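/- Fix the standard unit-cost word RAM model, in which the word length is logarithmic in the input size plus the running time. All-Pairs Max-Flow in uncapacitated graphs is the following problem: given a simple directed graph $G=(V,E)$ with $n=|V|$ nodes and $m=|E|$ edges, all of capacity $1$, output for every ordered pair of distinct nodes $u,v\in V$ the maximum value of a flow from $u$ to $v$ in $G$. MAX-CNF-SAT asks, given a CNF formula, for the maximum number of its clauses that can be satisfied by one assignment. SETH is the statement that for every $\varepsilon'>0$ there is an integer $k\ge 3$ such that $k$SAT on $n'$ variables and $m'$ clauses cannot be solved in time $2^{(1-\varepsilon')n'}\,\mathrm{poly}(m')$. For every $\varepsilon>0$ there is a $\delta=\delta(\varepsilon)>0$ such that for every $c\in[1,2]$ the following holds. If All-Pairs Max-Flow in uncapacitated directed graphs with $n$ nodes and $m=\tilde\Theta(n^{c})$ edges (that is, for every fixed choice of $K>0$ and $k\in\mathbb{N}$, in the graphs with $n\ge 2$, $n^c\le K(\log n)^k\,m$ and $m\le K(\log n)^k\,n^c$) can be solved in time $O((nm)^{1-\varepsilon})$, then MAX-CNF-SAT on $n'$ variables and $O(n')$ clauses can be solved in time $O(2^{(1-\delta)n'})$, and moreover SETH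 is false. -/

import Mathlib

/-! ## Machine model: word RAM with structured programs -/

namespace WordRAM

/-- Arithmetic and bitwise word operations (subtraction is truncated, division rounds down). -/
inductive Op
  | add | sub | mul | div | mod | and | or | xor

/-- The function computed by a word operation. -/
def Op.eval : Op → ℕ → ℕ → ℕ
  | .add, x, y => x + y
  | .sub, x, y => x - y
  | .mul, x, y => x * y
  | .div, x, y => x / y
  | .mod, x, y => x % y
  | .and, x, y => x &&& y
  | .or, x, y => x ||| y
  | .xor, x, y => x ^^^ y

/-- Programs. Registers and arrays are named by natural numbers; a program mentions only finitely
many of them. Arrays are random access memories, indexed by the contents of a register. -/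
inductive Prog
  /-- do nothing -/
  | skip
  /-- `r := c` -/
  | const (r c : ℕ)
  /-- `r := a o b` for registers `r`, `a`, `b` -/
  | op (o : Op) (r a b : ℕ)
  /-- `r := A[i]` for registers `r`, `i` and an array `A` -/
  | load (r A i : ℕ)
  /-- `A[i] := r` for registers `r`, `i` and an array `A` -/
  | store (A i r : ℕ)
  /-- first `p`, then `q` -/
  | seq (p q : Prog)
  /-- if register `r` is nonzero then `p` else `q` -/
  | ite (r : ℕ) (p q : Prog)
  /-- while register `r` is nonzero do `p` -/
  | loop (r : ℕ) (p : Prog)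

/-- Contents of all registers and all array cells. -/
structure State where
  reg : ℕ → ℕ
  mem : ℕ → ℕ → ℕ

/-- Overwrite register `r`. -/
def State.setReg (s : State) (r v : ℕ) : State :=
  { s with reg := Function.update s.reg r v }

/-- Overwrite cell `i` of array `A`. -/
def State.setMem (s : State) (A i v : ℕ) : State :=
  { s with mem := Function.update s.mem A (Function.update (s.mem A) i v) }

/-- `Exec B p s s' t`: started in state `s`, the program `p` halts in state `s'` after exactly `t`
unit-cost steps, and every value it computes on the way is smaller than `B`. -/
inductive Exec (B : ℕ) : Prog → State → State → ℕ → Prop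
  | skip (s : State) : Exec B .skip s s 1
  | const (s : State) (r c : ℕ) (h : c < B) : Exec B (.const r c) s (s.setReg r c) 1
  | op (s : State) (o : Op) (r a b : ℕ) (h : o.eval (s.reg a) (s.reg b) < B) :
      Exec B (.op o r a b) s (s.setReg r (o.eval (s.reg a) (s.reg b))) 1
  | load (s : State) (r A i : ℕ) :
      Exec B (.load r A i) s (s.setReg r (s.mem A (s.reg i))) 1
  | store (s : State) (A i r : ℕ) :
      Exec B (.store A i r) s (s.setMem A (s.reg i) (s.reg r)) 1
  | seq {p q : Prog} {s s₁ s₂ : State} {t₁ t₂ : ℕ} (hp : Exec B p s s₁ t₁)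
      (hq : Exec B q s₁ s₂ t₂) : Exec B (.seq p q) s s₂ (t₁ + t₂)
  | iteTrue {r : ℕ} {p q : Prog} {s s₁ : State} {t : ℕ} (h : s.reg r ≠ 0)
      (hp : Exec B p s s₁ t) : Exec B (.ite r p q) s s₁ (t + 1)
  | iteFalse {r : ℕ} {p q : Prog} {s s₁ : State} {t : ℕ} (h : s.reg r = 0)
      (hq : Exec B q s s₁ t) : Exec B (.ite r p q) s s₁ (t + 1)
  | loopDone {r : ℕ} {p : Prog} {s : State} (h : s.reg r = 0) : Exec B (.loop r p) s s 1
  | loopStep {r : ℕ} {p : Prog} {s s₁ s₂ : State} {t₁ t₂ : ℕ} (h : s.reg r ≠ 0)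
      (hp : Exec B p s s₁ t₁) (hl : Exec B (.loop r p) s₁ s₂ t₂) :
      Exec B (.loop r p) s s₂ (t₁ + t₂ + 1)

/-- Initial state: the input is stored in array `0`; all other cells and all registers are `0`. -/
def init (x : List ℕ) : State where
  reg := fun _ => 0
  mem := fun A i => if A = 0 then x.getD i 0 else 0

/-- `SolvableInTime P enc correct T`: there is one program that, on every instance `x` satisfying
the promise `P`, halts within `O(T x)` steps with a correct output (read in array `1`), on words of
`O(log (N + T x))` bits, where `N` (number of input words plus their sum) is the input size.
The word length is `w`: the input words and all computed values are smaller than `2 ^ w`. -/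
def SolvableInTime {ι : Type} (P : ι → Prop) (enc : ι → List ℕ)
    (correct : ι → (ℕ → ℕ) → Prop) (T : ι → ℝ) : Prop :=
  ∃ (p : Prog) (C κ : ℕ), ∀ x : ι, P x →
    ∃ (w t : ℕ) (s : State),
      (2 : ℝ) ^ w ≤ C * (((enc x).length + (enc x).sum : ℕ) + T x) ^ κ ∧
      (∀ v ∈ enc x, v < 2 ^ w) ∧
      Exec (2 ^ w) p (init (enc x)) s t ∧
      (t : ℝ) ≤ C * T x ∧
      correct x (s.mem 1)

end WordRAM

/-! ## All-Pairs Max-Flow in uncapacitated directed graphs -/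

/-- `f` is a feasible `s`-`t` flow in the directed network with capacities `cap`. -/
structure IsFlow {V : Type} [Fintype V] (cap : V → V → ℝ) (s t : V) (f : V → V → ℝ) : Prop where
  nonneg : ∀ u v, 0 ≤ f u v
  le_cap : ∀ u v, f u v ≤ cap u v
  conserve : ∀ v, v ≠ s → v ≠ t → ∑ u, f u v = ∑ u, f v u

/-- The value of a flow: the net amount leaving the source. -/
noncomputable def flowValue {V : Type} [Fintype V] (f : V → V → ℝ) (s : V) : ℝ :=
  ∑ v, f s v - ∑ v, f v s

/-- `x` is the maximum value of an `s`-`t` flow. -/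
def IsMaxFlowValue {V : Type} [Fintype V] (cap : V → V → ℝ) (s t : V) (x : ℝ) : Prop :=
  IsGreatest {y : ℝ | ∃ f : V → V → ℝ, IsFlow cap s t f ∧ flowValue f s = y} x

/-- A simple directed graph on the nodes `0, …, n - 1`, given by the list of its edges
(antiparallel edges are allowed). -/
structure EdgeListGraph where
  n : ℕ
  edges : List (Fin n × Fin n)
  nodup : edges.Nodup
  loopless : ∀ e ∈ edges, e.1 ≠ e.2

namespace EdgeListGraph

/-- Number of edges. -/
def m (G : EdgeListGraph) : ℕ := G.edges.length

/-- Every edge has capacity `1`. -/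
noncomputable def unitCap (G : EdgeListGraph) (u v : Fin G.n) : ℝ :=
  if (u, v) ∈ G.edges then 1 else 0

/-- Input format: `n`, `m`, and the endpoints of the edges. -/
def encode (G : EdgeListGraph) : List ℕ :=
  G.n :: G.m :: G.edges.flatMap fun e => [e.1.val, e.2.val]

/-- The output table holds, for every ordered pair of distinct nodes `u`, `v`, the maximum flow
value from `u` to `v` in cell `u * n + v`. -/
def AllPairsMaxFlow (G : EdgeListGraph) (out : ℕ → ℕ) : Prop :=
  ∀ u v : Fin G.n, u ≠ v → IsMaxFlowValue G.unitCap u v (out (u.val * G.n + v.val))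

/-- The class of graphs with `m = Θ̃(n ^ c)` edges, with explicit constants: `m` and `n ^ c` agree
up to the factor `K * (log n) ^ k`. -/
def HasDensity (c K : ℝ) (k : ℕ) (G : EdgeListGraph) : Prop :=
  2 ≤ G.n ∧ (G.n : ℝ) ^ c ≤ K * Real.log G.n ^ k * G.m ∧
    (G.m : ℝ) ≤ K * Real.log G.n ^ k * (G.n : ℝ) ^ c

end EdgeListGraph

/-- All-Pairs Max-Flow in uncapacitated graphs with `n` nodes and `m = Θ̃(n ^ c)` edges can be
solved in time `O((n m) ^ (1 - ε))`: for every choice of the constants hidden in `Θ̃` there is an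
algorithm for the corresponding class of graphs. -/
def UncapAllPairsSolvable (ε c : ℝ) : Prop :=
  ∀ (K : ℝ) (k : ℕ), WordRAM.SolvableInTime (EdgeListGraph.HasDensity c K k)
    EdgeListGraph.encode EdgeListGraph.AllPairsMaxFlow
    (fun G => ((G.n : ℝ) * (G.m : ℝ)) ^ (1 - ε))

/-! ## CNF formulas, MAX-CNF-SAT, k-SAT and the Strong Exponential Time Hypothesis -/

/-- A CNF formula with variables `0, …, n - 1`. A literal is a variable with a sign; a clause is a
list of distinct literals. -/
structure CNFFormula where
  n : ℕ
  clauses : List (List (Fin n × Bool))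
  nodup : ∀ c ∈ clauses, c.Nodup

namespace CNFFormula

/-- Number of clauses. -/
def m (F : CNFFormula) : ℕ := F.clauses.length

/-- The assignment `a` satisfies a clause if it makes one of its literals true. -/
def satClause {n : ℕ} (a : Fin n → Bool) (c : List (Fin n × Bool)) : Bool :=
  c.any fun l => a l.1 == l.2

/-- Number of clauses satisfied by `a`. -/
def numSat (F : CNFFormula) (a : Fin F.n → Bool) : ℕ :=
  F.clauses.countP (satClause a)

/-- Some assignment satisfies all clauses. -/
def Satisfiable (F : CNFFormula) : Prop :=
  ∃ a : Fin F.n → Bool, ∀ c ∈ F.clauses, satClause a c = true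

/-- Input format: `n`, `m`, and for every clause its length followed by its literals, where the
literals `xᵢ` and `¬ xᵢ` are coded as `2 * i + 1` and `2 * i`. -/
def encode (F : CNFFormula) : List ℕ :=
  F.n :: F.m :: F.clauses.flatMap fun c =>
    c.length :: c.map fun l => 2 * l.1.val + l.2.toNat

/-- Correct output of MAX-CNF-SAT: the maximum number of clauses satisfied by one assignment. -/
def MaxSatOutput (F : CNFFormula) (out : ℕ → ℕ) : Prop :=
  IsGreatest (Set.range F.numSat) (out 0)

/-- Correct output of SAT: `1` if the formula is satisfiable and `0` if it is not. -/
def SatOutput (F : CNFFormula) (out : ℕ → ℕ) : Prop :=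
  (F.Satisfiable ∧ out 0 = 1) ∨ (¬ F.Satisfiable ∧ out 0 = 0)

end CNFFormula

/-- MAX-CNF-SAT on `n` variables and `O(n)` clauses can be solved in time `O(2 ^ ((1 - δ) n))`. -/
def MaxCNFSATSolvable (δ : ℝ) : Prop :=
  ∀ D : ℕ, WordRAM.SolvableInTime (fun F : CNFFormula => F.m ≤ D * F.n)
    CNFFormula.encode CNFFormula.MaxSatOutput
    (fun F => (2 : ℝ) ^ ((1 - δ) * (F.n : ℝ)))

/-- k-SAT (clauses with at most `k` literals) on `n` variables and `m` clauses can be solved in time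
`2 ^ ((1 - ε) n) poly(m)`. -/
def KSATSolvable (k : ℕ) (ε : ℝ) : Prop :=
  ∃ d : ℕ, WordRAM.SolvableInTime (fun F : CNFFormula => ∀ c ∈ F.clauses, c.length ≤ k)
    CNFFormula.encode CNFFormula.SatOutput
    (fun F => (2 : ℝ) ^ ((1 - ε) * (F.n : ℝ)) * ((F.m : ℝ) + 1) ^ d)

/-- The Strong Exponential Time Hypothesis. -/
def SETH : Prop :=
  ∀ ε : ℝ, 0 < ε → ∃ k : ℕ, 3 ≤ k ∧ ¬ KSATSolvable k ε

namespace WordRAM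

/-! ### Expressions and a Hoare-style calculus with running times -/

/-! The variables are split into blocks of sizes `a`, `a` and `b = min a g`, with partial
assignments α, β, γ. In the graph of the reduction every α is a source, every slot t = (γ, i), a
third-block assignment with a clause, is a middle node in two copies, and every pair (β, p) of an
assignment and a threshold is a sink. The source α has one unit edge per slot, to the copy that
records whether both α and γ leave clause i unsatisfied. If they do and β leaves it unsatisfied too,
the unit has a direct edge to the sink; otherwise it must pass through one of the p + 1 slack nodes
of γ that lead to (β, p). Hence all edges out of α can be saturated exactly if, for every γ, at most
p + 1 slots are satisfied by (α, β, γ). The lower bound comes from edge-disjoint walks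
(`Valid.exists_saturating_flow`), the upper bound from a cut (`Valid.value_lt`), and
`Valid.isMaxFlowValue_iff` combines them. So the flow values tell which pairs (α, β) extend to a
good assignment.

Up to factors polynomial in the number of clauses the graph has N ≈ 2^a nodes and, after padding, M
≈ 2^(a+g) edges, with NM ≈ 2^n; time (NM)^(1-ε) therefore means about 2^((1-ε)n). The exponent g is
chosen near (c-1)a, which gives M ≈ N^c (`exists_guess`, `hasDensity_graph`).

The real number c need not be computable, so the program tries all pairs (a, g). On a wrong guess
the flow algorithm may diverge or return garbage. It is therefore simulated with limited fuel, with
values reduced modulo a limit, inside a fresh window of memory (`Prog.limited_spec`). The flow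
values only select candidates, whose unsatisfied clauses are then counted exactly, so that a wrong
guess cannot push the best value below the optimum, while a right guess attains it
(`Runs.guessBody`, `exists_right_guess`).

Scanning the flow values of all pairs (α, β) takes time about 2^(2a), which the sizes alone do not
bound well enough. But all these values are positive and the memory is initially zero, so the flow
algorithm must have written that many cells itself: 2^(2a) is at most its running time
(`sq_le_of_exec`).

With r ≥ 3 and 1/r ≤ ε the total time is 2^(n - n/r) times a polynomial in n and m. Half of the
saving absorbs the polynomial in n, which gives δ = 1/(2r). The polynomial in m is harmless for
linearly many clauses, and for k-SAT it is allowed by the definition, so SETH fails without any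
sparsification. -/

theorem State.reg_setReg (s : State) (r v r' : ℕ) :
    (s.setReg r v).reg r' = if r' = r then v else s.reg r' := by
  simp [State.setReg, Function.update_apply]

theorem State.reg_setReg_self (s : State) (r v : ℕ) : (s.setReg r v).reg r = v := by
  simp [State.setReg]

theorem State.reg_setReg_of_ne {s : State} {r v r' : ℕ} (h : r' ≠ r) :
    (s.setReg r v).reg r' = s.reg r' := by
  simp [State.setReg, h]

theorem State.mem_setMem (s : State) (A i v A' j : ℕ) :
    (s.setMem A i v).mem A' j = if A' = A ∧ j = i then v else s.mem A' j := by
  simp only [State.setMem, Function.update_apply]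
  by_cases h : A' = A
  · subst h; simp [Function.update_apply]
  · simp [h]

/-- Arithmetic expressions over registers and array cells. -/
inductive Expr
  | lit (c : ℕ)
  | var (r : ℕ)
  | op (o : Op) (a b : Expr)
  | load (A : ℕ) (e : Expr)

namespace Expr

instance : Add Expr := ⟨.op .add⟩
instance : Sub Expr := ⟨.op .sub⟩
instance : Mul Expr := ⟨.op .mul⟩
instance : Div Expr := ⟨.op .div⟩
instance : Mod Expr := ⟨.op .mod⟩

/-- Value of an expression. -/
def eval (s : State) : Expr → ℕ
  | lit c => c
  | var r => s.reg r
  | op o a b => o.eval (a.eval s) (b.eval s)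
  | load A e => s.mem A (e.eval s)

/-- Code that evaluates an expression into register `d`, with scratch registers above `d`. -/
def code : Expr → ℕ → Prog
  | lit c, d => .const d c
  | var r, d => .op .or d r r
  | op o a b, d => .seq (a.code d) (.seq (b.code (d + 1)) (.op o d d (d + 1)))
  | load A e, d => .seq (e.code d) (.load d A d)

/-- Number of steps of the code of an expression. -/
def size : Expr → ℕ
  | lit _ => 1
  | var _ => 1
  | op _ a b => a.size + (b.size + 1)
  | load _ e => e.size + 1

/-- Number of scratch registers used by the code of an expression. -/
def depth : Expr → ℕ
  | lit _ => 1
  | var _ => 1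
  | op _ a b => max a.depth (b.depth + 1)
  | load _ e => e.depth

/-- A bound for the degree of an expression, as a polynomial in its leaves. -/
def deg : Expr → ℕ
  | lit _ => 1
  | var _ => 1
  | op _ a b => a.deg + b.deg
  | load _ e => e.deg

/-- All variables are below `64`. -/
def userVars : Expr → Bool
  | lit _ => true
  | var r => decide (r < 64)
  | op _ a b => a.userVars && b.userVars
  | load _ e => e.userVars

/-- Static well-formedness. -/
def wf (e : Expr) : Bool := e.userVars && decide (e.depth ≤ 60) && decide (e.deg ≤ 32)

/-- All values computed by the code of the expression are below `B`. -/
def Ok (B : ℕ) (s : State) : Expr → Prop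
  | lit c => c < B
  | var r => s.reg r < B
  | op o a b => a.Ok B s ∧ b.Ok B s ∧ o.eval (a.eval s) (b.eval s) < B
  | load _ e => e.Ok B s

/-- All leaves of the expression are below `V`. -/
def Bd (V : ℕ) (s : State) : Expr → Prop
  | lit c => c < V
  | var r => s.reg r < V
  | op _ a b => a.Bd V s ∧ b.Bd V s
  | load A e => e.Bd V s ∧ s.mem A (e.eval s) < V

section simps
variable (s : State) (V : ℕ) (a b : Expr) (n : ℕ)

@[simp] theorem eval_lit : (lit n).eval s = n := rfl
@[simp] theorem eval_var : (var n).eval s = s.reg n := rfl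
@[simp] theorem eval_load : (load n a).eval s = s.mem n (a.eval s) := rfl
@[simp] theorem eval_add : (a + b).eval s = a.eval s + b.eval s := rfl
@[simp] theorem eval_sub : (a - b).eval s = a.eval s - b.eval s := rfl
@[simp] theorem eval_mul : (a * b).eval s = a.eval s * b.eval s := rfl
@[simp] theorem eval_div : (a / b).eval s = a.eval s / b.eval s := rfl
@[simp] theorem eval_mod : (a % b).eval s = a.eval s % b.eval s := rfl
@[simp] theorem bd_lit : (lit n).Bd V s ↔ n < V := Iff.rfl
@[simp] theorem bd_var : (var n).Bd V s ↔ s.reg n < V := Iff.rfl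
@[simp] theorem bd_load : (load n a).Bd V s ↔ a.Bd V s ∧ s.mem n (a.eval s) < V := Iff.rfl
@[simp] theorem bd_add : (a + b).Bd V s ↔ a.Bd V s ∧ b.Bd V s := Iff.rfl
@[simp] theorem bd_sub : (a - b).Bd V s ↔ a.Bd V s ∧ b.Bd V s := Iff.rfl
@[simp] theorem bd_mul : (a * b).Bd V s ↔ a.Bd V s ∧ b.Bd V s := Iff.rfl
@[simp] theorem bd_div : (a / b).Bd V s ↔ a.Bd V s ∧ b.Bd V s := Iff.rfl
@[simp] theorem bd_mod : (a % b).Bd V s ↔ a.Bd V s ∧ b.Bd V s := Iff.rfl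

end simps

theorem depth_pos : ∀ e : Expr, 1 ≤ e.depth
  | lit _ => le_refl _
  | var _ => le_refl _
  | op _ a _ => le_max_of_le_left a.depth_pos
  | load _ e => e.depth_pos

theorem deg_pos : ∀ e : Expr, 1 ≤ e.deg
  | lit _ => le_refl _
  | var _ => le_refl _
  | op _ a _ => le_trans a.deg_pos (Nat.le_add_right _ _)
  | load _ e => e.deg_pos

end Expr


/-- Multiplication dictates the exponent `a + b`; positive exponents let the sum fit under it as
well. Bit lengths thus add up along an expression, which is what `Expr.deg` counts. -/
theorem Op.eval_lt_two_pow (o : Op) {x y a b : ℕ} (ha : 1 ≤ a) (hb : 1 ≤ b) (hx : x < 2 ^ a)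
    (hy : y < 2 ^ b) : o.eval x y < 2 ^ (a + b) := by
  have h1 : 2 ^ a ≤ 2 ^ (a + b) := Nat.pow_le_pow_right (by norm_num) (by omega)
  have h2 : 2 ^ b ≤ 2 ^ (a + b) := Nat.pow_le_pow_right (by norm_num) (by omega)
  have hx' := hx.trans_le h1
  have hy' := hy.trans_le h2
  have hm : x * y < 2 ^ (a + b) := by
    rw [pow_add]; exact Nat.mul_lt_mul'' hx hy
  have ha2 : 2 ≤ 2 ^ a := by simpa using Nat.pow_le_pow_right (n := 2) (by norm_num) ha
  have hb2 : 2 ≤ 2 ^ b := by simpa using Nat.pow_le_pow_right (n := 2) (by norm_num) hb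
  have hs : x + y < 2 ^ (a + b) := by rw [pow_add]; nlinarith
  cases o <;> simp only [Op.eval]
  · exact hs
  · omega
  · exact hm
  · exact (Nat.div_le_self _ _).trans_lt hx'
  · exact (Nat.mod_le _ _).trans_lt hx'
  · exact Nat.and_le_left.trans_lt hx'
  · exact Nat.or_lt_two_pow hx' hy'
  · exact Nat.xor_lt_two_pow hx' hy'

namespace Expr

theorem eval_lt {v : ℕ} {s : State} (hv : 1 ≤ v) :
    ∀ {e : Expr}, e.Bd (2 ^ v) s → e.eval s < 2 ^ (v * e.deg)
  | lit _, h => by rw [deg, mul_one]; exact h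
  | var _, h => by rw [deg, mul_one]; exact h
  | op o a b, h => by
    rw [deg, mul_add]
    exact o.eval_lt_two_pow (Nat.mul_pos hv a.deg_pos) (Nat.mul_pos hv b.deg_pos)
      (eval_lt hv h.1) (eval_lt hv h.2)
  | load A e, h =>
    h.2.trans_le (Nat.pow_le_pow_right (by norm_num) (Nat.le_mul_of_pos_right _ e.deg_pos))

/-- A value of degree `d` in leaves of `v` bits has at most `d * v` bits, so bounding the leaves is
enough to rule out overflow in every intermediate result. -/
theorem ok_of_bd {v D : ℕ} {s : State} (hv : 1 ≤ v) :
    ∀ {e : Expr}, e.Bd (2 ^ v) s → e.deg ≤ D → e.Ok (2 ^ (D * v)) s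
  | lit c, h, hd => by
    have := eval_lt hv (e := lit c) h
    exact this.trans_le (Nat.pow_le_pow_right (by norm_num) (by rw [mul_comm]; gcongr))
  | var c, h, hd => by
    have := eval_lt hv (e := var c) h
    exact this.trans_le (Nat.pow_le_pow_right (by norm_num) (by rw [mul_comm]; gcongr))
  | op o a b, h, hd => by
    have := eval_lt hv (e := op o a b) h
    have hd' : a.deg + b.deg ≤ D := hd
    exact ⟨ok_of_bd hv h.1 (by omega), ok_of_bd hv h.2 (by omega),
      this.trans_le (Nat.pow_le_pow_right (by norm_num) (by rw [mul_comm]; gcongr))⟩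
  | load A e, h, hd => ok_of_bd (e := e) hv h.1 hd

theorem eval_congr {s s' : State} (hm : s.mem = s'.mem) (hr : ∀ r < 64, s.reg r = s'.reg r) :
    ∀ {e : Expr}, e.userVars → e.eval s = e.eval s'
  | lit c, _ => rfl
  | var r, h => hr r (by simpa [userVars] using h)
  | op o a b, h => by
    simp only [userVars, Bool.and_eq_true] at h
    simp only [eval, eval_congr hm hr h.1, eval_congr hm hr h.2]
  | load A e, h => by
    simp only [eval, eval_congr hm hr (e := e) h, hm]

theorem ok_congr {B : ℕ} {s s' : State} (hm : s.mem = s'.mem) (hr : ∀ r < 64, s.reg r = s'.reg r) :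
    ∀ {e : Expr}, e.userVars → e.Ok B s → e.Ok B s'
  | lit c, _, h => h
  | var r, h, h' => by
    simp only [Ok] at h' ⊢; rwa [← hr r (by simpa [userVars] using h)]
  | op o a b, h, h' => by
    simp only [userVars, Bool.and_eq_true] at h
    refine ⟨ok_congr hm hr h.1 h'.1, ok_congr hm hr h.2 h'.2.1, ?_⟩
    rw [← eval_congr hm hr h.1, ← eval_congr hm hr h.2]; exact h'.2.2
  | load A e, h, h' => ok_congr hm hr (e := e) h h'

/-- The value of the left operand is safe in register `d` while the right operand is evaluated,
because the code of the latter writes only from `d + 1` on. The variables lie below `64`, hence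
below all scratch registers. -/
theorem exec_code {B : ℕ} : ∀ (e : Expr) {s : State} {d : ℕ}, 64 ≤ d → e.userVars → e.Ok B s →
    ∃ s', Exec B (e.code d) s s' e.size ∧ s'.mem = s.mem ∧ s'.reg d = e.eval s ∧
      ∀ r, (r < d ∨ d + e.depth ≤ r) → s'.reg r = s.reg r
  | lit c, s, d, _, _, ho => ⟨_, .const s d c ho, rfl, by simp [State.setReg, eval], fun r hr => by
      have : r ≠ d := by simp only [depth] at hr; omega
      simp [State.setReg, this]⟩
  | var a, s, d, _, _, ho => by
    have := Exec.op (B := B) s .or d a a (by simpa [Op.eval] using (show s.reg a < B from ho))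
    refine ⟨_, this, rfl, by simp [State.setReg, eval, Op.eval], fun r hr => ?_⟩
    have : r ≠ d := by simp only [depth] at hr; omega
    simp [State.setReg, this]
  | op o a b, s, d, hd, hu, ho => by
    simp only [userVars, Bool.and_eq_true] at hu
    obtain ⟨s1, h1, m1, v1, f1⟩ := exec_code a (d := d) hd hu.1 ho.1
    have hag : ∀ r < 64, s.reg r = s1.reg r := fun r hr => (f1 r (by omega)).symm
    obtain ⟨s2, h2, m2, v2, f2⟩ := exec_code b (s := s1) (d := d + 1) (by omega) hu.2
      (ok_congr m1.symm hag hu.2 ho.2.1)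
    have hb : b.eval s1 = b.eval s := (eval_congr m1.symm hag hu.2).symm
    have h3 := Exec.op (B := B) s2 o d d (d + 1) (by
      rw [f2 d (by omega), v1, v2, hb]; exact ho.2.2)
    refine ⟨_, .seq h1 (.seq h2 h3), by simp [State.setReg, m1, m2], ?_, fun r hr => ?_⟩
    · simp [State.setReg, f2 d (by omega), v1, v2, hb, eval]
    · simp only [depth] at hr
      have : r ≠ d := by have := a.depth; omega
      simp only [State.setReg, Function.update_of_ne this]
      rw [f2 r (by omega), f1 r (by omega)]
  | load A e, s, d, hd, hu, ho => by
    obtain ⟨s1, h1, m1, v1, f1⟩ := exec_code e (d := d) hd hu ho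
    refine ⟨_, .seq h1 (.load s1 d A d), by simp [State.setReg, m1], ?_, fun r hr => ?_⟩
    · simp [State.setReg, v1, m1, eval]
    · simp only [depth] at hr
      by_cases h : r = d
      · subst h
        have := e.depth_pos
        omega
      · simp only [State.setReg, Function.update_of_ne h]
        exact f1 r hr

end Expr

/-- Two states agree up to the scratch registers `64, …, 127`. -/
def Sim (s s' : State) : Prop := s.mem = s'.mem ∧ ∀ r, (r < 64 ∨ 128 ≤ r) → s.reg r = s'.reg r

theorem Sim.refl (s : State) : Sim s s := ⟨rfl, fun _ _ => rfl⟩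

/-- Started in `s` (up to scratch registers), the program `p` halts within `T` steps on words of
`32 * v` bits in a state that satisfies `Q` (up to scratch registers). -/
def Runs (v : ℕ) (p : Prog) (s : State) (Q : State → Prop) (T : ℕ) : Prop :=
  ∀ s₀, Sim s₀ s → ∃ s₁ t s', Exec (2 ^ (32 * v)) p s₀ s₁ t ∧ t ≤ T ∧ Sim s₁ s' ∧ Q s'

theorem Runs.mono {v : ℕ} {p : Prog} {s : State} {Q Q' : State → Prop} {T T' : ℕ}
    (h : Runs v p s Q T) (hQ : ∀ s, Q s → Q' s) (hT : T ≤ T') : Runs v p s Q' T' := fun s₀ hs => by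
  obtain ⟨s₁, t, s', h1, h2, h3, h4⟩ := h s₀ hs
  exact ⟨s₁, t, s', h1, h2.trans hT, h3, hQ _ h4⟩

theorem Runs.le {v : ℕ} {p : Prog} {s : State} {Q : State → Prop} {T T' : ℕ}
    (h : Runs v p s Q T) (hT : T ≤ T') : Runs v p s Q T' := h.mono (fun _ h => h) hT

theorem Runs.seq {v : ℕ} {p q : Prog} {s : State} {Q R : State → Prop} {T T' : ℕ}
    (h : Runs v p s Q T) (h' : ∀ s', Q s' → Runs v q s' R T') :
    Runs v (.seq p q) s R (T + T') := fun s₀ hs => by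
  obtain ⟨s₁, t, s', h1, h2, h3, h4⟩ := h s₀ hs
  obtain ⟨s₂, t', s'', g1, g2, g3, g4⟩ := h' s' h4 s₁ h3
  exact ⟨s₂, _, s'', .seq h1 g1, by omega, g3, g4⟩

theorem Runs.skip {v : ℕ} {s : State} {Q : State → Prop} (h : Q s) : Runs v .skip s Q 1 :=
  fun s₀ hs => ⟨s₀, 1, s, .skip _, le_refl _, hs, h⟩

/-- `r := e` -/
def assign (r : ℕ) (e : Expr) : Prog := .seq (e.code 64) (.op .or r 64 64)

/-- `A[i] := e` -/
def put (A : ℕ) (i e : Expr) : Prog := .seq (i.code 64) (.seq (e.code 65) (.store A 64 65))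

/-- If `e` is nonzero then `p` else `q`. -/
def cond (e : Expr) (p q : Prog) : Prog := .seq (e.code 64) (.ite 64 p q)

/-- For `i = 0, …, e - 1` do `p`; the register `c` counts the remaining rounds. -/
def forLoop (i c : ℕ) (e : Expr) (p : Prog) : Prog :=
  .seq (assign c e) (.seq (assign i (.lit 0)) (.loop c (.seq p
    (.seq (assign i (.var i + .lit 1)) (assign c (.var c - .lit 1))))))

theorem Expr.wf_spec {e : Expr} (h : e.wf = true) :
    e.userVars = true ∧ e.depth ≤ 60 ∧ e.deg ≤ 32 := by
  simpa [Expr.wf, and_assoc] using h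

theorem Runs.code {v : ℕ} {s s₀ : State} {e : Expr} {d : ℕ} (hd : d = 64 ∨ d = 65)
    (hw : e.wf = true) (hv : 1 ≤ v) (hb : e.Bd (2 ^ v) s) (hs : Sim s₀ s) :
    ∃ s₁, Exec (2 ^ (32 * v)) (e.code d) s₀ s₁ e.size ∧ Sim s₁ s ∧ s₁.reg d = e.eval s ∧
      ∀ r < d, s₁.reg r = s₀.reg r := by
  obtain ⟨h1, h2, h3⟩ := Expr.wf_spec hw
  have ho := Expr.ok_congr hs.1.symm (fun r hr => (hs.2 r (.inl hr)).symm) h1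
    (Expr.ok_of_bd hv hb h3)
  obtain ⟨s₁, g1, g2, g3, g4⟩ := e.exec_code (d := d) (by omega) h1 ho
  exact ⟨s₁, g1, ⟨g2.trans hs.1, fun r hr => (g4 r (by omega)).trans (hs.2 r hr)⟩,
    g3.trans (Expr.eval_congr hs.1 (fun r hr => hs.2 r (.inl hr)) h1), fun r hr => g4 r (.inl hr)⟩

theorem Expr.eval_lt_bound {v : ℕ} {s : State} {e : Expr} (hw : e.wf = true) (hv : 1 ≤ v)
    (hb : e.Bd (2 ^ v) s) : e.eval s < 2 ^ (32 * v) :=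
  (Expr.eval_lt hv hb).trans_le (Nat.pow_le_pow_right (by norm_num)
    (by rw [mul_comm]; exact Nat.mul_le_mul_right _ (Expr.wf_spec hw).2.2))

theorem Expr.wf_var_op_one {o : Op} {i n : ℕ} (hi : i < 64) :
    (Expr.op o (.var i) (.lit n)).wf = true := by
  simp [wf, userVars, depth, deg, hi]

theorem Sim.setReg {s s' : State} (h : Sim s s') (r x : ℕ) :
    Sim (s.setReg r x) (s'.setReg r x) :=
  ⟨h.1, fun r' hr' => by
    by_cases hrr : r' = r
    · subst hrr; simp [State.setReg]
    · simp [State.setReg, hrr, h.2 r' hr']⟩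

theorem Runs.assign {v : ℕ} {s : State} {Q : State → Prop} {r : ℕ} {e : Expr}
    (hw : e.wf = true) (hv : 1 ≤ v) (hb : e.Bd (2 ^ v) s) (hQ : Q (s.setReg r (e.eval s))) :
    Runs v (assign r e) s Q (e.size + 1) := fun s₀ hs => by
  obtain ⟨s₁, h1, h2, h3, -⟩ := Runs.code (.inl rfl) hw hv hb hs
  have h4 := Exec.op (B := 2 ^ (32 * v)) s₁ .or r 64 64 (by
    simpa [Op.eval, h3] using Expr.eval_lt_bound hw hv hb)
  refine ⟨_, _, _, .seq h1 h4, le_refl _, ?_, hQ⟩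
  simpa [Op.eval, h3] using h2.setReg r (e.eval s)

theorem Runs.put {v : ℕ} {s : State} {Q : State → Prop} {A : ℕ} {i e : Expr}
    (hwi : i.wf = true) (hw : e.wf = true) (hv : 1 ≤ v) (hbi : i.Bd (2 ^ v) s)
    (hb : e.Bd (2 ^ v) s) (hQ : Q (s.setMem A (i.eval s) (e.eval s))) :
    Runs v (put A i e) s Q (i.size + (e.size + 1)) := fun s₀ hs => by
  obtain ⟨s₁, h1, h2, h3, -⟩ := Runs.code (.inl rfl) hwi hv hbi hs
  obtain ⟨s₂, g1, g2, g3, g4⟩ := Runs.code (.inr rfl) hw hv hb h2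
  refine ⟨_, _, _, .seq h1 (.seq g1 (.store s₂ A 64 65)), le_refl _, ?_, hQ⟩
  rw [g3, g4 64 (by norm_num), h3]
  exact ⟨by simp [State.setMem, g2.1], g2.2⟩

theorem Runs.cond {v : ℕ} {s : State} {Q : State → Prop} {e : Expr} {p q : Prog} {T : ℕ}
    (hw : e.wf = true) (hv : 1 ≤ v) (hb : e.Bd (2 ^ v) s)
    (hp : e.eval s ≠ 0 → Runs v p s Q T) (hq : e.eval s = 0 → Runs v q s Q T) :
    Runs v (cond e p q) s Q (e.size + (T + 1)) := fun s₀ hs => by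
  obtain ⟨s₁, h1, h2, h3, -⟩ := Runs.code (.inl rfl) hw hv hb hs
  by_cases h : e.eval s = 0
  · obtain ⟨s₂, t, s', g1, g2, g3, g4⟩ := hq h s₁ h2
    exact ⟨s₂, _, s', .seq h1 (.iteFalse (h3.trans h) g1), by omega, g3, g4⟩
  · obtain ⟨s₂, t, s', g1, g2, g3, g4⟩ := hp h s₁ h2
    exact ⟨s₂, _, s', .seq h1 (.iteTrue (h3 ▸ h) g1), by omega, g3, g4⟩

/-- Induction on the number `j` of remaining rounds. The two control registers are rewritten after
each body, so the invariant has to ignore them (`hst`). The `9` extra steps per round are two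
updates of cost `4` and the loop test. -/
theorem Runs.loop {v : ℕ} {p : Prog} {i c : ℕ} (hi : i < 64) (hc : c < 64) (hic : i ≠ c)
    (hv : 1 ≤ v) {I : ℕ → State → Prop} {N T : ℕ} (hN : N < 2 ^ v)
    (hst : ∀ k s x y, I k s → I k ((s.setReg i x).setReg c y))
    (hstep : ∀ k, k < N → ∀ s, I k s → s.reg i = k →
      Runs v p s (fun s' => s'.reg i = k ∧ s'.reg c = s.reg c ∧ I (k + 1) s') T) :
    ∀ (j k : ℕ), k + j = N → ∀ s, I k s → s.reg i = k → s.reg c = j →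
    Runs v (.loop c (.seq p (.seq (WordRAM.assign i (.var i + .lit 1))
      (WordRAM.assign c (.var c - .lit 1))))) s (I N) (j * (T + 9) + 1) := by
  intro j
  have h2v : 2 ≤ 2 ^ v := by simpa using Nat.pow_le_pow_right (n := 2) (by norm_num) hv
  induction j with
  | zero =>
    intro k hk s hI h1 h2 s₀ hs
    have : k = N := by omega
    subst this
    exact ⟨s₀, 1, s, .loopDone (by rw [hs.2 c (.inl hc), h2]), by omega, hs, hI⟩
  | succ j ih =>
    intro k hk s hI h1 h2 s₀ hs
    have hbody : Runs v (.seq p (.seq (WordRAM.assign i (.var i + .lit 1))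
      (WordRAM.assign c (.var c - .lit 1)))) s (fun s' => I (k + 1) s' ∧ s'.reg i = k + 1 ∧
        s'.reg c = j) (T + (4 + 4)) := by
      refine (hstep k (by omega) s hI h1).seq fun s' hs' => ?_
      refine Runs.seq (Q := fun s'' => s'' = s'.setReg i (k + 1))
        (Runs.assign (Expr.wf_var_op_one hi) hv
          ⟨by simp only [Expr.Bd]; omega, by simp only [Expr.Bd]; omega⟩ (by simp [hs'.1])) fun s'' hs'' => ?_
      · subst hs''
        refine Runs.assign (Expr.wf_var_op_one hc) hv ⟨?_, by simp only [Expr.Bd]; omega⟩ ?_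
        · simp only [Expr.Bd, State.setReg, Function.update_of_ne hic.symm, hs'.2.1]; omega
        · refine ⟨hst _ _ _ _ hs'.2.2, by simp [State.setReg, hic], ?_⟩
          simp [State.setReg, hic.symm, hs'.2.1, h2]
    obtain ⟨s₁, t, s', g1, g2, g3, g4⟩ := hbody s₀ hs
    obtain ⟨s₂, t', s'', e1, e2, e3, e4⟩ := ih (k + 1) (by omega) s' g4.1 g4.2.1 g4.2.2 s₁ g3
    refine ⟨s₂, _, s'', .loopStep (by rw [hs.2 c (.inl hc), h2]; omega) g1 e1, ?_, e3, e4⟩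
    rw [Nat.succ_mul]; omega

theorem Runs.forLoop {v : ℕ} {p : Prog} {i c : ℕ} {e : Expr} {s : State} {Q : State → Prop}
    (I : ℕ → State → Prop) {N T : ℕ} (hi : i < 64) (hc : c < 64) (hic : i ≠ c)
    (hv : 1 ≤ v) (hw : e.wf = true) (hb : e.Bd (2 ^ v) s) (hNe : e.eval s = N) (hN : N < 2 ^ v)
    (hst : ∀ k s x y, I k s → I k ((s.setReg i x).setReg c y))
    (h0 : I 0 s)
    (hstep : ∀ k, k < N → ∀ s, I k s → s.reg i = k →
      Runs v p s (fun s' => s'.reg i = k ∧ s'.reg c = s.reg c ∧ I (k + 1) s') T)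
    (hQ : ∀ s, I N s → Q s) :
    Runs v (forLoop i c e p) s Q (e.size + (N * (T + 9) + 4)) := by
  have h : Runs v (WordRAM.forLoop i c e p) s (I N) ((e.size + 1) + (2 + (N * (T + 9) + 1))) := by
    refine Runs.seq (Q := fun s' => s' = s.setReg c N) (Runs.assign hw hv hb (by rw [hNe]))
      fun s' hs' => ?_
    refine Runs.seq (Q := fun s' => s' = (s.setReg i 0).setReg c N) (Runs.assign rfl hv ?_ ?_)
      fun s' hs' => ?_
    · exact Nat.two_pow_pos _
    · subst hs'
      simp only [State.setReg, Expr.eval]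
      rw [Function.update_comm hic]
    · subst hs'
      refine Runs.loop hi hc hic hv hN hst hstep N 0 (by omega) _ (hst _ _ _ _ h0) ?_ ?_
      · simp [State.setReg, hic]
      · simp [State.setReg]
  exact h.mono hQ (by omega)

theorem Runs.assign_seq {v : ℕ} {s : State} {Q : State → Prop} {r x T : ℕ} {e : Expr} {q : Prog}
    (hw : e.wf = true) (hv : 1 ≤ v) (hb : e.Bd (2 ^ v) s) (he : e.eval s = x)
    (h : Runs v q (s.setReg r x) Q T) :
    Runs v (.seq (WordRAM.assign r e) q) s Q (e.size + 1 + T) := by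
  subst he
  exact (Runs.assign (Q := fun z => z = _) hw hv hb rfl).seq fun z hz => hz ▸ h

theorem Runs.put_seq {v : ℕ} {s : State} {Q : State → Prop} {A j x T : ℕ} {i e : Expr} {q : Prog}
    (hwi : i.wf = true) (hw : e.wf = true) (hv : 1 ≤ v) (hbi : i.Bd (2 ^ v) s)
    (hb : e.Bd (2 ^ v) s) (hi : i.eval s = j) (he : e.eval s = x)
    (h : Runs v q (s.setMem A j x) Q T) :
    Runs v (.seq (WordRAM.put A i e) q) s Q (i.size + (e.size + 1) + T) := by
  subst he hi
  exact (Runs.put (Q := fun z => z = _) hwi hw hv hbi hb rfl).seq fun z hz => hz ▸ h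

theorem Runs.assign' {v : ℕ} {s : State} {Q : State → Prop} {r x : ℕ} {e : Expr}
    (hw : e.wf = true) (hv : 1 ≤ v) (hb : e.Bd (2 ^ v) s) (he : e.eval s = x)
    (hQ : Q (s.setReg r x)) : Runs v (WordRAM.assign r e) s Q (e.size + 1) :=
  Runs.assign hw hv hb (he ▸ hQ)

theorem Runs.put' {v : ℕ} {s : State} {Q : State → Prop} {A j x : ℕ} {i e : Expr}
    (hwi : i.wf = true) (hw : e.wf = true) (hv : 1 ≤ v) (hbi : i.Bd (2 ^ v) s)
    (hb : e.Bd (2 ^ v) s) (hi : i.eval s = j) (he : e.eval s = x)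
    (hQ : Q (s.setMem A j x)) : Runs v (WordRAM.put A i e) s Q (i.size + (e.size + 1)) :=
  Runs.put hwi hw hv hbi hb (by rw [hi, he]; exact hQ)

end WordRAM

namespace WordRAM

/-! ### Fuel-limited execution inside a window of memory -/

/-- Registers at or above this bound are never written by the program. -/
def Prog.regBound : Prog → ℕ
  | .skip => 0
  | .const r _ => r + 1
  | .op _ r _ _ => r + 1
  | .load r _ _ => r + 1
  | .store _ _ _ => 0
  | .seq p q => max p.regBound q.regBound
  | .ite _ p q => max p.regBound q.regBound
  | .loop _ p => p.regBound

/-- A bound for the constants of a program. -/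
def Prog.constBound : Prog → ℕ
  | .const _ c => c + 1
  | .seq p q => max p.constBound q.constBound
  | .ite _ p q => max p.constBound q.constBound
  | .loop _ p => p.constBound
  | _ => 0

/-- Register with the limit for all values. -/
notation "rLim" => (6 : ℕ)
/-- Register with the start of the memory window. -/
notation "rOff" => (7 : ℕ)
/-- Register with the fuel. -/
notation "rFuel" => (40 : ℕ)
/-- Register with the loop guard. -/
notation "rGuard" => (41 : ℕ)
/-- Register for addresses. -/
notation "rAddr" => (42 : ℕ)
/-- Register with the constant `1`. -/
notation "rOne" => (43 : ℕ)

/-- Simulation of a program: registers are shifted by `128` and arrays by `16`, values are reduced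
modulo the limit, addresses are relative to the window, and every round of a loop costs a unit of
fuel. -/
def Prog.limited : Prog → Prog
  | .skip => .skip
  | .const r c => .seq (.const (r + 128) c) (.op .mod (r + 128) (r + 128) rLim)
  | .op o r a b => .seq (.op o (r + 128) (a + 128) (b + 128)) (.op .mod (r + 128) (r + 128) rLim)
  | .load r A i => .seq (.op .add rAddr (i + 128) rOff) (.load (r + 128) (A + 16) rAddr)
  | .store A i r => .seq (.op .add rAddr (i + 128) rOff) (.store (A + 16) rAddr (r + 128))
  | .seq p q => .seq p.limited q.limited
  | .ite r p q => .ite (r + 128) p.limited q.limited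
  | .loop r p => .seq (.op .mul rGuard (r + 128) rFuel) (.loop rGuard
      (.seq (.op .sub rFuel rFuel rOne) (.seq p.limited (.op .mul rGuard (r + 128) rFuel))))

/-- Time of the simulation per unit of fuel. -/
def Prog.limitedCost : Prog → ℕ
  | .seq p q => p.limitedCost + q.limitedCost
  | .ite _ p q => p.limitedCost + q.limitedCost + 1
  | .loop _ p => p.limitedCost + 3
  | _ => 2

/-- `S` represents the state `s` of the simulated program. -/
def Represents (lim off : ℕ) (s S : State) : Prop :=
  (∀ r, s.reg r = S.reg (r + 128)) ∧ ∀ A i, i < lim → s.mem A i = S.mem (A + 16) (off + i)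

/-- Invariant of the simulation. -/
structure LimInv (lim off fuel : ℕ) (S : State) : Prop where
  hlim : S.reg rLim = lim
  hoff : S.reg rOff = off
  hfuel : S.reg rFuel = fuel
  one : S.reg rOne = 1
  reg : ∀ r, S.reg (r + 128) < lim
  mem : ∀ A i, S.mem (A + 16) i < lim

/-- The simulation does not touch anything but its own registers and the window. -/
structure LimFrame (lim off bound : ℕ) (S S' : State) : Prop where
  reg : ∀ r < 128, r ≠ rFuel → r ≠ rGuard → r ≠ rAddr → S'.reg r = S.reg r
  regBound : ∀ r, bound ≤ r → S'.reg (r + 128) = S.reg (r + 128)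
  mem : ∀ A < 16, S'.mem A = S.mem A
  window : ∀ A i, (i < off ∨ off + lim ≤ i) → S'.mem (A + 16) i = S.mem (A + 16) i

theorem LimFrame.refl (lim off bound : ℕ) (S : State) : LimFrame lim off bound S S :=
  ⟨fun _ _ _ _ _ => rfl, fun _ _ => rfl, fun _ _ => rfl, fun _ _ _ => rfl⟩

theorem LimFrame.trans {lim off b : ℕ} {S S' S'' : State} (h : LimFrame lim off b S S')
    (h' : LimFrame lim off b S' S'') : LimFrame lim off b S S'' :=
  ⟨fun r h1 h2 h3 h4 => (h'.reg r h1 h2 h3 h4).trans (h.reg r h1 h2 h3 h4),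
    fun r hr => (h'.regBound r hr).trans (h.regBound r hr),
    fun A hA => (h'.mem A hA).trans (h.mem A hA),
    fun A i hi => (h'.window A i hi).trans (h.window A i hi)⟩

theorem LimFrame.mono {lim off b b' : ℕ} {S S' : State} (h : LimFrame lim off b S S')
    (hb : b ≤ b') : LimFrame lim off b' S S' :=
  ⟨h.reg, fun r hr => h.regBound r (hb.trans hr), h.mem, h.window⟩

theorem LimFrame.setReg {lim off b r x : ℕ} {S S' : State} (h : LimFrame lim off b S S')
    (hr : r = rFuel ∨ r = rGuard ∨ r = rAddr) : LimFrame lim off b S (S'.setReg r x) := by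
  have hlt : r < 128 := by rcases hr with rfl | rfl | rfl <;> norm_num
  refine ⟨fun r' h1 h2 h3 h4 => ?_, fun r' h1 => ?_, h.mem, h.window⟩
  · have : r' ≠ r := by rintro rfl; tauto
    simpa [State.setReg, this] using h.reg r' h1 h2 h3 h4
  · have : r' + 128 ≠ r := by omega
    simpa [State.setReg, this] using h.regBound r' h1

theorem LimFrame.setShifted {lim off b r x : ℕ} {S S' : State} (h : LimFrame lim off b S S')
    (hr : r < b) : LimFrame lim off b S (S'.setReg (r + 128) x) := by
  refine ⟨fun r' h1 h2 h3 h4 => ?_, fun r' h1 => ?_, h.mem, h.window⟩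
  · have : r' ≠ r + 128 := by omega
    simpa [State.setReg, this] using h.reg r' h1 h2 h3 h4
  · have : r' ≠ r := by omega
    simpa [State.setReg, this] using h.regBound r' h1

theorem LimInv.setShifted {lim off fuel r x : ℕ} {S : State} (h : LimInv lim off fuel S)
    (hx : x < lim) : LimInv lim off fuel (S.setReg (r + 128) x) := by
  obtain ⟨h1, h2, h3, h4, h5, h6⟩ := h
  have e : ∀ k < 128, k ≠ r + 128 := fun k hk => by omega
  refine ⟨?_, ?_, ?_, ?_, fun r' => ?_, h6⟩
  any_goals simp only [State.setReg]; rw [Function.update_of_ne (e _ (by norm_num))]; assumption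
  by_cases hr : r' = r
  · subst hr; simpa [State.setReg] using hx
  · simpa [State.setReg, hr] using h5 r'

theorem LimInv.setUser {lim off fuel r x : ℕ} {S : State} (h : LimInv lim off fuel S)
    (hr : r = rGuard ∨ r = rAddr) : LimInv lim off fuel (S.setReg r x) := by
  obtain ⟨h1, h2, h3, h4, h5, h6⟩ := h
  refine ⟨?_, ?_, ?_, ?_, fun r' => ?_, h6⟩
  any_goals
    simp only [State.setReg]
    rw [Function.update_of_ne (by rcases hr with rfl | rfl <;> norm_num)]; assumption
  have hne : r' + 128 ≠ r := by
    rcases hr with rfl | rfl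
    exacts [show r' + 128 ≠ 41 by omega, show r' + 128 ≠ 42 by omega]
  rw [State.reg_setReg_of_ne hne]
  exact h5 r'

theorem LimInv.setFuel {lim off fuel x : ℕ} {S : State} (h : LimInv lim off fuel S) :
    LimInv lim off x (S.setReg rFuel x) := by
  obtain ⟨h1, h2, h3, h4, h5, h6⟩ := h
  refine ⟨?_, ?_, ?_, ?_, fun r' => ?_, h6⟩
  any_goals first | exact State.reg_setReg_self _ _ _ | (
      rw [State.reg_setReg_of_ne (by norm_num)]; assumption)
  rw [State.reg_setReg_of_ne (show r' + 128 ≠ 40 by omega)]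
  exact h5 r'

theorem Represents.setUser {lim off r x : ℕ} {s S : State} (h : Represents lim off s S)
    (hr : r < 128) : Represents lim off s (S.setReg r x) := by
  refine ⟨fun r' => ?_, h.2⟩
  have : r' + 128 ≠ r := by omega
  simpa [State.setReg, this] using h.1 r'

theorem Represents.setShifted {lim off r x : ℕ} {s S : State} (h : Represents lim off s S) :
    Represents lim off (s.setReg r x) (S.setReg (r + 128) x) := by
  refine ⟨fun r' => ?_, h.2⟩
  by_cases hr : r' = r
  · subst hr; simp [State.setReg]
  · simpa [State.setReg, hr] using h.1 r'

/-- Conclusion of the simulation theorem for a single program. -/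
def LimSpec (B lim off fuel : ℕ) (p : Prog) (S : State) : Prop :=
  ∃ S' t' f', Exec B p.limited S S' t' ∧ LimInv lim off f' S' ∧ f' ≤ fuel ∧
    t' + p.limitedCost * f' ≤ p.limitedCost * (fuel + 1) ∧
    LimFrame lim off p.regBound S S' ∧
    ∀ s s' t B', B' ≤ lim → Represents lim off s S → Exec B' p s s' t → t ≤ fuel →
      Represents lim off s' S' ∧ fuel ≤ f' + t

/-- The running time is paid by the fuel: each round of a loop burns a unit, and code between two
such payments costs at most `limitedCost`; the `+ 1` pays for the code after the last one.
Termination thus holds for every program and every content of the memory. Faithfulness is claimed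
only for a genuine run of at most `fuel` steps with values below the limit: reduction modulo the
limit does not change such values, and `t` genuine steps burn at most `t` units. -/
theorem Prog.limited_spec {B v lim off F : ℕ} (hB : 2 ^ (3 * v) ≤ B) (hv : 1 ≤ v)
    (hlim : lim ≤ 2 ^ v) (hoff : off < 2 ^ v) (hF : F < 2 ^ v) :
    ∀ (p : Prog), p.constBound ≤ 2 ^ v → ∀ fuel ≤ F, ∀ S, LimInv lim off fuel S →
      LimSpec B lim off fuel p S := by
  have hop : ∀ (o : Op) {x y : ℕ}, x < 2 ^ v → y < 2 ^ v → o.eval x y < B := fun o x y hx hy =>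
    (o.eval_lt_two_pow hv hv hx hy).trans_le
      ((Nat.pow_le_pow_right (by norm_num) (by omega)).trans hB)
  have h1B : 2 ^ v ≤ B := (Nat.pow_le_pow_right (by norm_num) (by omega)).trans hB
  intro p
  induction p with
  | skip =>
    intro _ fuel _ S hS
    refine ⟨S, 1, fuel, .skip S, hS, le_rfl, by simp only [limitedCost]; omega, .refl _ _ _ _, ?_⟩
    rintro s s' t B' hB' hR h ht
    cases h
    exact ⟨hR, by omega⟩
  | const r c =>
    intro hc fuel _ S hS
    have hl : 0 < lim := (Nat.zero_le _).trans_lt (hS.reg 0)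
    have hc' : c < 2 ^ v := hc
    have e1 := Exec.const (B := B) S (r + 128) c (hc'.trans_le h1B)
    have e2 := Exec.op (B := B) (S.setReg (r + 128) c) .mod (r + 128) (r + 128) rLim (by
      simp only [State.setReg, Function.update_self, Op.eval]
      exact (Nat.mod_le _ _).trans_lt (hc'.trans_le h1B))
    have hset : (S.setReg (r + 128) c).setReg (r + 128)
        (Op.mod.eval ((S.setReg (r + 128) c).reg (r + 128)) ((S.setReg (r + 128) c).reg rLim)) =
        S.setReg (r + 128) (c % lim) := by
      simp [State.setReg, Op.eval, ← hS.hlim]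
    rw [hset] at e2
    refine ⟨_, _, fuel, .seq e1 e2, hS.setShifted (Nat.mod_lt _ hl), le_rfl,
      by simp only [limitedCost]; omega, (LimFrame.refl _ _ _ _).setShifted (Nat.lt_succ_self r), ?_⟩
    rintro s s' t B' hB' hR h ht
    cases h with
    | const _ _ _ h =>
      rw [Nat.mod_eq_of_lt (h.trans_le hB')]
      exact ⟨hR.setShifted, by omega⟩
  | op o r a b =>
    intro _ fuel _ S hS
    have hl : 0 < lim := (Nat.zero_le _).trans_lt (hS.reg 0)
    set x := o.eval (S.reg (a + 128)) (S.reg (b + 128)) with hx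
    have hxB : x < B := hop o ((hS.reg a).trans_le hlim) ((hS.reg b).trans_le hlim)
    have e1 := Exec.op (B := B) S o (r + 128) (a + 128) (b + 128) hxB
    rw [← hx] at e1
    have e2 := Exec.op (B := B) (S.setReg (r + 128) x) .mod (r + 128) (r + 128) rLim (by
      simp only [State.setReg, Function.update_self, Op.eval]
      exact (Nat.mod_le _ _).trans_lt hxB)
    have hset : (S.setReg (r + 128) x).setReg (r + 128)
        (Op.mod.eval ((S.setReg (r + 128) x).reg (r + 128)) ((S.setReg (r + 128) x).reg rLim)) =
        S.setReg (r + 128) (x % lim) := by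
      simp [State.setReg, Op.eval, ← hS.hlim]
    rw [hset] at e2
    refine ⟨_, _, fuel, .seq e1 e2, hS.setShifted (Nat.mod_lt _ hl), le_rfl,
      by simp only [limitedCost]; omega, (LimFrame.refl _ _ _ _).setShifted (Nat.lt_succ_self r), ?_⟩
    rintro s s' t B' hB' hR h ht
    cases h with
    | op _ _ _ _ _ h =>
      rw [hR.1 a, hR.1 b, ← hx] at h ⊢
      rw [Nat.mod_eq_of_lt (h.trans_le hB')]
      exact ⟨hR.setShifted, by omega⟩
  | load r A i =>
    intro _ fuel _ S hS
    have e1 := Exec.op (B := B) S .add rAddr (i + 128) rOff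
      (hop .add ((hS.reg i).trans_le hlim) (by rw [hS.hoff]; exact hoff))
    have e2 := Exec.load (B := B) (S.setReg rAddr (Op.add.eval (S.reg (i + 128)) (S.reg rOff)))
      (r + 128) (A + 16) rAddr
    refine ⟨_, _, fuel, .seq e1 e2, (hS.setUser (.inr rfl)).setShifted (hS.mem _ _), le_rfl,
      by simp only [limitedCost]; omega,
      ((LimFrame.refl _ _ _ _).setReg (.inr (.inr rfl))).setShifted (Nat.lt_succ_self r), ?_⟩
    rintro s s' t B' hB' hR h ht
    cases h with
    | load _ _ _ _ =>
      have := (hR.setUser (r := rAddr) (x := Op.add.eval (S.reg (i + 128)) (S.reg rOff))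
        (by norm_num)).setShifted (r := r) (x := s.mem A (s.reg i))
      rw [hR.2 A _ (by rw [hR.1]; exact hS.reg i)] at this
      refine ⟨?_, by omega⟩
      rw [hR.2 A _ (by rw [hR.1]; exact hS.reg i)]
      convert this using 2
      simp [State.setReg, Op.eval, hR.1, hS.hoff, add_comm]
  | store A i r =>
    intro _ fuel _ S hS
    have e1 := Exec.op (B := B) S .add rAddr (i + 128) rOff
      (hop .add ((hS.reg i).trans_le hlim) (by rw [hS.hoff]; exact hoff))
    have e2 := Exec.store (B := B) (S.setReg rAddr (Op.add.eval (S.reg (i + 128)) (S.reg rOff)))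
      (A + 16) rAddr (r + 128)
    set S₁ := S.setReg rAddr (Op.add.eval (S.reg (i + 128)) (S.reg rOff)) with hS₁
    have ha : S₁.reg rAddr = off + S.reg (i + 128) := by
      simp [hS₁, State.setReg, Op.eval, hS.hoff, add_comm]
    have hr : S₁.reg (r + 128) = S.reg (r + 128) :=
      State.reg_setReg_of_ne (show r + 128 ≠ 42 by omega)
    rw [ha, hr] at e2
    have hI : LimInv lim off fuel S₁ := hS.setUser (.inr rfl)
    have hfr : LimFrame lim off 0 S S₁ := (LimFrame.refl _ _ _ _).setReg (.inr (.inr rfl))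
    refine ⟨_, _, fuel, .seq e1 e2, ⟨hI.hlim, hI.hoff, hI.hfuel, hI.one, hI.reg, fun A' j => ?_⟩,
      le_rfl, by simp only [limitedCost]; omega,
      ⟨hfr.reg, hfr.regBound, fun A' hA' => ?_, fun A' j hj => ?_⟩, ?_⟩
    · rw [State.mem_setMem]
      split_ifs
      · exact hS.reg r
      · exact hS.mem A' j
    · have : A' ≠ A + 16 := by omega
      simpa [State.setMem, this] using hfr.mem A' hA'
    · have := hS.reg i
      have : j ≠ off + S.reg (i + 128) := by omega
      rw [State.mem_setMem, if_neg (by tauto)]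
      rfl
    · rintro s s' t B' hB' hR h ht
      cases h with
      | store _ _ _ _ =>
        have hR₁ : Represents lim off s S₁ := hR.setUser (by norm_num)
        refine ⟨⟨fun r' => ?_, fun A' j hj => ?_⟩, by omega⟩
        · exact hR₁.1 r'
        · have h0 : S₁.mem = S.mem := rfl
          simp only [State.mem_setMem, hR.1, Nat.add_left_cancel_iff,
            Nat.add_right_cancel_iff, h0]
          split_ifs
          · rfl
          · exact hR.2 A' j hj
  | seq p q ihp ihq =>
    intro hc fuel hf S hS
    simp only [constBound, max_le_iff] at hc
    obtain ⟨S₁, t₁, f₁, a1, a2, a3, a4, a5, a6⟩ := ihp hc.1 fuel hf S hS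
    obtain ⟨S₂, t₂, f₂, b1, b2, b3, b4, b5, b6⟩ := ihq hc.2 f₁ (a3.trans hf) S₁ a2
    refine ⟨S₂, _, f₂, .seq a1 b1, b2, b3.trans a3, ?_,
      (a5.mono (le_max_left _ _)).trans (b5.mono (le_max_right _ _)), ?_⟩
    · simp only [limitedCost]
      nlinarith [Nat.mul_le_mul_left p.limitedCost b3, Nat.mul_le_mul_left q.limitedCost a3]
    · rintro s s' t B' hB' hR h ht
      cases h with
      | seq hp hq =>
        obtain ⟨c1, c2⟩ := a6 _ _ _ B' hB' hR hp (by omega)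
        obtain ⟨d1, d2⟩ := b6 _ _ _ B' hB' c1 hq (by omega)
        exact ⟨d1, by omega⟩
  | ite r p q ihp ihq =>
    intro hc fuel hf S hS
    simp only [constBound, max_le_iff] at hc
    by_cases h0 : S.reg (r + 128) = 0
    · obtain ⟨S₁, t₁, f₁, a1, a2, a3, a4, a5, a6⟩ := ihq hc.2 fuel hf S hS
      refine ⟨S₁, _, f₁, .iteFalse h0 a1, a2, a3, ?_, a5.mono (le_max_right _ _), ?_⟩
      · simp only [limitedCost]
        nlinarith [Nat.mul_le_mul_left p.limitedCost a3]
      · rintro s s' t B' hB' hR h ht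
        cases h with
        | iteTrue hr hp => exact absurd (hR.1 r ▸ h0) hr
        | iteFalse hr hp =>
          obtain ⟨c1, c2⟩ := a6 _ _ _ B' hB' hR hp (by omega)
          exact ⟨c1, by omega⟩
    · obtain ⟨S₁, t₁, f₁, a1, a2, a3, a4, a5, a6⟩ := ihp hc.1 fuel hf S hS
      refine ⟨S₁, _, f₁, .iteTrue h0 a1, a2, a3, ?_, a5.mono (le_max_left _ _), ?_⟩
      · simp only [limitedCost]
        nlinarith [Nat.mul_le_mul_left q.limitedCost a3]
      · rintro s s' t B' hB' hR h ht
        cases h with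
        | iteFalse hr hp => exact absurd (hR.1 r ▸ hr) h0
        | iteTrue hr hp =>
          obtain ⟨c1, c2⟩ := a6 _ _ _ B' hB' hR hp (by omega)
          exact ⟨c1, by omega⟩
  | loop r p ih =>
    intro hc fuel hf S hS
    -- Strong induction on the fuel, since the body may burn an unknown amount in its own loops. The
    -- guard is the product of the tested register and the fuel, so it vanishes as soon as one of
    -- them does.
    have key : ∀ fuel ≤ F, ∀ S, LimInv lim off fuel S → S.reg rGuard = S.reg (r + 128) * fuel →
        ∃ S' t' f', Exec B (.loop rGuard (.seq (.op .sub rFuel rFuel rOne)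
          (.seq p.limited (.op .mul rGuard (r + 128) rFuel)))) S S' t' ∧ LimInv lim off f' S' ∧
        f' ≤ fuel ∧ t' + (p.limitedCost + 3) * f' ≤ (p.limitedCost + 3) * fuel + 1 ∧
        LimFrame lim off p.regBound S S' ∧
        ∀ s s' t B', B' ≤ lim → Represents lim off s S → Exec B' (.loop r p) s s' t → t ≤ fuel →
          Represents lim off s' S' ∧ fuel ≤ f' + t := by
      intro fuel
      induction fuel using Nat.strong_induction_on with
      | _ fuel ihf =>
        intro hf S hS hg
        by_cases h0 : S.reg rGuard = 0
        · refine ⟨S, 1, fuel, .loopDone h0, hS, le_rfl, by omega, .refl _ _ _ _, ?_⟩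
          rintro s s' t B' hB' hR h ht
          -- If the guard vanishes because the fuel is used up, then a genuine run has no steps left
          -- for another round.
          rw [hg, mul_eq_zero] at h0
          cases h with
          | loopDone hr => exact ⟨hR, by omega⟩
          | loopStep hr hp hl =>
            rcases h0 with h0 | h0
            · exact absurd (hR.1 r ▸ h0) hr
            · omega
        · have hpos : 1 ≤ fuel := by
            rcases Nat.eq_zero_or_pos fuel with h | h
            · exact absurd (by rw [hg, h, mul_zero]) h0
            · exact h
          have e1 := Exec.op (B := B) S .sub rFuel rFuel rOne (by
            simp only [Op.eval, hS.hfuel]; omega)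
          have hv1 : Op.sub.eval (S.reg rFuel) (S.reg rOne) = fuel - 1 := by
            simp [Op.eval, hS.hfuel, hS.one]
          rw [hv1] at e1
          obtain ⟨S₁, t₁, f₁, a1, a2, a3, a4, a5, a6⟩ := ih hc (fuel - 1) (by omega) _
            (hS.setFuel (x := fuel - 1))
          have e3 := Exec.op (B := B) S₁ .mul rGuard (r + 128) rFuel
            (hop .mul ((a2.reg r).trans_le hlim) (by rw [a2.hfuel]; omega))
          set S₂ := S₁.setReg rGuard (Op.mul.eval (S₁.reg (r + 128)) (S₁.reg rFuel)) with hS₂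
          have hI₂ : LimInv lim off f₁ S₂ := a2.setUser (.inl rfl)
          obtain ⟨S₃, t₃, f₃, b1, b2, b3, b4, b5, b6⟩ := ihf f₁ (by omega) (by omega) S₂ hI₂ (by
            rw [hS₂, State.reg_setReg_self, State.reg_setReg_of_ne (show r + 128 ≠ 41 by omega),
              a2.hfuel, Op.eval])
          refine ⟨S₃, _, f₃, .loopStep h0 (.seq e1 (.seq a1 e3)) b1, b2, by omega, ?_, ?_, ?_⟩
          · obtain ⟨d, rfl⟩ : ∃ d, fuel = d + 1 := ⟨fuel - 1, by omega⟩
            simp only [Nat.add_sub_cancel] at a3 a4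
            nlinarith
          · exact ((((LimFrame.refl _ _ _ S).setReg (.inl rfl)).trans a5).setReg
              (.inr (.inl rfl))).trans b5
          · rintro s s' t B' hB' hR h ht
            cases h with
            | loopDone hr => exact absurd (by rw [hg, ← hR.1 r, hr, zero_mul]) h0
            | loopStep hr hp hl =>
              obtain ⟨c1, c2⟩ := a6 _ _ _ B' hB' (hR.setUser (by norm_num)) hp (by omega)
              obtain ⟨d1, d2⟩ := b6 _ _ _ B' hB' (c1.setUser (by norm_num)) hl (by omega)
              exact ⟨d1, by omega⟩
    have e1 := Exec.op (B := B) S .mul rGuard (r + 128) rFuel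
      (hop .mul ((hS.reg r).trans_le hlim) (by rw [hS.hfuel]; omega))
    obtain ⟨S', t', f', a1, a2, a3, a4, a5, a6⟩ := key fuel hf
      (S.setReg rGuard (Op.mul.eval (S.reg (r + 128)) (S.reg rFuel))) (hS.setUser (.inl rfl)) (by
        rw [State.reg_setReg_self, State.reg_setReg_of_ne (show r + 128 ≠ 41 by omega),
          hS.hfuel, Op.eval])
    refine ⟨S', _, f', .seq e1 a1, a2, a3, ?_,
      ((LimFrame.refl _ _ _ S).setReg (.inr (.inl rfl))).trans a5, ?_⟩
    · simp only [limitedCost]; nlinarith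
    · rintro s s' t B' hB' hR h ht
      exact a6 s s' t B' hB' (hR.setUser (by norm_num)) h ht

/-! ### The number of memory cells that a program can write -/

/-- A step writes at most one cell. This turns a count of nonzero outputs into a lower bound for the
running time. -/
theorem Exec.card_changed_le {B : ℕ} {p : Prog} {s s' : State} {t : ℕ} (h : Exec B p s s' t)
    (A : ℕ) : ∃ W : Finset ℕ, W.card ≤ t ∧ ∀ i ∉ W, s'.mem A i = s.mem A i := by
  induction h with
  | store s A' i r =>
    refine ⟨{s.reg i}, by simp, fun j hj => ?_⟩
    have : j ≠ s.reg i := by simpa using hj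
    rw [State.mem_setMem, if_neg (by tauto)]
  | seq _ _ ih₁ ih₂ =>
    obtain ⟨W₁, h1, h2⟩ := ih₁
    obtain ⟨W₂, h3, h4⟩ := ih₂
    refine ⟨W₁ ∪ W₂, (Finset.card_union_le _ _).trans (by omega), fun i hi => ?_⟩
    rw [Finset.mem_union, not_or] at hi
    rw [h4 i hi.2, h2 i hi.1]
  | loopStep _ _ _ ih₁ ih₂ =>
    obtain ⟨W₁, h1, h2⟩ := ih₁
    obtain ⟨W₂, h3, h4⟩ := ih₂
    refine ⟨W₁ ∪ W₂, (Finset.card_union_le _ _).trans (by omega), fun i hi => ?_⟩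
    rw [Finset.mem_union, not_or] at hi
    rw [h4 i hi.2, h2 i hi.1]
  | iteTrue _ _ ih => obtain ⟨W, h1, h2⟩ := ih; exact ⟨W, by omega, h2⟩
  | iteFalse _ _ ih => obtain ⟨W, h1, h2⟩ := ih; exact ⟨W, by omega, h2⟩
  | _ => exact ⟨∅, by simp, fun _ _ => rfl⟩

end WordRAM

/-! ### Flows: the cut bound and flows along edge-disjoint walks -/

/-- The arcs of the walk that starts in `x` and visits the vertices of a list. -/
def walkArcs {V : Type} : V → List V → List (V × V)
  | _, [] => []
  | x, y :: l => (x, y) :: walkArcs y l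

/-- Each visit to `v` uses one arc in and one arc out; the two indicators account for the start and
the end of the walk. -/
theorem walkArcs_balance {V : Type} [DecidableEq V] (v : V) : ∀ (x : V) (l : List V),
    (walkArcs x l).countP (fun e => e.2 = v) + (if x = v then 1 else 0) =
      (walkArcs x l).countP (fun e => e.1 = v) + (if l.getLastD x = v then 1 else 0)
  | x, [] => by simp [walkArcs]
  | x, y :: l => by
    have := walkArcs_balance v y l
    simp only [walkArcs, List.countP_cons, List.getLastD_cons, decide_eq_true_eq] at this ⊢
    omega

section Flow

variable {V : Type} [Fintype V] [DecidableEq V]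

/-- Summing the net outflow over `S` gives the value of the flow by conservation; arcs inside `S`
cancel, and arcs entering `S` only decrease the sum. -/
theorem IsFlow.value_le_cut {cap : V → V → ℝ} {s t : V} {f : V → V → ℝ} (hf : IsFlow cap s t f)
    (S : Finset V) (hs : s ∈ S) (ht : t ∉ S) :
    flowValue f s ≤ ∑ u ∈ S, ∑ v ∈ Sᶜ, cap u v := by
  have h1 : flowValue f s = ∑ v ∈ S, (∑ w, f v w - ∑ w, f w v) := by
    rw [Finset.sum_eq_single_of_mem s hs]
    · rfl
    · intro v hv hvs
      rw [hf.conserve v hvs (by rintro rfl; exact ht hv), sub_self]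
  have h2 : ∀ g : V → V → ℝ, ∑ v ∈ S, ∑ w, g v w = ∑ v ∈ S, ∑ w ∈ S, g v w +
      ∑ v ∈ S, ∑ w ∈ Sᶜ, g v w := fun g => by
    rw [← Finset.sum_add_distrib]
    exact Finset.sum_congr rfl fun v _ => (Finset.sum_add_sum_compl S _).symm
  rw [h1, Finset.sum_sub_distrib, h2, h2 (fun v w => f w v),
    Finset.sum_comm (s := S) (t := S) (f := fun v w => f w v)]
  have h3 : 0 ≤ ∑ v ∈ S, ∑ w ∈ Sᶜ, f w v :=
    Finset.sum_nonneg fun v _ => Finset.sum_nonneg fun w _ => hf.nonneg w v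
  have h4 : ∑ v ∈ S, ∑ w ∈ Sᶜ, f v w ≤ ∑ v ∈ S, ∑ w ∈ Sᶜ, cap v w :=
    Finset.sum_le_sum fun v _ => Finset.sum_le_sum fun w _ => hf.le_cap v w
  linarith

theorem sum_count_fst (L : List (V × V)) (v : V) :
    ∑ u, ((L.count (u, v) : ℕ) : ℝ) = (L.countP (fun e => e.2 = v) : ℕ) := by
  induction L with
  | nil => simp
  | cons e L ih =>
    obtain ⟨a, b⟩ := e
    simp only [List.count_cons, List.countP_cons, Nat.cast_add, Finset.sum_add_distrib, ih]
    by_cases h : b = v <;> simp [h]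

theorem sum_count_snd (L : List (V × V)) (v : V) :
    ∑ u, ((L.count (v, u) : ℕ) : ℝ) = (L.countP (fun e => e.1 = v) : ℕ) := by
  induction L with
  | nil => simp
  | cons e L ih =>
    obtain ⟨a, b⟩ := e
    simp only [List.count_cons, List.countP_cons, Nat.cast_add, Finset.sum_add_distrib, ih]
    by_cases h : a = v <;> simp [h]

/-- The flow on an arc is its multiplicity in the concatenation of all walks, which is at most one
by disjointness. Conservation and the value are the balance identity summed over the walks, so
vertices may be visited repeatedly. -/
theorem exists_flow_of_walks {ι : Type} {cap : V → V → ℝ} {s t : V} (hst : s ≠ t)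
    (hcap : ∀ u v, 0 ≤ cap u v) (T : List ι) (w : ι → List V)
    (hend : ∀ i ∈ T, (w i).getLastD s = t)
    (hnd : (T.flatMap fun i => walkArcs s (w i)).Nodup)
    (hmem : ∀ i ∈ T, ∀ e ∈ walkArcs s (w i), 1 ≤ cap e.1 e.2) :
    ∃ f, IsFlow cap s t f ∧ flowValue f s = T.length := by
  set L := T.flatMap fun i => walkArcs s (w i) with hL
  have hbal : ∀ v, L.countP (fun e => e.2 = v) + (if s = v then T.length else 0) =
      L.countP (fun e => e.1 = v) + (if t = v then T.length else 0) := by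
    intro v
    rw [hL]
    clear hnd hmem hL L
    induction T with
    | nil => simp
    | cons i T ih =>
      have h1 := walkArcs_balance v s (w i)
      rw [hend i List.mem_cons_self] at h1
      have h2 := ih fun j hj => hend j (List.mem_cons_of_mem _ hj)
      simp only [List.flatMap_cons, List.countP_append, List.length_cons]
      split_ifs at h1 h2 ⊢ <;> omega
  refine ⟨fun u v => (L.count (u, v) : ℕ), ⟨fun u v => Nat.cast_nonneg _, fun u v => ?_,
    fun v hvs hvt => ?_⟩, ?_⟩
  · by_cases h : (u, v) ∈ L
    · obtain ⟨i, hi, he⟩ := List.mem_flatMap.1 h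
      refine le_trans ?_ (hmem i hi _ he)
      exact_mod_cast List.nodup_iff_count_le_one.1 hnd (u, v)
    · rw [List.count_eq_zero_of_not_mem h]
      simpa using hcap u v
  · rw [sum_count_fst, sum_count_snd]
    have := hbal v
    rw [if_neg hvs.symm, if_neg hvt.symm] at this
    exact_mod_cast this
  · rw [flowValue, sum_count_fst, sum_count_snd]
    have := hbal s
    rw [if_pos rfl, if_neg hst.symm] at this
    have h : ((L.countP (fun e => e.2 = s) : ℕ) : ℝ) + T.length =
      (L.countP (fun e => e.1 = s) : ℕ) := by exact_mod_cast this
    linarith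

end Flow

namespace EdgeListGraph

variable (G : EdgeListGraph)

theorem unitCap_nonneg (u v : Fin G.n) : 0 ≤ G.unitCap u v := by
  unfold unitCap; split_ifs <;> norm_num

/-- A set of edges that contains all edges leaving `S` bounds the flow values. -/
theorem flowValue_le_card_of_cut {s t : Fin G.n} {f : Fin G.n → Fin G.n → ℝ}
    (hf : IsFlow G.unitCap s t f) (S : Fin G.n → Prop) (hs : S s) (ht : ¬ S t)
    (X : Finset (Fin G.n × Fin G.n))
    (hX : ∀ e ∈ G.edges, S e.1 → ¬ S e.2 → e ∈ X) : flowValue f s ≤ X.card := by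
  classical
  refine (hf.value_le_cut (Finset.univ.filter S) (by simpa using hs) (by simpa using ht)).trans ?_
  rw [← Finset.sum_product', Finset.card_eq_sum_ones, Nat.cast_sum]
  calc _ ≤ ∑ e ∈ (Finset.univ.filter S) ×ˢ (Finset.univ.filter S)ᶜ,
        (if e ∈ X then (1 : ℝ) else 0) := by
        refine Finset.sum_le_sum fun e he => ?_
        simp only [Finset.mem_product, Finset.mem_compl, Finset.mem_filter, Finset.mem_univ,
          true_and] at he
        unfold unitCap
        by_cases h : (e.1, e.2) ∈ G.edges
        · rw [if_pos h, if_pos (hX _ h he.1 he.2)]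
        · rw [if_neg h]; split_ifs <;> norm_num
    _ ≤ ∑ e ∈ X, ((1 : ℕ) : ℝ) := by
        rw [← Finset.sum_filter, Nat.cast_one]
        exact Finset.sum_le_sum_of_subset_of_nonneg
          (fun e he => (Finset.mem_filter.1 he).2) fun _ _ _ => zero_le_one

end EdgeListGraph

/-! ### The graph of the reduction -/

/-- Edges, table entries and output cells are all addressed by one loop counter; this lemma splits
the counter into its mixed-radix digits. -/
theorem Nat.lt_mul_iff_exists_digits {a b k : ℕ} :
    k < a * b ↔ ∃ q < a, ∃ r < b, k = q * b + r := by
  constructor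
  · intro h
    have hb : 0 < b := Nat.pos_of_ne_zero (by rintro rfl; simp at h)
    exact ⟨k / b, Nat.div_lt_of_lt_mul (by rwa [mul_comm]), k % b, Nat.mod_lt _ hb,
      by rw [mul_comm, Nat.div_add_mod]⟩
  · rintro ⟨q, hq, r, hr, rfl⟩
    nlinarith [Nat.mul_le_mul_right b (Nat.succ_le_of_lt hq)]

theorem Nat.digits_div {b q r : ℕ} (hr : r < b) : (q * b + r) / b = q := by
  rw [add_comm, Nat.add_mul_div_right _ _ (by omega), Nat.div_eq_of_lt hr, zero_add]

theorem Nat.digits_mod {b q r : ℕ} (hr : r < b) : (q * b + r) % b = r := by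
  rw [add_comm, Nat.add_mul_mod_self_right, Nat.mod_eq_of_lt hr]

/-- The list of the pairs `f k` with `k < N` and `c k`. -/
def pairList (N : ℕ) (c : ℕ → Prop) [DecidablePred c] (f : ℕ → ℕ × ℕ) : List (ℕ × ℕ) :=
  ((List.range N).filter fun k => c k).map f

theorem mem_pairList {N : ℕ} {c : ℕ → Prop} [DecidablePred c] {f : ℕ → ℕ × ℕ} {e : ℕ × ℕ} :
    e ∈ pairList N c f ↔ ∃ k < N, c k ∧ f k = e := by
  simp [pairList, and_assoc]

theorem nodup_pairList {N : ℕ} {c : ℕ → Prop} [DecidablePred c] {f : ℕ → ℕ × ℕ}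
    (hf : ∀ k l, f k = f l → k = l) : (pairList N c f).Nodup :=
  (List.nodup_range.filter _).map fun k l h => hf k l h

theorem length_pairList_le (N : ℕ) (c : ℕ → Prop) [DecidablePred c] (f : ℕ → ℕ × ℕ) :
    (pairList N c f).length ≤ N := by
  rw [pairList, List.length_map]
  exact (List.length_filter_le _ _).trans (by simp)

/-- Parameters of the reduction: `A` partial assignments of the first and of the second block of
variables, `Gm` of the third, `s` clause slots, a block of `Bl` nodes for every kind of nodes, `Mp`
padding edges, and the table `u` whose rows are indexed by the partial assignments of all blocks
(`u r i = 1` if assignment `r` does not satisfy clause `i`, and `0` otherwise). -/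
structure RedParams where
  A : ℕ
  Gm : ℕ
  s : ℕ
  Bl : ℕ
  Mp : ℕ
  u : ℕ → ℕ → ℕ

namespace RedParams

variable (R : RedParams)

/-- First and third block leave the clause of slot `t` unsatisfied. -/
def bit (α t : ℕ) : ℕ := R.u α (t % R.s) * R.u (2 * R.A + t / R.s) (t % R.s)

/-- One unit edge per slot. The offset of the target is even or odd according to `bit`, so the copy
that is reached remembers whether the clause is still open. -/
def outEdges : List (ℕ × ℕ) := pairList (R.A * (R.Gm * R.s)) (fun _ => True) fun k =>
  (k / (R.Gm * R.s),
    2 * R.Bl + (2 * (k % (R.Gm * R.s)) + R.bit (k / (R.Gm * R.s)) (k % (R.Gm * R.s))))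

/-- Both copies of a slot lead to all `s` slack nodes of the same third-block assignment `t / s`,
and to no others. -/
def midEdges : List (ℕ × ℕ) := pairList (R.Gm * R.s * 2 * R.s) (fun _ => True) fun k =>
  (2 * R.Bl + k / R.s, 3 * R.Bl + (k / R.s / 2 / R.s * R.s + k % R.s))

/-- The bypass for slots left open by all three blocks: it starts in the odd copy only, and it does
not depend on the threshold. -/
def directEdges : List (ℕ × ℕ) := pairList (R.A * (R.Gm * R.s) * R.s)
  (fun k => R.u (R.A + k / R.s / (R.Gm * R.s)) (k / R.s % (R.Gm * R.s) % R.s) ≠ 0) fun k =>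
  (2 * R.Bl + (2 * (k / R.s % (R.Gm * R.s)) + 1),
    R.Bl + (k / R.s / (R.Gm * R.s) * R.s + k % R.s))

/-- The truncated difference is nonzero exactly if the slack index is at most the threshold `p`, so
`p + 1` slack nodes of every third-block assignment lead to a sink. The condition has the form in
which the machine evaluates it. -/
def slackEdges : List (ℕ × ℕ) := pairList (R.A * (R.Gm * R.s) * R.s)
  (fun k => k % R.s + 1 - k / R.s % (R.Gm * R.s) % R.s ≠ 0) fun k =>
  (3 * R.Bl + k / R.s % (R.Gm * R.s), R.Bl + (k / R.s / (R.Gm * R.s) * R.s + k % R.s))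

/-- A bipartite piece on nodes of its own, filled row by row. It tunes the number of edges and has
no influence on the flows that are read. -/
def padEdges : List (ℕ × ℕ) := pairList R.Mp (fun _ => True) fun k =>
  (4 * R.Bl + k / (2 * R.Bl), 6 * R.Bl + k % (2 * R.Bl))

def allEdges : List (ℕ × ℕ) :=
  R.outEdges ++ (R.midEdges ++ (R.directEdges ++ (R.slackEdges ++ R.padEdges)))

theorem mem_outEdges {x y : ℕ} : (x, y) ∈ R.outEdges ↔
    ∃ t < R.Gm * R.s, x < R.A ∧ y = 2 * R.Bl + (2 * t + R.bit x t) := by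
  simp only [outEdges, mem_pairList, true_and, Prod.mk.injEq]
  constructor
  · rintro ⟨k, hk, rfl, rfl⟩
    obtain ⟨q, hq, r, hr, rfl⟩ := Nat.lt_mul_iff_exists_digits.1 hk
    rw [Nat.digits_div hr, Nat.digits_mod hr]
    exact ⟨r, hr, hq, rfl⟩
  · rintro ⟨t, ht, hx, rfl⟩
    refine ⟨x * (R.Gm * R.s) + t, Nat.lt_mul_iff_exists_digits.2 ⟨x, hx, t, ht, rfl⟩, ?_⟩
    rw [Nat.digits_div ht, Nat.digits_mod ht]
    exact ⟨rfl, rfl⟩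

theorem mem_midEdges {x y : ℕ} : (x, y) ∈ R.midEdges ↔
    ∃ t < R.Gm * R.s, ∃ b < 2, ∃ j < R.s, x = 2 * R.Bl + (2 * t + b) ∧
      y = 3 * R.Bl + (t / R.s * R.s + j) := by
  simp only [midEdges, mem_pairList, true_and, Prod.mk.injEq]
  constructor
  · rintro ⟨k, hk, rfl, rfl⟩
    obtain ⟨q, hq, j, hj, rfl⟩ := Nat.lt_mul_iff_exists_digits.1 hk
    obtain ⟨t, ht, b, hb, rfl⟩ := Nat.lt_mul_iff_exists_digits.1 hq
    rw [Nat.digits_div hj, Nat.digits_mod hj, Nat.digits_div hb]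
    exact ⟨t, ht, b, hb, j, hj, by ring, rfl⟩
  · rintro ⟨t, ht, b, hb, j, hj, rfl, rfl⟩
    refine ⟨(t * 2 + b) * R.s + j, Nat.lt_mul_iff_exists_digits.2 ⟨_,
      Nat.lt_mul_iff_exists_digits.2 ⟨t, ht, b, hb, rfl⟩, j, hj, rfl⟩, ?_⟩
    rw [Nat.digits_div hj, Nat.digits_mod hj, Nat.digits_div hb]
    exact ⟨by ring, rfl⟩

theorem mem_directEdges {x y : ℕ} : (x, y) ∈ R.directEdges ↔
    ∃ β < R.A, ∃ t < R.Gm * R.s, ∃ p < R.s, R.u (R.A + β) (t % R.s) ≠ 0 ∧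
      x = 2 * R.Bl + (2 * t + 1) ∧ y = R.Bl + (β * R.s + p) := by
  simp only [directEdges, mem_pairList, Prod.mk.injEq]
  constructor
  · rintro ⟨k, hk, hc, rfl, rfl⟩
    obtain ⟨q, hq, p, hp, rfl⟩ := Nat.lt_mul_iff_exists_digits.1 hk
    obtain ⟨β, hβ, t, ht, rfl⟩ := Nat.lt_mul_iff_exists_digits.1 hq
    rw [Nat.digits_div hp, Nat.digits_div ht, Nat.digits_mod ht] at *
    rw [Nat.digits_mod hp]
    exact ⟨β, hβ, t, ht, p, hp, hc, rfl, rfl⟩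
  · rintro ⟨β, hβ, t, ht, p, hp, hc, rfl, rfl⟩
    refine ⟨(β * (R.Gm * R.s) + t) * R.s + p, Nat.lt_mul_iff_exists_digits.2 ⟨_,
      Nat.lt_mul_iff_exists_digits.2 ⟨β, hβ, t, ht, rfl⟩, p, hp, rfl⟩, ?_⟩
    rw [Nat.digits_div hp, Nat.digits_mod hp, Nat.digits_div ht, Nat.digits_mod ht]
    exact ⟨hc, rfl, rfl⟩

theorem mem_slackEdges {x y : ℕ} : (x, y) ∈ R.slackEdges ↔
    ∃ β < R.A, ∃ t < R.Gm * R.s, ∃ p < R.s, t % R.s ≤ p ∧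
      x = 3 * R.Bl + t ∧ y = R.Bl + (β * R.s + p) := by
  simp only [slackEdges, mem_pairList, Prod.mk.injEq]
  constructor
  · rintro ⟨k, hk, hc, rfl, rfl⟩
    obtain ⟨q, hq, p, hp, rfl⟩ := Nat.lt_mul_iff_exists_digits.1 hk
    obtain ⟨β, hβ, t, ht, rfl⟩ := Nat.lt_mul_iff_exists_digits.1 hq
    rw [Nat.digits_mod hp, Nat.digits_div hp, Nat.digits_mod ht] at *
    rw [Nat.digits_div ht]
    exact ⟨β, hβ, t, ht, p, hp, by omega, rfl, rfl⟩
  · rintro ⟨β, hβ, t, ht, p, hp, hc, rfl, rfl⟩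
    refine ⟨(β * (R.Gm * R.s) + t) * R.s + p, Nat.lt_mul_iff_exists_digits.2 ⟨_,
      Nat.lt_mul_iff_exists_digits.2 ⟨β, hβ, t, ht, rfl⟩, p, hp, rfl⟩, ?_⟩
    rw [Nat.digits_div hp, Nat.digits_mod hp, Nat.digits_div ht, Nat.digits_mod ht]
    exact ⟨by omega, rfl, rfl⟩

/-- Conditions on the parameters. -/
structure Valid : Prop where
  s_pos : 1 ≤ R.s
  A_pos : 1 ≤ R.A
  Gm_pos : 1 ≤ R.Gm
  A_le : R.A * R.s ≤ R.Bl
  Gm_le : 2 * (R.Gm * R.s) ≤ R.Bl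
  Mp_le : R.Mp ≤ 2 * R.Bl * (2 * R.Bl)
  u_le : ∀ r i, R.u r i ≤ 1

variable {R}

theorem Valid.bit_le (h : R.Valid) (α t : ℕ) : R.bit α t ≤ 1 :=
  (Nat.mul_le_mul (h.u_le _ _) (h.u_le _ _)).trans (by norm_num)

theorem Valid.A_le_Bl (h : R.Valid) : R.A ≤ R.Bl :=
  (Nat.le_mul_of_pos_right _ h.s_pos).trans h.A_le

theorem Valid.sink_lt (h : R.Valid) {β p : ℕ} (hβ : β < R.A) (hp : p < R.s) :
    β * R.s + p < R.Bl :=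
  (Nat.lt_mul_iff_exists_digits.2 ⟨β, hβ, p, hp, rfl⟩).trans_le h.A_le

theorem slot_lt {t j : ℕ} (ht : t < R.Gm * R.s) (hj : j < R.s) :
    t / R.s * R.s + j < R.Gm * R.s :=
  Nat.lt_mul_iff_exists_digits.2 ⟨t / R.s, Nat.div_lt_of_lt_mul (by rwa [mul_comm]), j, hj, rfl⟩

theorem mem_padEdges_ge {x y : ℕ} (h : (x, y) ∈ R.padEdges) : 4 * R.Bl ≤ x := by
  simp only [padEdges, mem_pairList, Prod.mk.injEq] at h
  obtain ⟨k, _, _, rfl, _⟩ := h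
  exact Nat.le_add_right _ _

/-- The nodes form eight blocks of length `Bl`: sources, sinks, slot copies, slack nodes, and two
blocks for either side of the padding. The blocks of the endpoints separate the five kinds of edges
and exclude loops. -/
theorem Valid.kind (h : R.Valid) {e : ℕ × ℕ} :
    (e ∈ R.outEdges → e.1 < R.Bl ∧ 2 * R.Bl ≤ e.2 ∧ e.2 < 3 * R.Bl) ∧
    (e ∈ R.midEdges → 2 * R.Bl ≤ e.1 ∧ e.1 < 3 * R.Bl ∧ 3 * R.Bl ≤ e.2 ∧ e.2 < 4 * R.Bl) ∧
    (e ∈ R.directEdges → 2 * R.Bl ≤ e.1 ∧ e.1 < 3 * R.Bl ∧ R.Bl ≤ e.2 ∧ e.2 < 2 * R.Bl) ∧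
    (e ∈ R.slackEdges → 3 * R.Bl ≤ e.1 ∧ e.1 < 4 * R.Bl ∧ R.Bl ≤ e.2 ∧ e.2 < 2 * R.Bl) ∧
    (e ∈ R.padEdges → 4 * R.Bl ≤ e.1 ∧ e.1 < 6 * R.Bl ∧ 6 * R.Bl ≤ e.2 ∧ e.2 < 8 * R.Bl) := by
  obtain ⟨x, y⟩ := e
  have hG := h.Gm_le
  have hA := h.A_le_Bl
  refine ⟨fun he => ?_, fun he => ?_, fun he => ?_, fun he => ?_, fun he => ?_⟩
  · obtain ⟨t, ht, hx, rfl⟩ := R.mem_outEdges.1 he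
    have := h.bit_le x t
    simp only; omega
  · obtain ⟨t, ht, b, hb, j, hj, rfl, rfl⟩ := R.mem_midEdges.1 he
    have := slot_lt ht hj
    simp only; omega
  · obtain ⟨β, hβ, t, ht, p, hp, -, rfl, rfl⟩ := R.mem_directEdges.1 he
    have := h.sink_lt hβ hp
    simp only; omega
  · obtain ⟨β, hβ, t, ht, p, hp, -, rfl, rfl⟩ := R.mem_slackEdges.1 he
    have := h.sink_lt hβ hp
    simp only; omega
  · simp only [padEdges, mem_pairList, Prod.mk.injEq] at he
    obtain ⟨k, hk, -, rfl, rfl⟩ := he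
    have h1 : k / (2 * R.Bl) < 2 * R.Bl := Nat.div_lt_of_lt_mul (hk.trans_le h.Mp_le)
    have h2 : k % (2 * R.Bl) < 2 * R.Bl := Nat.mod_lt _ (by have := h.A_pos; omega)
    generalize k / (2 * R.Bl) = q at *
    generalize k % (2 * R.Bl) = r at *
    simp only; omega

theorem Valid.lt_of_mem (h : R.Valid) : ∀ e ∈ R.allEdges, e.1 < 8 * R.Bl ∧ e.2 < 8 * R.Bl := by
  intro e he
  obtain ⟨h1, h2, h3, h4, h5⟩ := h.kind (e := e)
  simp only [allEdges, List.mem_append] at he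
  have := h.A_pos
  have := h.A_le_Bl
  rcases he with he | he | he | he | he
  · have := h1 he; omega
  · have := h2 he; omega
  · have := h3 he; omega
  · have := h4 he; omega
  · have := h5 he; omega

theorem Valid.ne_of_mem (h : R.Valid) : ∀ e ∈ R.allEdges, e.1 ≠ e.2 := by
  intro e he
  obtain ⟨h1, h2, h3, h4, h5⟩ := h.kind (e := e)
  simp only [allEdges, List.mem_append] at he
  rcases he with he | he | he | he | he
  · have := h1 he; omega
  · have := h2 he; omega
  · have := h3 he; omega
  · have := h4 he; omega
  · have := h5 he; omega

theorem digits_inj {b k l : ℕ} (h1 : k / b = l / b) (h2 : k % b = l % b) : k = l := by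
  rw [← Nat.div_add_mod k b, ← Nat.div_add_mod l b, h1, h2]

theorem digits_inj' {b q r q' r' : ℕ} (hr : r < b) (hr' : r' < b) (h : q * b + r = q' * b + r') :
    q = q' ∧ r = r' := by
  have h1 := Nat.digits_div (q := q) hr
  have h2 := Nat.digits_mod (q := q) hr
  rw [h] at h1 h2
  rw [Nat.digits_div hr'] at h1
  rw [Nat.digits_mod hr'] at h2
  exact ⟨h1.symm, h2.symm⟩

theorem Valid.nodup (h : R.Valid) : R.allEdges.Nodup := by
  have hs := h.s_pos
  have hd : ∀ {L L' : List (ℕ × ℕ)}, (∀ e, e ∈ L → e ∈ L' → False) → List.Disjoint L L' :=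
    fun h e he he' => h e he he'
  have hmod : ∀ k, k % R.s < R.s := fun k => Nat.mod_lt _ hs
  refine List.nodup_append'.2 ⟨?_, List.nodup_append'.2 ⟨?_, List.nodup_append'.2 ⟨?_,
    List.nodup_append'.2 ⟨?_, ?_, ?_⟩, ?_⟩, ?_⟩, ?_⟩
  · refine nodup_pairList fun k l hkl => ?_
    simp only [Prod.mk.injEq] at hkl
    have h1 := h.bit_le (k / (R.Gm * R.s)) (k % (R.Gm * R.s))
    have h2 := h.bit_le (l / (R.Gm * R.s)) (l % (R.Gm * R.s))
    exact digits_inj hkl.1 (by omega)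
  · refine nodup_pairList fun k l hkl => ?_
    simp only [Prod.mk.injEq] at hkl
    have h1 : k / R.s = l / R.s := by omega
    exact digits_inj h1 (by rw [h1] at hkl; omega)
  · refine nodup_pairList fun k l hkl => ?_
    simp only [Prod.mk.injEq, Nat.add_left_cancel_iff] at hkl
    obtain ⟨h1, h2⟩ := digits_inj' (hmod k) (hmod l) hkl.2
    exact digits_inj (digits_inj h1 (by omega)) h2
  · refine nodup_pairList fun k l hkl => ?_
    simp only [Prod.mk.injEq, Nat.add_left_cancel_iff] at hkl
    obtain ⟨h1, h2⟩ := digits_inj' (hmod k) (hmod l) hkl.2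
    exact digits_inj (digits_inj h1 (by omega)) h2
  · refine nodup_pairList fun k l hkl => ?_
    simp only [Prod.mk.injEq, Nat.add_left_cancel_iff] at hkl
    exact digits_inj hkl.1 hkl.2
  all_goals
    refine hd fun e he he' => ?_
    obtain ⟨h1, h2, h3, h4, h5⟩ := h.kind (e := e)
    try simp only [List.mem_append] at he'
  · have := h4 he; have := h5 he'; omega
  · have := h3 he
    rcases he' with he' | he'
    · have := h4 he'; omega
    · have := h5 he'; omega
  · have := h2 he
    rcases he' with he' | he' | he'
    · have := h3 he'; omega
    · have := h4 he'; omega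
    · have := h5 he'; omega
  · have := h1 he
    rcases he' with he' | he' | he' | he'
    · have := h2 he'; omega
    · have := h3 he'; omega
    · have := h4 he'; omega
    · have := h5 he'; omega

/-- The graph of the reduction. -/
def graph (h : R.Valid) : EdgeListGraph where
  n := 8 * R.Bl
  edges := R.allEdges.pmap (fun e he => (⟨e.1, he.1⟩, ⟨e.2, he.2⟩)) h.lt_of_mem
  nodup := h.nodup.pmap fun a _ b _ hab => by
    simpa [Prod.ext_iff] using hab
  loopless := fun e he => by
    obtain ⟨a, ha, rfl⟩ := List.mem_pmap.1 he
    simpa using h.ne_of_mem a ha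

theorem graph_n (h : R.Valid) : (graph h).n = 8 * R.Bl := rfl

theorem graph_m (h : R.Valid) : (graph h).m = R.allEdges.length := by
  simp [EdgeListGraph.m, graph]

theorem flatMap_pmap_val {n : ℕ} : ∀ (L : List (ℕ × ℕ)) (H : ∀ e ∈ L, e.1 < n ∧ e.2 < n),
    (L.pmap (fun e he => ((⟨e.1, he.1⟩ : Fin n), (⟨e.2, he.2⟩ : Fin n))) H).flatMap
      (fun e => [e.1.val, e.2.val]) = L.flatMap fun e => [e.1, e.2]
  | [], _ => rfl
  | e :: L, H => by simp [flatMap_pmap_val L fun e he => H e (List.mem_cons_of_mem _ he)]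

theorem graph_encode (h : R.Valid) : (graph h).encode =
    8 * R.Bl :: R.allEdges.length :: R.allEdges.flatMap fun e => [e.1, e.2] := by
  rw [EdgeListGraph.encode, graph_m]
  simp only [graph]
  rw [flatMap_pmap_val]

theorem graph_mem (h : R.Valid) {x y : Fin (graph h).n} :
    (x, y) ∈ (graph h).edges ↔ (x.val, y.val) ∈ R.allEdges := by
  refine Iff.trans List.mem_pmap ⟨?_, fun he => ⟨_, he, rfl⟩⟩
  rintro ⟨e, he, h1⟩
  have h2 : e.1 = x.val := congrArg (fun z => z.1.val) h1
  have h3 : e.2 = y.val := congrArg (fun z => z.2.val) h1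
  rw [← h2, ← h3]
  exact he

theorem Valid.n_pos (h : R.Valid) : 0 < (graph h).n := by
  have := h.A_pos; have := h.A_le_Bl; rw [graph_n]; omega

/-- A node of the graph. -/
def node (h : R.Valid) (x : ℕ) : Fin (graph h).n := ⟨x % (graph h).n, Nat.mod_lt _ h.n_pos⟩

theorem node_val (h : R.Valid) {x : ℕ} (hx : x < 8 * R.Bl) : (node h x).val = x :=
  Nat.mod_eq_of_lt hx

theorem unitCap_node (h : R.Valid) {x y : ℕ} (hxy : (x, y) ∈ R.allEdges) :
    1 ≤ (graph h).unitCap (node h x) (node h y) := by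
  obtain ⟨hx, hy⟩ := h.lt_of_mem _ hxy
  rw [EdgeListGraph.unitCap, if_pos]
  rw [graph_mem, node_val h hx, node_val h hy]
  exact hxy

/-- Slot `t` is not satisfied by the assignment made of `α`, `β`, and the third block of `t`. -/
def full (R : RedParams) (α β t : ℕ) : ℕ := R.bit α t * R.u (R.A + β) (t % R.s)

/-- The number of unsatisfied slots. -/
def unsat (R : RedParams) (α β γ : ℕ) : ℕ :=
  ∑ i ∈ Finset.range R.s, R.full α β (γ * R.s + i)

theorem Valid.full_le (h : R.Valid) (α β t : ℕ) : R.full α β t ≤ 1 :=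
  (Nat.mul_le_mul (h.bit_le _ _) (h.u_le _ _)).trans (by norm_num)

theorem Valid.unsat_eq (h : R.Valid) (α β γ : ℕ) : R.unsat α β γ =
    ((Finset.range R.s).filter fun i => R.full α β (γ * R.s + i) ≠ 0).card := by
  rw [unsat, Finset.card_filter]
  refine Finset.sum_congr rfl fun i _ => ?_
  have := h.full_le α β (γ * R.s + i)
  split_ifs with h0 <;> omega

/-! ### Upper bound for the flow values by a cut. -/

section Flow

variable {α β p : ℕ} (h : R.Valid) (hα : α < R.A) (hβ : β < R.A) (hp : p < R.s)

include hα hβ hp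

/-- The source side of the cut consists of `α`, the copies of the slots of `γ` that `α` uses, the
slack nodes of `γ`, and every sink except the target. It is left by the `Gm * s - s` edges from `α`
to slots of other third blocks, by at most `unsat` direct edges, and by `p + 1` slack edges. -/
theorem Valid.value_lt {γ : ℕ} (hγ : γ < R.Gm) (hu : R.unsat α β γ + p + 1 < R.s)
    {f : Fin (graph h).n → Fin (graph h).n → ℝ}
    (hf : IsFlow (graph h).unitCap (node h α) (node h (R.Bl + (β * R.s + p))) f) :
    flowValue f (node h α) < (R.Gm * R.s : ℕ) := by
  have hG := h.Gm_le
  have hA := h.A_le_Bl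
  have hs := h.s_pos
  have hsink := h.sink_lt hβ hp
  have hslot : ∀ i < R.s, γ * R.s + i < R.Gm * R.s := fun i hi =>
    Nat.lt_mul_iff_exists_digits.2 ⟨γ, hγ, i, hi, rfl⟩
  set T := R.Bl + (β * R.s + p) with hT
  set M : ℕ → ℕ := fun t => 2 * R.Bl + (2 * t + R.bit α t) with hM
  let S : Fin (graph h).n → Prop := fun x => x.val = α ∨ (∃ i < R.s, x.val = M (γ * R.s + i)) ∨
    (∃ i < R.s, x.val = 3 * R.Bl + (γ * R.s + i)) ∨ (R.Bl ≤ x.val ∧ x.val < 2 * R.Bl ∧ x.val ≠ T)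
  let X₁ := ((Finset.range (R.Gm * R.s)) \ (Finset.range R.s).image fun i => γ * R.s + i).image
    fun t => (node h α, node h (M t))
  let X₂ := ((Finset.range R.s).filter fun i => R.full α β (γ * R.s + i) ≠ 0).image
    fun i => (node h (M (γ * R.s + i)), node h T)
  let X₃ := (Finset.range (p + 1)).image
    fun i => (node h (3 * R.Bl + (γ * R.s + i)), node h T)
  have hX : (X₁ ∪ (X₂ ∪ X₃)).card < R.Gm * R.s := by
    have h1 : X₁.card ≤ R.Gm * R.s - R.s := by
      refine Finset.card_image_le.trans ?_
      rw [Finset.card_sdiff_of_subset, Finset.card_image_of_injective, Finset.card_range,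
        Finset.card_range]
      · intro i j hij
        simpa using hij
      · intro t ht
        obtain ⟨i, hi, rfl⟩ := Finset.mem_image.1 ht
        exact Finset.mem_range.2 (hslot i (Finset.mem_range.1 hi))
    have h2 : X₂.card ≤ R.unsat α β γ := by
      rw [h.unsat_eq]; exact Finset.card_image_le
    have h3 : X₃.card ≤ p + 1 := Finset.card_image_le.trans (by simp)
    have h4 := Finset.card_union_le X₁ (X₂ ∪ X₃)
    have h5 := Finset.card_union_le X₂ X₃
    have h6 := hslot 0 hs
    have h7 : R.s ≤ R.Gm * R.s := Nat.le_mul_of_pos_left _ h.Gm_pos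
    omega
  refine lt_of_le_of_lt ((graph h).flowValue_le_card_of_cut hf S ?_ ?_ (X₁ ∪ (X₂ ∪ X₃)) ?_)
    (by exact_mod_cast hX)
  · left; exact node_val h (by omega)
  · have hTv := node_val h (x := T) (by omega)
    simp only [S, hTv, hM, not_or, not_exists, not_and]
    refine ⟨by omega, fun i hi => by omega, fun i hi => by omega, fun _ _ => by simp⟩
  · rintro ⟨x, y⟩ hxy hx hy
    rw [graph_mem] at hxy
    simp only [S, not_or, not_exists, not_and, not_not] at hx hy
    have hext : ∀ {z : Fin (graph h).n} {k : ℕ}, z.val = k → z = node h k := fun {z k} hz => by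
      apply Fin.ext; rw [node_val h (by rw [← hz]; exact z.2), hz]
    simp only [allEdges, List.mem_append] at hxy
    simp only [Finset.mem_union]
    rcases hxy with he | he | he | he | he
    · left
      have hk := h.kind.1 he
      obtain ⟨t, ht, hxA, hyt⟩ := R.mem_outEdges.1 he
      have hxα : x.val = α := by
        rcases hx with hx | ⟨i, hi, hx⟩ | ⟨i, hi, hx⟩ | hx
        · exact hx
        all_goals (try simp only [hM] at hx); omega
      rw [hxα] at hyt
      refine Finset.mem_image.2 ⟨t, Finset.mem_sdiff.2 ⟨Finset.mem_range.2 ht, fun hmem => ?_⟩, ?_⟩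
      · obtain ⟨i, hi, rfl⟩ := Finset.mem_image.1 hmem
        exact hy.2.1 i (Finset.mem_range.1 hi) hyt
      · rw [← hext hxα, ← hext hyt]
    · exfalso
      -- Middle edges preserve the third-block assignment, so from a copy on the source side they
      -- end in a slack node that is there too.
      obtain ⟨t, ht, b, hb, j, hj, hxt, hyt⟩ := R.mem_midEdges.1 he
      rcases hx with hx | ⟨i, hi, hx⟩ | ⟨i, hi, hx⟩ | hx
      · omega
      · have := h.bit_le α (γ * R.s + i)
        have : t = γ * R.s + i := by simp only [hM] at hx; omega
        rw [this, Nat.digits_div hi] at hyt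
        exact hy.2.2.1 j hj hyt
      · have := hslot i hi; omega
      · omega
    · right; left
      obtain ⟨β', hβ', t, ht, p', hp', hu', hxt, hyt⟩ := R.mem_directEdges.1 he
      have hk := h.kind.2.2.1 he
      have hyT : y.val = T := hy.2.2.2 hk.2.2.1 hk.2.2.2
      rcases hx with hx | ⟨i, hi, hx⟩ | ⟨i, hi, hx⟩ | hx
      · omega
      · have hb := h.bit_le α (γ * R.s + i)
        have htt : t = γ * R.s + i := by simp only [hM] at hx; omega
        have hb1 : R.bit α (γ * R.s + i) = 1 := by simp only [hM] at hx; omega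
        have hββ : β' = β := (digits_inj' hp' hp (show β' * R.s + p' = β * R.s + p by omega)).1
        refine Finset.mem_image.2 ⟨i, Finset.mem_filter.2 ⟨Finset.mem_range.2 hi, ?_⟩, ?_⟩
        · rw [full, hb1, one_mul, ← htt, ← hββ]; exact hu'
        · rw [← hext hx, ← hext hyT]
      · have := hslot i hi; omega
      · omega
    · right; right
      obtain ⟨β', hβ', t, ht, p', hp', hu', hxt, hyt⟩ := R.mem_slackEdges.1 he
      have hk := h.kind.2.2.2.1 he
      have hyT : y.val = T := hy.2.2.2 hk.2.2.1 hk.2.2.2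
      rcases hx with hx | ⟨i, hi, hx⟩ | ⟨i, hi, hx⟩ | hx
      · omega
      · have := hslot i hi
        have := h.bit_le α (γ * R.s + i)
        simp only [hM] at hx; omega
      · have htt : t = γ * R.s + i := by omega
        have hpp : p' = p := (digits_inj' hp' hp (show β' * R.s + p' = β * R.s + p by omega)).2
        rw [htt, Nat.digits_mod hi, hpp] at hu'
        refine Finset.mem_image.2 ⟨i, Finset.mem_range.2 (by omega), ?_⟩
        rw [← hext hx, ← hext hyT]
      · omega
    · exfalso
      have := mem_padEdges_ge he
      rcases hx with hx | ⟨i, hi, hx⟩ | ⟨i, hi, hx⟩ | hx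
      · omega
      · have := hslot i hi
        have := h.bit_le α (γ * R.s + i)
        simp only [hM] at hx; omega
      · have := hslot i hi; omega
      · omega

end Flow

end RedParams

namespace RedParams

variable {R : RedParams}

/-! ### Lower bound for the flow values by edge-disjoint walks. -/

section Flow

variable {α β p : ℕ} (h : R.Valid) (hα : α < R.A) (hβ : β < R.A) (hp : p < R.s)

/-- The walk through slot `t` that uses the slack node `o`, unless `t` is unsatisfied. -/
def walk (h : R.Valid) (α β p o t : ℕ) : List (Fin (graph h).n) :=
  if R.full α β t ≠ 0 then
    [node h (2 * R.Bl + (2 * t + R.bit α t)), node h (R.Bl + (β * R.s + p))]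
  else [node h (2 * R.Bl + (2 * t + R.bit α t)), node h (3 * R.Bl + (t / R.s * R.s + o)),
    node h (R.Bl + (β * R.s + p))]

include hα hβ hp

/-- Walks through different slots use different copies, so only their last edges, from slack nodes
to the sink, could coincide, and `hinj` forbids this. The list `T` is arbitrary because it serves
twice: with all slots for saturation, and with a single slot for positivity. -/
theorem Valid.exists_flow (T : List ℕ) (hT : ∀ t ∈ T, t < R.Gm * R.s) (hnd : T.Nodup) (o : ℕ → ℕ)
    (ho : ∀ t ∈ T, R.full α β t = 0 → o t ≤ p)
    (hinj : ∀ t ∈ T, ∀ t' ∈ T, R.full α β t = 0 → R.full α β t' = 0 → t / R.s = t' / R.s →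
      o t = o t' → t = t') :
    ∃ f, IsFlow (graph h).unitCap (node h α) (node h (R.Bl + (β * R.s + p))) f ∧
      flowValue f (node h α) = T.length := by
  have hG := h.Gm_le
  have hA := h.A_le_Bl
  have hs := h.s_pos
  have hsink := h.sink_lt hβ hp
  have hinjN : ∀ {x y : ℕ}, x < 8 * R.Bl → y < 8 * R.Bl → node h x = node h y → x = y :=
    fun {x y} hx hy hxy => by
      rw [← node_val h hx, ← node_val h hy, hxy]
  have hslack : ∀ t ∈ T, R.full α β t = 0 → t / R.s * R.s + o t < R.Gm * R.s := fun t ht h0 =>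
    slot_lt (hT t ht) ((ho t ht h0).trans_lt hp)
  refine exists_flow_of_walks (fun heq => ?_) (graph h).unitCap_nonneg T
    (fun t => walk h α β p (o t) t) (fun t ht => ?_) ?_ (fun t ht e he => ?_)
  · have := hinjN (by omega) (by omega) heq
    omega
  · unfold walk; split_ifs <;> simp
  · refine List.nodup_flatMap.2 ⟨fun t ht => ?_, ?_⟩
    · have hb := h.bit_le α t
      have ht' := hT t ht
      unfold walk
      split_ifs with h0
      · simp only [walkArcs, List.nodup_cons, List.mem_singleton, List.not_mem_nil,
          not_false_eq_true, List.nodup_nil, and_true, Prod.mk.injEq, not_and]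
        intro h1
        have := hinjN (by omega) (by omega) h1
        omega
      · have hsl := hslack t ht (by omega)
        simp only [walkArcs, List.nodup_cons, List.mem_cons, List.not_mem_nil, or_false,
          not_false_eq_true, List.nodup_nil, and_true, Prod.mk.injEq, not_or, not_and]
        refine ⟨⟨fun h1 => ?_, fun h1 => ?_⟩, fun h1 => ?_⟩
        all_goals
          have := hinjN (by omega) (by omega) h1
          omega
    · refine hnd.pairwise_of_forall_ne fun t ht t' ht' htt => ?_
      rw [Function.onFun, List.disjoint_left]
      intro e he he'
      have hb := h.bit_le α t
      have hb' := h.bit_le α t'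
      have h1 := hT t ht
      have h2 := hT t' ht'
      have hM : node h (2 * R.Bl + (2 * t + R.bit α t)) ≠
          node h (2 * R.Bl + (2 * t' + R.bit α t')) := fun hh => by
        have := hinjN (by omega) (by omega) hh
        omega
      have hne : ∀ {x y : ℕ}, x < 8 * R.Bl → y < 8 * R.Bl → x ≠ y → node h x ≠ node h y :=
        fun hx hy hxy hh => hxy (hinjN hx hy hh)
      have e1 := hne (x := α) (y := 2 * R.Bl + (2 * t + R.bit α t)) (by omega) (by omega) (by omega)
      have e2 := hne (x := α) (y := 2 * R.Bl + (2 * t' + R.bit α t')) (by omega) (by omega)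
        (by omega)
      have e7 := hne (x := α) (y := R.Bl + (β * R.s + p)) (by omega) (by omega) (by omega)
      have e8 := hne (x := R.Bl + (β * R.s + p)) (y := 2 * R.Bl + (2 * t + R.bit α t)) (by omega)
        (by omega) (by omega)
      have e9 := hne (x := R.Bl + (β * R.s + p)) (y := 2 * R.Bl + (2 * t' + R.bit α t')) (by omega)
        (by omega) (by omega)
      simp only [walk] at he he'
      split_ifs at he he' with h3 h4 h4
      · simp only [walkArcs, List.mem_cons, List.not_mem_nil, or_false] at he he'
        rcases he with rfl | rfl <;> rcases he' with he' | he' <;>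
          simp only [Prod.mk.injEq] at he' <;> tauto
      · have hsl := hslack t' ht' (by omega)
        have e3 := hne (x := 3 * R.Bl + (t' / R.s * R.s + o t'))
          (y := 2 * R.Bl + (2 * t + R.bit α t)) (by omega) (by omega) (by omega)
        simp only [walkArcs, List.mem_cons, List.not_mem_nil, or_false] at he he'
        rcases he with rfl | rfl <;> rcases he' with he' | he' | he' <;>
          simp only [Prod.mk.injEq] at he' <;> tauto
      · have hsl := hslack t ht (by omega)
        have e3 := hne (x := 3 * R.Bl + (t / R.s * R.s + o t))
          (y := 2 * R.Bl + (2 * t' + R.bit α t')) (by omega) (by omega) (by omega)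
        simp only [walkArcs, List.mem_cons, List.not_mem_nil, or_false] at he he'
        rcases he with rfl | rfl | rfl <;> rcases he' with he' | he' <;>
          simp only [Prod.mk.injEq] at he' <;> tauto
      · have hsl := hslack t ht (by omega)
        have hsl' := hslack t' ht' (by omega)
        have e3 := hne (x := 3 * R.Bl + (t / R.s * R.s + o t))
          (y := 2 * R.Bl + (2 * t' + R.bit α t')) (by omega) (by omega) (by omega)
        have e4 := hne (x := 3 * R.Bl + (t' / R.s * R.s + o t'))
          (y := 2 * R.Bl + (2 * t + R.bit α t)) (by omega) (by omega) (by omega)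
        have e5 := hne (x := 3 * R.Bl + (t / R.s * R.s + o t))
          (y := 3 * R.Bl + (t' / R.s * R.s + o t')) (by omega) (by omega) (fun hh => by
            obtain ⟨g1, g2⟩ := digits_inj' ((ho t ht (by omega)).trans_lt hp)
              ((ho t' ht' (by omega)).trans_lt hp) (Nat.add_left_cancel hh)
            exact htt (hinj t ht t' ht' (by omega) (by omega) g1 g2))
        have e6 := hne (x := 3 * R.Bl + (t / R.s * R.s + o t)) (y := α) (by omega) (by omega)
          (by omega)
        simp only [walkArcs, List.mem_cons, List.not_mem_nil, or_false] at he he'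
        rcases he with rfl | rfl | rfl <;> rcases he' with he' | he' | he' <;>
          simp only [Prod.mk.injEq] at he' <;> tauto
  · have ht' := hT t ht
    have hb := h.bit_le α t
    have hout : (α, 2 * R.Bl + (2 * t + R.bit α t)) ∈ R.allEdges :=
      List.mem_append_left _ (R.mem_outEdges.2 ⟨t, ht', hα, rfl⟩)
    simp only [walk] at he
    split_ifs at he with h0
    · simp only [walkArcs, List.mem_cons, List.not_mem_nil, or_false] at he
      have hb1 : R.bit α t ≠ 0 := fun hb0 => h0 (by rw [full, hb0, zero_mul])
      have hu1 : R.u (R.A + β) (t % R.s) ≠ 0 := fun hb0 => h0 (by rw [full, hb0, mul_zero])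
      rcases he with rfl | rfl
      · exact unitCap_node h hout
      · refine unitCap_node h (List.mem_append_right _ (List.mem_append_right _
          (List.mem_append_left _ (R.mem_directEdges.2 ⟨β, hβ, t, ht', p, hp, hu1, ?_, rfl⟩))))
        omega
    · have hfull : R.full α β t = 0 := by omega
      have hop := ho t ht hfull
      simp only [walkArcs, List.mem_cons, List.not_mem_nil, or_false] at he
      rcases he with rfl | rfl | rfl
      · exact unitCap_node h hout
      · exact unitCap_node h (List.mem_append_right _ (List.mem_append_left _
          (R.mem_midEdges.2 ⟨t, ht', _, by omega, o t, by omega, rfl, rfl⟩)))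
      · refine unitCap_node h (List.mem_append_right _ (List.mem_append_right _
          (List.mem_append_right _ (List.mem_append_left _ (R.mem_slackEdges.2
          ⟨β, hβ, t / R.s * R.s + o t, hslack t ht hfull, p, hp, ?_, rfl, rfl⟩)))))
        rw [Nat.digits_mod (by omega)]
        exact hop

/-- If every third block leaves enough slots unsatisfied, then all edges out of `α` are
saturated. -/
theorem Valid.exists_saturating_flow (hu : ∀ γ < R.Gm, R.s ≤ R.unsat α β γ + p + 1) :
    ∃ f, IsFlow (graph h).unitCap (node h α) (node h (R.Bl + (β * R.s + p))) f ∧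
      flowValue f (node h α) = (R.Gm * R.s : ℕ) := by
  have hs := h.s_pos
  have key : ∀ γ, ∃ o : ℕ → ℕ, γ < R.Gm →
      (∀ i < R.s, R.full α β (γ * R.s + i) = 0 → o i ≤ p) ∧
      ∀ i < R.s, ∀ i' < R.s, R.full α β (γ * R.s + i) = 0 → R.full α β (γ * R.s + i') = 0 →
        o i = o i' → i = i' := by
    intro γ
    by_cases hγ : γ < R.Gm
    -- The satisfied slots of `γ` number `s - unsat ≤ p + 1`, so they can be mapped injectively to
    -- the slack nodes that lead to the sink.
    · have hc : ((Finset.range R.s).filter fun i => R.full α β (γ * R.s + i) = 0).card ≤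
          (Finset.range (p + 1)).card := by
        have h1 := Finset.card_filter_add_card_filter_not (s := Finset.range R.s)
          (p := fun i => R.full α β (γ * R.s + i) = 0)
        have h2 := h.unsat_eq α β γ
        have h3 := hu γ hγ
        rw [Finset.card_range] at h1 ⊢
        simp only [ne_eq] at h2
        omega
      have hc' : (((Finset.range R.s).filter fun i => R.full α β (γ * R.s + i) = 0 : Finset ℕ) :
          Set ℕ).encard ≤ ((Finset.range (p + 1) : Finset ℕ) : Set ℕ).encard := by
        rw [Set.encard_coe_eq_coe_finsetCard, Set.encard_coe_eq_coe_finsetCard]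
        exact_mod_cast hc
      obtain ⟨o, ho1, ho2⟩ := (Finset.finite_toSet _).exists_injOn_of_encard_le hc'
      have hmem : ∀ i < R.s, R.full α β (γ * R.s + i) = 0 →
          i ∈ (((Finset.range R.s).filter fun i => R.full α β (γ * R.s + i) = 0 : Finset ℕ) :
            Set ℕ) := fun i hi h0 => by simp [hi, h0]
      refine ⟨o, fun _ => ⟨fun i hi h0 => ?_, fun i hi i' hi' h0 h0' hoo =>
        ho2 (hmem i hi h0) (hmem i' hi' h0') hoo⟩⟩
      have : o i ∈ ((Finset.range (p + 1) : Finset ℕ) : Set ℕ) := ho1 (hmem i hi h0)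
      have : o i < p + 1 := by simpa using this
      omega
    · exact ⟨id, fun h => absurd h hγ⟩
  choose o ho using key
  have hfl := h.exists_flow hα hβ hp (List.range (R.Gm * R.s))
    (fun t ht => List.mem_range.1 ht) List.nodup_range (fun t => o (t / R.s) (t % R.s)) ?_ ?_
  · obtain ⟨f, hf, hv⟩ := hfl
    exact ⟨f, hf, by rw [hv, List.length_range]⟩
  · intro t ht h0
    have hq : t / R.s < R.Gm := Nat.div_lt_of_lt_mul (by rw [mul_comm]; exact List.mem_range.1 ht)
    refine (ho _ hq).1 (t % R.s) (Nat.mod_lt _ hs) ?_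
    rwa [mul_comm, Nat.div_add_mod]
  · intro t ht t' ht' h0 h0' htt hoo
    have hq : t / R.s < R.Gm := Nat.div_lt_of_lt_mul (by rw [mul_comm]; exact List.mem_range.1 ht)
    have := (ho _ hq).2 (t % R.s) (Nat.mod_lt _ hs) (t' % R.s) (Nat.mod_lt _ hs)
      (by rwa [mul_comm, Nat.div_add_mod]) (by rwa [htt, mul_comm, Nat.div_add_mod])
      (by rw [hoo, htt])
    exact digits_inj htt this

/-- Even threshold `0` leaves one slack node, so a single walk always exists and the value is
positive. Positivity is what later forces an algorithm to write the corresponding cell. -/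
theorem Valid.isMaxFlowValue_iff {x : ℕ}
    (hx : IsMaxFlowValue (graph h).unitCap (node h α) (node h (R.Bl + (β * R.s + p))) x) :
    0 < x ∧ (x < R.Gm * R.s ↔ ∃ γ < R.Gm, R.unsat α β γ + p + 1 < R.s) := by
  obtain ⟨⟨f, hf, hfv⟩, hmax⟩ := hx
  constructor
  · obtain ⟨g, hg, hgv⟩ := h.exists_flow hα hβ hp [0] (by
      have := Nat.mul_pos h.Gm_pos h.s_pos
      simpa using this) (by simp) (fun _ => 0) (by simp) (by simp)
    have := hmax ⟨g, hg, hgv⟩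
    have h1 : (1 : ℝ) ≤ x := by simpa using this
    exact_mod_cast h1
  · constructor
    · intro hlt
      by_contra! hcon
      obtain ⟨g, hg, hgv⟩ := h.exists_saturating_flow hα hβ hp fun γ hγ => hcon γ hγ
      have : ((R.Gm * R.s : ℕ) : ℝ) ≤ x := hmax ⟨g, hg, hgv⟩
      have : R.Gm * R.s ≤ x := by exact_mod_cast this
      omega
    · rintro ⟨γ, hγ, hu⟩
      have := h.value_lt hα hβ hp hγ hu hf
      rw [hfv] at this
      exact_mod_cast this

end Flow

end RedParams

namespace WordRAM

/-! ### Frames, and loops that append pairs to an output array -/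

/-- Only the registers of the list `R` and the arrays of the list `M` have changed. -/
structure Frame (R M : List ℕ) (s s' : State) : Prop where
  reg : ∀ r, r ∉ R → s'.reg r = s.reg r
  mem : ∀ A, A ∉ M → s'.mem A = s.mem A

namespace Frame

variable {R M R' M' : List ℕ} {s s' s'' : State}

theorem refl (R M : List ℕ) (s : State) : Frame R M s s := ⟨fun _ _ => rfl, fun _ _ => rfl⟩

theorem trans (h : Frame R M s s') (h' : Frame R M s' s'') : Frame R M s s'' :=
  ⟨fun r hr => (h'.reg r hr).trans (h.reg r hr), fun r hr => (h'.mem r hr).trans (h.mem r hr)⟩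

theorem mono (h : Frame R M s s') (hR : R ⊆ R') (hM : M ⊆ M') : Frame R' M' s s' :=
  ⟨fun r hr => h.reg r fun h' => hr (hR h'), fun r hr => h.mem r fun h' => hr (hM h')⟩

theorem setReg (h : Frame R M s s') {r : ℕ} (hr : r ∈ R) (x : ℕ) : Frame R M s (s'.setReg r x) :=
  ⟨fun r' hr' => (State.reg_setReg_of_ne (by rintro rfl; exact hr' hr)).trans (h.reg r' hr'), h.mem⟩

theorem setMem (h : Frame R M s s') {A : ℕ} (hA : A ∈ M) (i x : ℕ) :
    Frame R M s (s'.setMem A i x) :=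
  ⟨h.reg, fun A' hA' => by
    rw [← h.mem A' hA']
    funext j
    rw [State.mem_setMem, if_neg]
    rintro ⟨rfl, -⟩
    exact hA' hA⟩

end Frame

notation "rPtr" => (18 : ℕ)
notation "rk" => (19 : ℕ)
notation "rck" => (20 : ℕ)

/-- The list `l` has been written to the window of array `16` that starts at `off`. -/
structure Emitted (off lim : ℕ) (l : List ℕ) (s : State) : Prop where
  ptr : s.reg rPtr = off + l.length
  cell : ∀ i, s.mem 16 (off + i) = l.getD i 0
  lt : ∀ j, s.mem 16 j < lim

theorem Emitted.append {off lim : ℕ} {l : List ℕ} {s : State} (h : Emitted off lim l s) {x : ℕ}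
    (hx : x < lim) :
    Emitted off lim (l ++ [x]) ((s.setMem 16 (off + l.length) x).setReg rPtr
      (off + l.length + 1)) := by
  refine ⟨by rw [State.reg_setReg_self]; simp [add_assoc], fun i => ?_, fun j => ?_⟩
  · change (s.setMem 16 (off + l.length) x).mem 16 (off + i) = _
    rw [State.mem_setMem, h.cell]
    rcases lt_trichotomy i l.length with hi | hi | hi
    · rw [if_neg (by omega), List.getD_append _ _ _ _ hi]
    · rw [if_pos (by omega), List.getD_append_right _ _ _ _ (by omega), hi]; simp
    · rw [if_neg (by omega), List.getD_append_right _ _ _ _ (by omega),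
        List.getD_eq_default _ _ (by omega), List.getD_eq_default _ _ (by simp; omega)]
  · change (s.setMem 16 (off + l.length) x).mem 16 j < lim
    rw [State.mem_setMem]
    split_ifs
    · exact hx
    · exact h.lt j

theorem Emitted.congr {off lim : ℕ} {l : List ℕ} {s s' : State} (h : Emitted off lim l s)
    (hr : s'.reg rPtr = s.reg rPtr) (hm : s'.mem 16 = s.mem 16) : Emitted off lim l s' :=
  ⟨hr.trans h.ptr, fun i => by rw [hm, h.cell], fun j => by rw [hm]; exact h.lt j⟩

/-- For `k = 0, …, bnd - 1`: if `c` is nonzero then append the values of `eu` and `ev`. -/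
def emitLoop (bnd c eu ev : Expr) : Prog :=
  forLoop rk rck bnd (cond c
    (.seq (put 16 (.var rPtr) eu) (.seq (assign rPtr (.var rPtr + .lit 1))
      (.seq (put 16 (.var rPtr) ev) (assign rPtr (.var rPtr + .lit 1))))) .skip)

/-- The words that encode a list of pairs. -/
def words (L : List (ℕ × ℕ)) : List ℕ := L.flatMap fun e => [e.1, e.2]

theorem words_append (L L' : List (ℕ × ℕ)) : words (L ++ L') = words L ++ words L' :=
  List.flatMap_append

theorem length_words (L : List (ℕ × ℕ)) : (words L).length = 2 * L.length := by
  induction L with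
  | nil => rfl
  | cons e L ih => simp only [words, List.flatMap_cons, List.length_append] at *; simp [ih]; ring

theorem pairList_succ (N : ℕ) (c : ℕ → Prop) [DecidablePred c] (f : ℕ → ℕ × ℕ) :
    pairList (N + 1) c f = pairList N c f ++ if c N then [f N] else [] := by
  rw [pairList, List.range_succ, List.filter_append, List.map_append, pairList]
  by_cases h : c N <;> simp [h]

/-- The conditions `hc` and `hf` range over all states that differ from `s` only in the loop
registers, the pointer and the output array: `ev` is evaluated after the first word of the pair has
already been stored. -/
theorem Runs.emitLoop {v off lim N T : ℕ} {l : List ℕ} {s : State} {bnd c eu ev : Expr}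
    {C : ℕ → Prop} [DecidablePred C] {f : ℕ → ℕ × ℕ} (hv : 1 ≤ v) (hE : Emitted off lim l s)
    (hwb : bnd.wf = true) (hwc : c.wf = true) (hwu : eu.wf = true) (hwv : ev.wf = true)
    (hbb : bnd.Bd (2 ^ v) s) (hN : bnd.eval s = N) (hNv : N < 2 ^ v)
    (hroom : off + l.length + 2 * N + 1 < 2 ^ v)
    (hc : ∀ k < N, ∀ s', Frame [rk, rck, rPtr] [16] s s' → s'.reg rk = k →
      c.Bd (2 ^ v) s' ∧ (c.eval s' ≠ 0 ↔ C k))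
    (hf : ∀ k < N, C k → ∀ s', Frame [rk, rck, rPtr] [16] s s' → s'.reg rk = k →
      (eu.Bd (2 ^ v) s' ∧ ev.Bd (2 ^ v) s') ∧ eu.eval s' = (f k).1 ∧ ev.eval s' = (f k).2)
    (hlim : ∀ k < N, C k → (f k).1 < lim ∧ (f k).2 < lim)
    (hT : c.size + (eu.size + ev.size + 22) ≤ T) (hbT : bnd.size ≤ 5) :
    Runs v (emitLoop bnd c eu ev) s (fun s' => Frame [rk, rck, rPtr] [16] s s' ∧
      Emitted off lim (l ++ words (pairList N C f)) s') (N * T + 9) := by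
  have h1v : 1 < 2 ^ v := Nat.one_lt_two_pow (by omega)
  have hlen : ∀ k < N, (l ++ words (pairList k C f)).length ≤ l.length + 2 * k := fun k _ => by
    rw [List.length_append, length_words]
    have := length_pairList_le k C f
    omega
  refine (Runs.forLoop (v := v) (N := N) (T := c.size + (eu.size + ev.size + 12 + 1))
    (fun k s' => Frame [rk, rck, rPtr] [16] s s' ∧ Emitted off lim (l ++ words (pairList k C f)) s')
    (by norm_num) (by norm_num) (by norm_num) hv hwb hbb hN hNv ?_ ?_ ?_ (fun _ h => h)).le
    (by rw [show c.size + (eu.size + ev.size + 12 + 1) + 9 = c.size + (eu.size + ev.size + 22)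
          by omega]; have := Nat.mul_le_mul_left N hT; omega)
  · rintro k s' x y ⟨h1, h2⟩
    exact ⟨(h1.setReg (by simp) _).setReg (by simp) _, h2.congr rfl rfl⟩
  · exact ⟨.refl _ _ _, by simpa [pairList, words] using hE⟩
  · rintro k hk s' ⟨h1, h2⟩ hsk
    obtain ⟨hcb, hce⟩ := hc k hk s' h1 hsk
    have hlk := hlen k hk
    refine Runs.cond hwc hv hcb (fun h0 => ?_) fun h0 => ?_
    · have hCk := hce.1 h0
      obtain ⟨⟨hub, hvb⟩, hue, hve⟩ := hf k hk hCk s' h1 hsk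
      have hp := h2.ptr
      set l' := l ++ words (pairList k C f) with hl'
      set s₁ := (s'.setMem 16 (off + l'.length) (f k).1).setReg rPtr (off + l'.length + 1) with hs₁
      have hE₁ : Emitted off lim (l' ++ [(f k).1]) s₁ := h2.append (hlim k hk hCk).1
      have hF₁ : Frame [rk, rck, rPtr] [16] s s₁ := (h1.setMem (by simp) _ _).setReg (by simp) _
      have hk₁ : s₁.reg rk = k := by rw [hs₁, State.reg_setReg_of_ne (by norm_num)]; exact hsk
      obtain ⟨⟨-, hvb₁⟩, -, hve₁⟩ := hf k hk hCk s₁ hF₁ hk₁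
      set s₂ := (s₁.setMem 16 (off + (l' ++ [(f k).1]).length) (f k).2).setReg rPtr
        (off + (l' ++ [(f k).1]).length + 1) with hs₂
      have hE₂ : Emitted off lim (l' ++ [(f k).1] ++ [(f k).2]) s₂ :=
        hE₁.append (hlim k hk hCk).2
      have hF₂ : Frame [rk, rck, rPtr] [16] s s₂ := (hF₁.setMem (by simp) _ _).setReg (by simp) _
      have hp₁ := hE₁.ptr
      have hl₁ : (l' ++ [(f k).1]).length = l'.length + 1 := by simp
      refine Runs.le (T := 1 + (eu.size + 1) + (3 + 1 + (1 + (ev.size + 1) + (3 + 1)))) ?_ (by omega)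
      refine Runs.put_seq rfl hwu hv (by rw [Expr.bd_var]; omega) hub hp hue ?_
      refine Runs.assign_seq rfl hv ?_ (x := off + l'.length + 1) ?_ ?_
      · rw [Expr.bd_add, Expr.bd_var, Expr.bd_lit]
        change s'.reg rPtr < _ ∧ _; omega
      · rw [Expr.eval_add, Expr.eval_var, Expr.eval_lit]
        change s'.reg rPtr + 1 = _; rw [hp]
      refine Runs.put_seq rfl hwv hv (by rw [Expr.bd_var]; change s₁.reg rPtr < _; omega) hvb₁ hp₁ hve₁ ?_
      refine Runs.assign' rfl hv ?_ (x := off + (l' ++ [(f k).1]).length + 1) ?_ ⟨?_, ?_, hF₂, ?_⟩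
      · rw [Expr.bd_add, Expr.bd_var, Expr.bd_lit]
        change s₁.reg rPtr < _ ∧ _; omega
      · rw [Expr.eval_add, Expr.eval_var, Expr.eval_lit]
        change s₁.reg rPtr + 1 = _; rw [hp₁]
      · rw [State.reg_setReg_of_ne (by norm_num)]; exact hk₁
      · rw [State.reg_setReg_of_ne (by norm_num)]
        change s₁.reg rck = _
        rw [hs₁, State.reg_setReg_of_ne (by norm_num)]; rfl
      · rw [pairList_succ, if_pos hCk, words_append, ← List.append_assoc, ← hl']
        have : words [f k] = [(f k).1] ++ [(f k).2] := rfl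
        rw [this, ← List.append_assoc]
        exact hE₂
    · refine (Runs.skip ?_).le (by omega)
      have hCk : ¬ C k := fun h => hce.2 h h0
      refine ⟨hsk, rfl, h1, ?_⟩
      rw [pairList_succ, if_neg hCk, List.append_nil]
      exact h2

end WordRAM

/-! ### Clauses under partial assignments -/

/-- The literal with code `l` is true under the partial assignment `row % 2 ^ a` of the variables of
block number `row / 2 ^ a`, where the variables are divided into blocks of size `a`. -/
def litTrue (a row l : ℕ) : ℕ :=
  if l / 2 / a = row / 2 ^ a ∧ row % 2 ^ a / 2 ^ (l / 2 % a) % 2 = l % 2 then 1 else 0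

/-- Indicator that clause `i` has no literal that is true under the partial assignment `row`. -/
def unsatTable (cs : List (List ℕ)) (a row i : ℕ) : ℕ :=
  if i < cs.length then 1 - ((cs.getD i []).map (litTrue a row)).sum else 0

theorem unsatTable_le (cs : List (List ℕ)) (a row i : ℕ) : unsatTable cs a row i ≤ 1 := by
  unfold unsatTable; split_ifs <;> omega

theorem unsatTable_eq_one_iff {cs : List (List ℕ)} {a row i : ℕ} (hi : i < cs.length) :
    unsatTable cs a row i = 1 ↔ ∀ l ∈ cs.getD i [], litTrue a row l = 0 := by
  rw [unsatTable, if_pos hi]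
  constructor
  · intro h l hl
    have h0 : ((cs.getD i []).map (litTrue a row)).sum = 0 := by omega
    exact List.sum_eq_zero_iff.1 h0 _ (List.mem_map_of_mem hl)
  · intro h
    have h0 : ((cs.getD i []).map (litTrue a row)).sum = 0 :=
      List.sum_eq_zero_iff.2 fun x hx => by
        obtain ⟨l, hl, rfl⟩ := List.mem_map.1 hx
        exact h l hl
    omega

namespace CNFFormula

/-- Code of a literal. -/
def litCode {n : ℕ} (l : Fin n × Bool) : ℕ := 2 * l.1.val + l.2.toNat

/-- The clauses as lists of codes. -/
def codes (F : CNFFormula) : List (List ℕ) := F.clauses.map fun c => c.map litCode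

theorem codes_length (F : CNFFormula) : F.codes.length = F.m := by simp [codes, m]

theorem encode_eq (F : CNFFormula) :
    F.encode = F.n :: F.m :: F.codes.flatMap fun c => c.length :: c := by
  simp [encode, codes, List.flatMap_map]
  rfl

/-- The assignment made of the bits of the three blocks. -/
def joined (n a α β γ : ℕ) (v : Fin n) : Bool :=
  (if v.val / a = 0 then α else if v.val / a = 1 then β else γ).testBit (v.val % a)

theorem exists_testBit (k : ℕ) (g : ℕ → Bool) : ∃ z < 2 ^ k, ∀ j < k, z.testBit j = g j :=
  ⟨Nat.ofBits (fun j : Fin k => g j), Nat.ofBits_lt_two_pow _, fun j hj => by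
    rw [Nat.testBit_ofBits_lt _ _ hj]⟩

/-- As the third block is no longer than the others, division by `a` gives the block number 0, 1 or
2 and the position in the block. Positions beyond the last variable are filled with `false`. -/
theorem exists_joined {n a b : ℕ} (hn : n ≤ 2 * a + b) (hb : b ≤ a) (x : Fin n → Bool) :
    ∃ α < 2 ^ a, ∃ β < 2 ^ a, ∃ γ < 2 ^ b, joined n a α β γ = x := by
  let g : ℕ → Bool := fun v => if h : v < n then x ⟨v, h⟩ else false
  obtain ⟨α, hα, hα'⟩ := exists_testBit a g
  obtain ⟨β, hβ, hβ'⟩ := exists_testBit a fun j => g (a + j)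
  obtain ⟨γ, hγ, hγ'⟩ := exists_testBit b fun j => g (2 * a + j)
  refine ⟨α, hα, β, hβ, γ, hγ, funext fun ⟨v, hv⟩ => ?_⟩
  have ha : 0 < a := by omega
  have hg : g v = x ⟨v, hv⟩ := by simp [g, hv]
  have hm := Nat.mod_lt v ha
  have hd := Nat.div_add_mod v a
  rw [← hg, joined]
  simp only
  split_ifs with h0 h1
  · rw [hα' _ hm]; congr 1; rw [h0] at hd; omega
  · rw [hβ' _ hm]; congr 1; rw [h1] at hd; omega
  · have h3 : v / a < 3 := Nat.div_lt_of_lt_mul (by omega)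
    have h4 : v / a = 2 := by
      generalize v / a = q at h0 h1 h3
      omega
    rw [h4] at hd
    rw [hγ' _ (by omega)]; congr 1; omega

theorem litTrue_row {n a z r : ℕ} (hz : z < 2 ^ a) (l : Fin n × Bool) :
    litTrue a (r * 2 ^ a + z) (litCode l) =
      if l.1.val / a = r ∧ z.testBit (l.1.val % a) = l.2 then 1 else 0 := by
  have h1 : litCode l / 2 = l.1.val := by
    unfold litCode; cases l.2 <;> simp; omega
  have h2 : litCode l % 2 = l.2.toNat := by
    unfold litCode; cases l.2 <;> simp
  rw [litTrue, h1, h2, Nat.digits_div hz, Nat.digits_mod hz]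
  refine if_congr (and_congr_right' ?_) rfl rfl
  rw [Nat.testBit_eq_decide_div_mod_eq]
  have := Nat.mod_lt (z / 2 ^ (l.1.val % a)) (show 2 > 0 by norm_num)
  cases l.2 <;> simp

/-- Every variable lies in exactly one block, so a clause is falsified exactly if none of the three
partial assignments makes one of its literals true. The indicator therefore factors, and a path
through the graph can test one block at a time. -/
theorem unsat_product {F : CNFFormula} {a α β γ i : ℕ} (hn : F.n ≤ 3 * a) (hα : α < 2 ^ a)
    (hβ : β < 2 ^ a) (hγ : γ < 2 ^ a) (hi : i < F.clauses.length) :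
    unsatTable F.codes a α i * unsatTable F.codes a (2 * 2 ^ a + γ) i *
      unsatTable F.codes a (2 ^ a + β) i =
    if satClause (joined F.n a α β γ) F.clauses[i] then 0 else 1 := by
  have hi' : i < F.codes.length := by rwa [codes_length]
  have hget : F.codes.getD i [] = F.clauses[i].map litCode := by
    simp [codes, List.getD, hi]
  have key : ∀ r z, z < 2 ^ a → (unsatTable F.codes a (r * 2 ^ a + z) i = 1 ↔
      ∀ l ∈ F.clauses[i], ¬ (l.1.val / a = r ∧ z.testBit (l.1.val % a) = l.2)) := by
    intro r z hz
    rw [unsatTable_eq_one_iff hi', hget]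
    simp only [List.mem_map, forall_exists_index, and_imp, forall_apply_eq_imp_iff₂,
      litTrue_row hz, ite_eq_right_iff, one_ne_zero, imp_false]
  have k0 := key 0 α hα
  have k1 := key 1 β hβ
  have k2 := key 2 γ hγ
  rw [zero_mul, zero_add] at k0
  rw [one_mul] at k1
  have u0 := unsatTable_le F.codes a α i
  have u1 := unsatTable_le F.codes a (2 ^ a + β) i
  have u2 := unsatTable_le F.codes a (2 * 2 ^ a + γ) i
  have hsat : satClause (joined F.n a α β γ) F.clauses[i] = true ↔
      ∃ l ∈ F.clauses[i], (l.1.val / a = 0 ∧ α.testBit (l.1.val % a) = l.2) ∨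
        (l.1.val / a = 1 ∧ β.testBit (l.1.val % a) = l.2) ∨
        (l.1.val / a = 2 ∧ γ.testBit (l.1.val % a) = l.2) := by
    rw [satClause, List.any_eq_true]
    refine exists_congr fun l => and_congr_right fun _ => ?_
    have hl := l.1.2
    have ha : 0 < a := by omega
    have h3 : l.1.val / a < 3 := Nat.div_lt_of_lt_mul (by omega)
    rw [beq_iff_eq, joined]
    split_ifs with h0 h1
    · simp [h0]
    · simp [h1]
    · have h2 : l.1.val / a = 2 := by
        generalize l.1.val / a = q at h0 h1 h3
        omega
      simp [h2]
  split_ifs with hs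
  · obtain ⟨l, hl, h | h | h⟩ := hsat.1 hs
    · have : unsatTable F.codes a α i = 0 := by
        have := mt k0.1 (fun hh => hh l hl h); omega
      rw [this, zero_mul, zero_mul]
    · have : unsatTable F.codes a (2 ^ a + β) i = 0 := by
        have := mt k1.1 (fun hh => hh l hl h); omega
      rw [this, mul_zero]
    · have : unsatTable F.codes a (2 * 2 ^ a + γ) i = 0 := by
        have := mt k2.1 (fun hh => hh l hl h); omega
      rw [this, mul_zero, zero_mul]
  · rw [hsat] at hs
    push Not at hs
    rw [k0.2 fun l hl h => absurd h.2 ((hs l hl).1 h.1),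
      k1.2 fun l hl h => absurd h.2 ((hs l hl).2.1 h.1),
      k2.2 fun l hl h => absurd h.2 ((hs l hl).2.2 h.1)]

/-- The number of clauses that an assignment does not satisfy. -/
def numUnsat (F : CNFFormula) (x : Fin F.n → Bool) : ℕ :=
  F.clauses.countP fun c => !satClause x c

theorem numSat_add_numUnsat (F : CNFFormula) (x : Fin F.n → Bool) :
    F.numSat x + F.numUnsat x = F.m := by
  unfold numSat numUnsat m
  rw [List.length_eq_countP_add_countP (satClause x)]
  simp

theorem sum_getElem_eq_countP {α : Type} (L : List α) (p : α → Bool) (g : ℕ → ℕ)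
    (hg : ∀ i (hi : i < L.length), g i = if p L[i] then 0 else 1) :
    ∑ i ∈ Finset.range L.length, g i = L.countP fun c => !p c := by
  induction L generalizing g with
  | nil => simp
  | cons c L ih =>
    rw [List.length_cons, Finset.sum_range_succ', ih (fun i => g (i + 1))
      (fun i hi => hg (i + 1) (Nat.succ_lt_succ hi)), List.countP_cons,
      hg 0 (by simp)]
    cases h : p c <;> simp [h]

/-- Slot number `m` is a dummy that always counts as satisfied. It compensates for the slack `p + 1`
in place of `p`: with `s = m + 1` the flow test reads `unsat + p < m`, which can detect every number
of unsatisfied clauses below `m`. -/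
theorem unsat_eq_numUnsat {F : CNFFormula} {R : RedParams} {a α β γ : ℕ} (hA : R.A = 2 ^ a)
    (hs : R.s = F.m + 1) (hu : R.u = unsatTable F.codes a) (hn : F.n ≤ 3 * a) (hα : α < 2 ^ a)
    (hβ : β < 2 ^ a) (hγ : γ < 2 ^ a) :
    R.unsat α β γ = F.numUnsat (joined F.n a α β γ) := by
  rw [RedParams.unsat, hs, Finset.sum_range_succ]
  have h1 : ∀ i < R.s, R.full α β (γ * R.s + i) =
      unsatTable F.codes a α i * unsatTable F.codes a (2 * 2 ^ a + γ) i *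
      unsatTable F.codes a (2 ^ a + β) i := fun i hi => by
    rw [RedParams.full, RedParams.bit, Nat.digits_mod hi, Nat.digits_div hi, hu, hA]
  rw [← hs, h1 F.m (by omega), unsatTable, if_neg (by rw [codes_length]; omega), zero_mul, zero_mul,
    add_zero]
  refine sum_getElem_eq_countP F.clauses _ _ fun i hi => ?_
  have hi' : i < F.m := hi
  rw [h1 i (by omega), unsat_product hn hα hβ hγ hi]

/-- The minimum number of unsatisfied clauses. -/
noncomputable def minUnsat (F : CNFFormula) : ℕ := sInf (Set.range F.numUnsat)

theorem exists_numUnsat_eq (F : CNFFormula) : ∃ x, F.numUnsat x = F.minUnsat :=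
  Nat.sInf_mem (Set.range_nonempty F.numUnsat)

theorem minUnsat_le (F : CNFFormula) (x : Fin F.n → Bool) : F.minUnsat ≤ F.numUnsat x :=
  Nat.sInf_le ⟨x, rfl⟩

theorem minUnsat_le_m (F : CNFFormula) : F.minUnsat ≤ F.m := by
  obtain ⟨x, hx⟩ := F.exists_numUnsat_eq
  have := F.numSat_add_numUnsat x
  omega

theorem maxSatOutput_iff (F : CNFFormula) {out : ℕ → ℕ} (h : out 0 = F.m - F.minUnsat) :
    F.MaxSatOutput out := by
  rw [MaxSatOutput, h]
  constructor
  · obtain ⟨x, hx⟩ := F.exists_numUnsat_eq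
    exact ⟨x, by have := F.numSat_add_numUnsat x; omega⟩
  · rintro _ ⟨x, rfl⟩
    have := F.numSat_add_numUnsat x
    have := F.minUnsat_le x
    omega

/-- Satisfiability means that the optimum is zero, and the truncated difference is the indicator of
this. -/
theorem satOutput_iff (F : CNFFormula) {out : ℕ → ℕ} (h : out 0 = 1 - F.minUnsat) :
    F.SatOutput out := by
  have h0 : F.Satisfiable ↔ F.minUnsat = 0 := by
    have hx : ∀ x, (∀ c ∈ F.clauses, satClause x c = true) ↔ F.numUnsat x = 0 := fun x => by
      simp [numUnsat, List.countP_eq_zero]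
    constructor
    · rintro ⟨x, h⟩
      have := F.minUnsat_le x
      have := (hx x).1 h
      omega
    · intro h
      obtain ⟨x, hx'⟩ := F.exists_numUnsat_eq
      exact ⟨x, (hx x).2 (hx'.trans h)⟩
  rw [SatOutput, h0, h]
  omega

/-- Distinctness of the literals in a clause enters here; it keeps the time for the table polynomial
in the numbers of variables and clauses. -/
theorem clause_length_le (F : CNFFormula) {c : List ℕ} (hc : c ∈ F.codes) :
    c.length ≤ 2 * F.n := by
  obtain ⟨d, hd, rfl⟩ := List.mem_map.1 hc
  have := (F.nodup d hd).length_le_card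
  simp only [Fintype.card_prod, Fintype.card_fin, Fintype.card_bool] at this
  rw [List.length_map]; omega

theorem lit_lt (F : CNFFormula) {c : List ℕ} (hc : c ∈ F.codes) {l : ℕ} (hl : l ∈ c) :
    l < 2 * F.n := by
  obtain ⟨d, hd, rfl⟩ := List.mem_map.1 hc
  obtain ⟨l, hl, rfl⟩ := List.mem_map.1 hl
  have := l.1.2
  have := Bool.toNat_le l.2
  unfold litCode; omega

end CNFFormula

namespace WordRAM

/-! ### The table of unsatisfied clauses -/

notation "rn" => (0 : ℕ)
notation "rm" => (1 : ℕ)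
notation "rs" => (2 : ℕ)
notation "ra" => (9 : ℕ)
notation "rA" => (14 : ℕ)
notation "ri" => (21 : ℕ)
notation "rci" => (22 : ℕ)
notation "rj" => (23 : ℕ)
notation "rcj" => (24 : ℕ)
notation "rq" => (25 : ℕ)
notation "rlen" => (26 : ℕ)
notation "racc" => (27 : ℕ)

/-- Indicator of equality. -/
def Expr.eqE (x y : Expr) : Expr := .lit 1 - ((x - y) + (y - x))

theorem Expr.eval_eqE (s : State) (x y : Expr) :
    (eqE x y).eval s = if x.eval s = y.eval s then 1 else 0 := by
  simp only [eqE, eval_sub, eval_add, eval_lit]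
  split_ifs <;> omega

theorem Expr.bd_eqE {s : State} {V : ℕ} (x y : Expr) :
    (eqE x y).Bd V s ↔ 1 < V ∧ x.Bd V s ∧ y.Bd V s := by
  simp only [eqE, bd_sub, bd_add, bd_lit]; tauto

/-- Truth value of the literal in cell `rq` of the input under the partial assignment `rk`. -/
def litExpr : Expr :=
  .eqE (.load 0 (.var rq) / .lit 2 / .var ra) (.var rk / .var rA) *
    .eqE (.var rk % .var rA / .load 2 (.load 0 (.var rq) / .lit 2 % .var ra) % .lit 2)
      (.load 0 (.var rq) % .lit 2)

/-- Number of true literals of a clause. -/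
def litLoop : Prog := forLoop rj rcj (.var rlen)
  (.seq (assign racc (.var racc + litExpr)) (assign rq (.var rq + .lit 1)))

theorem Runs.litLoop {v n a row q : ℕ} {c : List ℕ} {s : State} (hv : 1 ≤ v)
    (hrq : s.reg rq = q) (hracc : s.reg racc = 0) (hrlen : s.reg rlen = c.length)
    (hra : s.reg ra = a) (hrA : s.reg rA = 2 ^ a) (hrow : s.reg rk = row)
    (hc : ∀ j < c.length, s.mem 0 (q + j) = c.getD j 0)
    (hpow : ∀ i < n, s.mem 2 i = 2 ^ i) (hclen : c.length ≤ 2 * n) (hlit : ∀ l ∈ c, l < 2 * n)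
    (hq : q + c.length + 1 < 2 ^ v) (hn : 2 * n + 2 < 2 ^ v) (hnv : 2 ^ n ≤ 2 ^ v) (ha : a < 2 ^ v)
    (hav : 2 ^ a < 2 ^ v) (hrv : row < 2 ^ v) :
    Runs v litLoop s (fun s' => Frame [rj, rcj, racc, rq] [] s s' ∧ s'.reg rq = q + c.length ∧
      s'.reg racc = (c.map (litTrue a row)).sum) (2 * n * 80 + 5) := by
  have h1v : 1 < 2 ^ v := Nat.one_lt_two_pow (by omega)
  refine (Runs.forLoop (v := v) (N := c.length) (T := 70) (fun k s' =>
    Frame [rj, rcj, racc, rq] [] s s' ∧ s'.reg rq = q + k ∧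
      s'.reg racc = ((c.take k).map (litTrue a row)).sum)
    (by norm_num) (by norm_num) (by norm_num) hv rfl (by rw [Expr.bd_var]; omega)
    (by rw [Expr.eval_var, hrlen]) (by omega) ?_ ?_ ?_ ?_).le ?_
  · rintro k s' x y ⟨h1, h2, h3⟩
    refine ⟨(h1.setReg (by simp) _).setReg (by simp) _, ?_, ?_⟩
    · simpa [State.reg_setReg] using h2
    · simpa [State.reg_setReg] using h3
  · exact ⟨.refl _ _ _, by simpa using hrq, by simpa using hracc⟩
  · rintro k hk s' ⟨h1, h2, h3⟩ hsk
    set l := c.getD k 0 with hl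
    have hlm : l ∈ c := by rw [hl, List.getD_eq_getElem _ _ hk]; exact List.getElem_mem hk
    have hl2 := hlit l hlm
    have e0 : s'.mem 0 (q + k) = l := by rw [h1.mem 0 (by simp), hc k hk]
    have e1 : s'.reg ra = a := (h1.reg _ (by simp)).trans hra
    have e2 : s'.reg rA = 2 ^ a := (h1.reg _ (by simp)).trans hrA
    have e3 : s'.reg rk = row := (h1.reg _ (by simp)).trans hrow
    have hva : l / 2 % a < n := (Nat.mod_le _ _).trans_lt (by omega)
    have e4 : s'.mem 2 (l / 2 % a) = 2 ^ (l / 2 % a) := by rw [h1.mem 2 (by simp), hpow _ hva]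
    have e5 : 2 ^ (l / 2 % a) < 2 ^ v :=
      (Nat.pow_lt_pow_right (by norm_num) hva).trans_le hnv
    have hacc : ((c.take k).map (litTrue a row)).sum ≤ k := by
      refine (List.sum_le_card_nsmul _ 1 fun x hx => ?_).trans (by simp)
      obtain ⟨y, -, rfl⟩ := List.mem_map.1 hx
      unfold litTrue; split_ifs <;> omega
    refine Runs.le (Runs.assign_seq (T := 4)
      (x := ((c.take (k + 1)).map (litTrue a row)).sum) rfl hv ?_ ?_ ?_)
      (show litExpr.size + 7 ≤ 70 by decide)
    · simp only [litExpr, Expr.bd_add, Expr.bd_mul, Expr.bd_eqE, Expr.bd_div, Expr.bd_mod,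
        Expr.bd_load, Expr.bd_var, Expr.bd_lit, Expr.eval_load, Expr.eval_var, Expr.eval_div,
        Expr.eval_mod, Expr.eval_lit, h2, h3, e0, e1, e2, e3, e4]
      refine ⟨by omega, ⟨h1v, ⟨⟨⟨?_, ?_⟩, ?_⟩, ?_⟩, ?_, ?_⟩, h1v, ⟨⟨⟨?_, ?_⟩, ⟨⟨⟨?_, ?_⟩, ?_⟩, ?_⟩, ?_⟩,
        ?_⟩, ⟨?_, ?_⟩, ?_⟩ <;> omega
    · simp only [litExpr, Expr.eval_add, Expr.eval_mul, Expr.eval_eqE, Expr.eval_load,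
        Expr.eval_var, Expr.eval_div, Expr.eval_mod, Expr.eval_lit, h2, h3, e0, e1, e2, e3, e4]
      rw [List.take_succ_eq_append_getElem hk, List.map_append, List.sum_append,
        ← List.getD_eq_getElem c 0 hk, ← hl]
      simp only [List.map_cons, List.map_nil, List.sum_cons, List.sum_nil, litTrue, add_zero,
        ite_and, mul_ite, mul_one, mul_zero]
      split_ifs <;> rfl
    · refine Runs.assign' (x := q + (k + 1)) rfl hv ?_ ?_ ⟨?_, ?_, ?_, ?_, ?_⟩
      · simp only [Expr.bd_add, Expr.bd_var, Expr.bd_lit, State.reg_setReg]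
        norm_num [h2]; omega
      · simp [State.reg_setReg, h2, add_assoc]
      · simpa [State.reg_setReg] using hsk
      · simp [State.reg_setReg]
      · exact (h1.setReg (by simp) _).setReg (by simp) _
      · simp [State.reg_setReg]
      · simp [State.reg_setReg]
  · rintro s' ⟨h1, h2, h3⟩
    exact ⟨h1, h2, by rw [h3, List.take_length]⟩
  · have : (Expr.var rlen).size = 1 := rfl
    rw [this]
    have := Nat.mul_le_mul_right (70 + 9) hclen
    omega

/-- The encoding of the clauses. -/
def clauseWords (cs : List (List ℕ)) : List ℕ := cs.flatMap fun c => c.length :: c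

/-- The encoding is self-delimiting: the word at the total length of the earlier clauses is the
length of the next one. This drives a single read pointer through the input. -/
theorem clauseWords_getD {cs : List (List ℕ)} {i : ℕ} (hi : i < cs.length) :
    (clauseWords cs).getD (clauseWords (cs.take i)).length 0 = (cs.getD i []).length ∧
    (∀ j < (cs.getD i []).length, (clauseWords cs).getD
      ((clauseWords (cs.take i)).length + 1 + j) 0 = (cs.getD i []).getD j 0) ∧
    (clauseWords (cs.take (i + 1))).length =
      (clauseWords (cs.take i)).length + 1 + (cs.getD i []).length := by
  have hg : cs.getD i [] = cs[i] := List.getD_eq_getElem _ _ hi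
  have h1 : clauseWords cs = clauseWords (cs.take i) ++ ((cs[i].length :: cs[i]) ++
      clauseWords (cs.drop (i + 1))) := by
    have hsplit : cs.take i ++ (cs[i] :: cs.drop (i + 1)) = cs := by
      rw [List.cons_getElem_drop_succ, List.take_append_drop]
    conv_lhs => rw [← hsplit, clauseWords, List.flatMap_append, List.flatMap_cons]
    rfl
  rw [hg]
  refine ⟨?_, fun j hj => ?_, ?_⟩
  · rw [h1, List.getD_append_right _ _ _ _ le_rfl]
    simp
  · rw [h1, List.getD_append_right _ _ _ _ (by omega), List.getD_append _ _ _ _ (by simp; omega)]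
    rw [show (clauseWords (cs.take i)).length + 1 + j - (clauseWords (cs.take i)).length = j + 1
      by omega]
    rfl
  · rw [List.take_succ_eq_append_getElem hi, clauseWords, List.flatMap_append, List.length_append]
    simp only [List.flatMap_cons, List.flatMap_nil, List.append_nil, List.length_cons, clauseWords]
    omega

/-- Fill the row `rk` of the table in array `3`. -/
def rowProg : Prog :=
  .seq (assign rq (.lit 2)) (.seq (forLoop ri rci (.var rm)
    (.seq (assign rlen (.load 0 (.var rq))) (.seq (assign rq (.var rq + .lit 1))
      (.seq (assign racc (.lit 0)) (.seq litLoop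
        (put 3 (.var rk * .var rs + .var ri) (.lit 1 - .var racc)))))))
    (put 3 (.var rk * .var rs + .var rm) (.lit 0)))

/-- The input of the program is in place. -/
structure InputAt (v n : ℕ) (cs : List (List ℕ)) (s : State) : Prop where
  rn_eq : s.reg rn = n
  rm_eq : s.reg rm = cs.length
  rs_eq : s.reg rs = cs.length + 1
  mem0 : ∀ i, s.mem 0 i = (n :: cs.length :: clauseWords cs).getD i 0
  pow : ∀ i ≤ n, s.mem 2 i = 2 ^ i

/-- Bounds for the input. -/
structure InputBd (v n : ℕ) (cs : List (List ℕ)) : Prop where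
  v_pos : 1 ≤ v
  len : ∀ c ∈ cs, c.length ≤ 2 * n
  lit : ∀ c ∈ cs, ∀ l ∈ c, l < 2 * n
  size : (clauseWords cs).length + 3 < 2 ^ v
  n_lt : 2 * n + 2 < 2 ^ v
  pow_lt : 2 ^ n < 2 ^ v

theorem InputAt.frame {v n : ℕ} {cs : List (List ℕ)} {s s' : State} {R M : List ℕ}
    (h : InputAt v n cs s) (hf : Frame R M s s')
    (hR : rn ∉ R ∧ rm ∉ R ∧ rs ∉ R) (hM : 0 ∉ M ∧ 2 ∉ M) : InputAt v n cs s' :=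
  ⟨(hf.reg _ hR.1).trans h.rn_eq, (hf.reg _ hR.2.1).trans h.rm_eq, (hf.reg _ hR.2.2).trans h.rs_eq,
    fun i => by rw [hf.mem _ hM.1, h.mem0], fun i hi => by rw [hf.mem _ hM.2, h.pow i hi]⟩

theorem InputBd.clauseWords_take_le {v n : ℕ} {cs : List (List ℕ)} (h : InputBd v n cs) (i : ℕ) :
    (clauseWords (cs.take i)).length + 3 < 2 ^ v := by
  refine lt_of_le_of_lt ?_ h.size
  have : clauseWords cs = clauseWords (cs.take i) ++ clauseWords (cs.drop i) := by
    rw [clauseWords, clauseWords, clauseWords, ← List.flatMap_append, List.take_append_drop]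
  rw [this, List.length_append]; omega

/-- Before clause `k` the pointer `rq` is `2` plus the number of words of the earlier clauses, the
`2` for the words `n` and `m`. True literals are counted, and the truncated `1 - racc` makes the
indicator. The final write fills the dummy slot. Cells outside the row are preserved, so earlier
rows survive. -/
theorem Runs.rowProg {v n a row : ℕ} {cs : List (List ℕ)} {s : State} (hI : InputAt v n cs s)
    (hb : InputBd v n cs) (hra : s.reg ra = a) (hrA : s.reg rA = 2 ^ a) (hrow : s.reg rk = row)
    (ha : a < 2 ^ v) (hav : 2 ^ a < 2 ^ v) (hrv : row < 2 ^ v)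
    (hm : cs.length + 1 < 2 ^ v) :
    Runs v rowProg s (fun s' => Frame [ri, rci, rlen, rj, rcj, racc, rq] [3] s s' ∧
      (∀ i < cs.length + 1, s'.mem 3 (row * (cs.length + 1) + i) = unsatTable cs a row i) ∧
      ∀ x, (∀ i < cs.length + 1, x ≠ row * (cs.length + 1) + i) → s'.mem 3 x = s.mem 3 x)
      (cs.length * (2 * n * 80 + 50) + 30) := by
  have hv := hb.v_pos
  have h1v : 1 < 2 ^ v := Nat.one_lt_two_pow (by omega)
  set m := cs.length with hmdef
  refine Runs.le (T := 2 + (1 + (m * ((2 + 1 + (3 + 1 + (1 + 1 + (2 * n * 80 + 5 + (5 + (3 + 1))))))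
    + 9) + 4) + (5 + (1 + 1)))) ?_ (by ring_nf; omega)
  refine Runs.assign_seq (x := 2) rfl hv
    (by rw [Expr.bd_lit]; have := hb.n_lt; have := hb.size; omega) rfl ?_
  have hF₀ : Frame [ri, rci, rlen, rj, rcj, racc, rq] [3] s (s.setReg rq 2) :=
    (Frame.refl _ _ _).setReg (by simp) _
  refine (Runs.forLoop (v := v) (N := m) (fun k s' =>
    Frame [ri, rci, rlen, rj, rcj, racc, rq] [3] s s' ∧
    s'.reg rq = 2 + (clauseWords (cs.take k)).length ∧
    (∀ i < k, s'.mem 3 (row * (m + 1) + i) = unsatTable cs a row i) ∧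
    ∀ x, (∀ i < m + 1, x ≠ row * (m + 1) + i) → s'.mem 3 x = s.mem 3 x)
    (by norm_num) (by norm_num) (by norm_num) hv rfl ?_ ?_ (by omega) ?_ ?_ ?_
    (fun _ h => h)).seq ?_
  · rw [Expr.bd_var, hF₀.reg _ (by simp), hI.rm_eq]; omega
  · rw [Expr.eval_var, hF₀.reg _ (by simp), hI.rm_eq]
  · rintro k s' x y ⟨h1, h2, h3, h4⟩
    refine ⟨(h1.setReg (by simp) _).setReg (by simp) _, ?_, h3, h4⟩
    simpa [State.reg_setReg] using h2
  · refine ⟨hF₀, by simp [State.reg_setReg, clauseWords], fun i hi => absurd hi (by omega),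
      fun _ _ => rfl⟩
  · rintro k hk s' ⟨h1, h2, h3, h4⟩ hsk
    obtain ⟨w1, w2, w3⟩ := clauseWords_getD hk
    set c := cs.getD k [] with hc
    set q := (clauseWords (cs.take k)).length with hq
    have hcm : c ∈ cs := by rw [hc, List.getD_eq_getElem _ _ hk]; exact List.getElem_mem hk
    have hcl := hb.len c hcm
    have hqv := hb.clauseWords_take_le (k + 1)
    have hn := hb.n_lt
    have hI' : InputAt v n cs s' := hI.frame h1 (by simp) (by simp)
    have e0 : s'.mem 0 (2 + q) = c.length := by
      rw [hI'.mem0, show 2 + q = q + 1 + 1 by ring, List.getD_cons_succ, List.getD_cons_succ, w1]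
    refine Runs.assign_seq (x := c.length) rfl hv ?_ ?_ ?_
    · simp only [Expr.bd_load, Expr.bd_var, Expr.eval_var, h2, e0]; omega
    · simp only [Expr.eval_load, Expr.eval_var, h2, e0]
    refine Runs.assign_seq (x := 2 + q + 1) rfl hv ?_ ?_ ?_
    · simp [State.reg_setReg, h2]; omega
    · simp [State.reg_setReg, h2]
    refine Runs.assign_seq (x := 0) rfl hv (by rw [Expr.bd_lit]; omega) rfl ?_
    set s₁ := ((s'.setReg rlen c.length).setReg rq (2 + q + 1)).setReg racc 0 with hs₁
    have hF₁ : Frame [ri, rci, rlen, rj, rcj, racc, rq] [3] s s₁ :=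
      ((h1.setReg (by simp) _).setReg (by simp) _).setReg (by simp) _
    have hI₁ : InputAt v n cs s₁ := hI.frame hF₁ (by simp) (by simp)
    refine (Runs.litLoop (n := n) (a := a) (row := row) (q := 2 + q + 1) (c := c) hv
      (by simp [hs₁, State.reg_setReg]) (by simp [hs₁, State.reg_setReg])
      (by simp [hs₁, State.reg_setReg]) ((hF₁.reg _ (by simp)).trans hra)
      ((hF₁.reg _ (by simp)).trans hrA) ((hF₁.reg _ (by simp)).trans hrow) (fun j hj => ?_)
      (fun i hi => hI₁.pow i hi.le) hcl (hb.lit c hcm) (by omega) hn hb.pow_lt.le ha hav hrv).seq ?_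
    · rw [hI₁.mem0, show 2 + q + 1 + j = q + 1 + j + 1 + 1 by ring, List.getD_cons_succ,
        List.getD_cons_succ, w2 j hj]
    rintro s₂ ⟨g1, g2, g3⟩
    have hF₂ : Frame [ri, rci, rlen, rj, rcj, racc, rq] [3] s s₂ :=
      hF₁.trans (g1.mono (by simp) (by simp))
    have hI₂ : InputAt v n cs s₂ := hI.frame hF₂ (by simp) (by simp)
    have hri : s₂.reg ri = k := by
      rw [g1.reg _ (by simp), hs₁]; simpa [State.reg_setReg] using hsk
    have hrci : s₂.reg rci = s'.reg rci := by
      rw [g1.reg _ (by simp), hs₁]; simp [State.reg_setReg]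
    have hrk : s₂.reg rk = row := (hF₂.reg _ (by simp)).trans hrow
    have haccle : (c.map (litTrue a row)).sum ≤ c.length := by
      refine (List.sum_le_card_nsmul _ 1 fun x hx => ?_).trans (by simp)
      obtain ⟨y, -, rfl⟩ := List.mem_map.1 hx
      unfold litTrue; split_ifs <;> omega
    have hm3 : s₂.mem 3 = s'.mem 3 := g1.mem _ (by simp)
    refine Runs.put' (j := row * (m + 1) + k) (x := unsatTable cs a row k) rfl rfl hv ?_ ?_ ?_ ?_
      ⟨hri, hrci, hF₂.setMem (by simp) _ _, ?_, fun i hi => ?_, fun x hx => ?_⟩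
    · simp only [Expr.bd_add, Expr.bd_mul, Expr.bd_var, hrk, hri, hI₂.rs_eq]; omega
    · simp only [Expr.bd_sub, Expr.bd_var, Expr.bd_lit, g3]; omega
    · simp only [Expr.eval_add, Expr.eval_mul, Expr.eval_var, hrk, hri, hI₂.rs_eq, hmdef]
    · simp only [Expr.eval_sub, Expr.eval_var, Expr.eval_lit, g3]
      rw [unsatTable, if_pos hk]
    · change s₂.reg rq = _
      rw [g2, w3]; ring
    · rw [State.mem_setMem, hm3]
      split_ifs with hh
      · have : i = k := by omega
        rw [this]
      · exact h3 i (by omega)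
    · rw [State.mem_setMem, hm3, if_neg (by have := hx k (by omega); tauto)]
      exact h4 x hx
  · rintro s' ⟨h1, h2, h3, h4⟩
    have hI' : InputAt v n cs s' := hI.frame h1 (by simp) (by simp)
    have hrk : s'.reg rk = row := (h1.reg _ (by simp)).trans hrow
    refine Runs.put' (j := row * (m + 1) + m) (x := 0) rfl rfl hv ?_ ?_ ?_ rfl
      ⟨h1.setMem (by simp) _ _, fun i hi => ?_, fun x hx => ?_⟩
    · simp only [Expr.bd_add, Expr.bd_mul, Expr.bd_var, hrk, hI'.rm_eq, hI'.rs_eq]; omega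
    · rw [Expr.bd_lit]; omega
    · simp only [Expr.eval_add, Expr.eval_mul, Expr.eval_var, hrk, hI'.rm_eq, hI'.rs_eq, hmdef]
    · rw [State.mem_setMem]
      split_ifs with hh
      · rw [unsatTable, if_neg (by omega)]
      · exact h3 i (by omega)
    · rw [State.mem_setMem, if_neg (by have := hx m (by omega); tauto)]
      exact h4 x hx

/-- Fill the table in array `3`. -/
def tableProg : Prog := forLoop rk rck (.lit 3 * .var rA) rowProg

/-- The table is in place. -/
def TableAt (cs : List (List ℕ)) (a : ℕ) (s : State) : Prop :=
  ∀ row < 3 * 2 ^ a, ∀ i < cs.length + 1,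
    s.mem 3 (row * (cs.length + 1) + i) = unsatTable cs a row i

theorem Runs.tableProg {v n a : ℕ} {cs : List (List ℕ)} {s : State} (hI : InputAt v n cs s)
    (hb : InputBd v n cs) (hra : s.reg ra = a) (hrA : s.reg rA = 2 ^ a)
    (ha : a < 2 ^ v) (hav : 3 * 2 ^ a < 2 ^ v) (hm : cs.length + 1 < 2 ^ v) :
    Runs v tableProg s (fun s' => Frame [rk, rck, ri, rci, rlen, rj, rcj, racc, rq] [3] s s' ∧
      TableAt cs a s')
      (3 * 2 ^ a * (cs.length * (2 * n * 80 + 50) + 40) + 10) := by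
  have hv := hb.v_pos
  refine (Runs.forLoop (v := v) (N := 3 * 2 ^ a) (T := cs.length * (2 * n * 80 + 50) + 30)
    (fun k s' => Frame [rk, rck, ri, rci, rlen, rj, rcj, racc, rq] [3] s s' ∧
      ∀ row < k, ∀ i < cs.length + 1,
        s'.mem 3 (row * (cs.length + 1) + i) = unsatTable cs a row i)
    (by norm_num) (by norm_num) (by norm_num) hv rfl ?_ ?_ hav ?_ ?_ ?_ (fun _ h => h)).le ?_
  · have : 1 ≤ 2 ^ a := Nat.one_le_two_pow
    simp only [Expr.bd_mul, Expr.bd_lit, Expr.bd_var, hrA]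
    refine ⟨lt_of_le_of_lt ?_ hav, ?_⟩ <;> omega
  · simp only [Expr.eval_mul, Expr.eval_lit, Expr.eval_var, hrA]
  · rintro k s' x y ⟨h1, h2⟩
    exact ⟨(h1.setReg (by simp) _).setReg (by simp) _, h2⟩
  · exact ⟨.refl _ _ _, fun row hr => absurd hr (by omega)⟩
  · rintro k hk s' ⟨h1, h2⟩ hsk
    refine (Runs.rowProg (a := a) (row := k) (hI.frame h1 (by simp) (by simp)) hb
      ((h1.reg _ (by simp)).trans hra) ((h1.reg _ (by simp)).trans hrA) hsk ha (by omega) (by omega)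
      hm).mono ?_ le_rfl
    rintro s'' ⟨g1, g2, g3⟩
    refine ⟨(g1.reg _ (by simp)).trans hsk, g1.reg _ (by simp),
      h1.trans (g1.mono (by simp) (by simp)), fun row hr i hi => ?_⟩
    by_cases hrk : row = k
    · rw [hrk]; exact g2 i hi
    · rw [g3 _ fun i' hi' => ?_]
      · exact h2 row (by omega) i hi
      · intro he
        exact hrk (RedParams.digits_inj' hi hi' he).1
  · have : (Expr.lit 3 * Expr.var rA).size = 3 := rfl
    rw [this]; ring_nf; omega

end WordRAM

namespace WordRAM

/-! ### Writing down the graph of the reduction -/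

notation "rGm" => (15 : ℕ)
notation "rBl" => (16 : ℕ)
notation "rMp" => (17 : ℕ)
notation "rGs" => (33 : ℕ)

/-- The parameters of the reduction are in place. -/
structure ParamsAt (R : RedParams) (off : ℕ) (s : State) : Prop where
  s_eq : s.reg rs = R.s
  A_eq : s.reg rA = R.A
  Gm_eq : s.reg rGm = R.Gm
  Gs_eq : s.reg rGs = R.Gm * R.s
  Bl_eq : s.reg rBl = R.Bl
  Mp_eq : s.reg rMp = R.Mp
  off_eq : s.reg rOff = off
  table : ∀ row < 2 * R.A + R.Gm, ∀ i < R.s, s.mem 3 (row * R.s + i) = R.u row i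

theorem ParamsAt.frame {R : RedParams} {off : ℕ} {s s' : State} {L M : List ℕ}
    (h : ParamsAt R off s) (hf : Frame L M s s') (hL : ∀ r ∈ L, r ∉ [rs, rA, rGm, rGs, rBl, rMp, rOff])
    (hM : 3 ∉ M) : ParamsAt R off s' := by
  have e : ∀ r, r ∈ [rs, rA, rGm, rGs, rBl, rMp, rOff] → s'.reg r = s.reg r :=
    fun r hr => hf.reg r fun hr' => hL r hr' hr
  exact ⟨(e _ (by simp)).trans h.s_eq, (e _ (by simp)).trans h.A_eq, (e _ (by simp)).trans h.Gm_eq,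
    (e _ (by simp)).trans h.Gs_eq, (e _ (by simp)).trans h.Bl_eq, (e _ (by simp)).trans h.Mp_eq,
    (e _ (by simp)).trans h.off_eq, fun row hr i hi => by rw [hf.mem _ hM, h.table row hr i hi]⟩

/-- Entry of the table. -/
def Expr.entry (row i : Expr) : Expr := .load 3 (row * .var rs + i)

theorem ParamsAt.eval_entry {R : RedParams} {off : ℕ} {s : State} (h : ParamsAt R off s)
    {row i : Expr} (hr : row.eval s < 2 * R.A + R.Gm) (hi : i.eval s < R.s) :
    (Expr.entry row i).eval s = R.u (row.eval s) (i.eval s) := by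
  simp only [Expr.entry, Expr.eval_load, Expr.eval_add, Expr.eval_mul, Expr.eval_var, h.s_eq]
  exact h.table _ hr _ hi

theorem ParamsAt.bd_entry {R : RedParams} {off V : ℕ} {s : State} (h : ParamsAt R off s)
    (hR : R.Valid) {row i : Expr} (hr : row.eval s < 2 * R.A + R.Gm) (hi : i.eval s < R.s)
    (hV : 1 < V) (hs : R.s < V) (hrb : row.Bd V s) (hib : i.Bd V s) : (Expr.entry row i).Bd V s := by
  refine ⟨⟨⟨hrb, ?_⟩, hib⟩, ?_⟩
  · rw [Expr.bd_var, h.s_eq]; exact hs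
  · have := h.eval_entry hr hi
    rw [Expr.entry, Expr.eval_load] at this
    rw [this]
    exact (hR.u_le _ _).trans_lt hV

/-- The expressions of the five emitters follow the definitions of the edge lists term by term, with
table lookups in place of `u`; `rGs` holds the product `Gm * s`. -/
def emitOut : Prog := emitLoop (.var rA * .var rGs) (.lit 1) (.var rk / .var rGs)
  (.lit 2 * .var rBl + (.lit 2 * (.var rk % .var rGs) +
    .entry (.var rk / .var rGs) (.var rk % .var rGs % .var rs) *
      .entry (.lit 2 * .var rA + .var rk % .var rGs / .var rs) (.var rk % .var rGs % .var rs)))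

def emitMid : Prog := emitLoop (.var rGs * .lit 2 * .var rs) (.lit 1)
  (.lit 2 * .var rBl + .var rk / .var rs)
  (.lit 3 * .var rBl + (.var rk / .var rs / .lit 2 / .var rs * .var rs + .var rk % .var rs))

def emitDirect : Prog := emitLoop (.var rA * .var rGs * .var rs)
  (.entry (.var rA + .var rk / .var rs / .var rGs) (.var rk / .var rs % .var rGs % .var rs))
  (.lit 2 * .var rBl + (.lit 2 * (.var rk / .var rs % .var rGs) + .lit 1))
  (.var rBl + (.var rk / .var rs / .var rGs * .var rs + .var rk % .var rs))

def emitSlack : Prog := emitLoop (.var rA * .var rGs * .var rs)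
  (.var rk % .var rs + .lit 1 - .var rk / .var rs % .var rGs % .var rs)
  (.lit 3 * .var rBl + .var rk / .var rs % .var rGs)
  (.var rBl + (.var rk / .var rs / .var rGs * .var rs + .var rk % .var rs))

def emitPad : Prog := emitLoop (.var rMp) (.lit 1)
  (.lit 4 * .var rBl + .var rk / (.lit 2 * .var rBl))
  (.lit 6 * .var rBl + .var rk % (.lit 2 * .var rBl))

/-- Number of rounds of all loops that write edges. -/
def _root_.RedParams.slots (R : RedParams) : ℕ := 5 * (R.A * (R.Gm * R.s) * R.s) + R.Mp

/-- Bounds for writing down the graph. -/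
structure BuildBd (R : RedParams) (v off lim : ℕ) : Prop where
  v_pos : 4 ≤ v
  Bl_lim : 8 * R.Bl < lim
  slots_lim : R.slots < lim
  room : off + 2 * R.slots + 10 < 2 ^ v
  s_lt : R.s < 2 ^ v
  A_lt : 2 * R.A < 2 ^ v
  Bl_lt : R.Bl < 2 ^ v

section Emit

variable {R : RedParams} {v off lim : ℕ} {l : List ℕ} {s : State}

theorem BuildBd.consts (hb : BuildBd R v off lim) : 16 ≤ 2 ^ v := by
  simpa using Nat.pow_le_pow_right (n := 2) (by norm_num) hb.v_pos

/-- Bounds for the registers that are used in writing down the graph. -/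
theorem BuildBd.lt (hR : R.Valid) (hb : BuildBd R v off lim) :
    R.Gm * R.s < 2 ^ v ∧ R.A * (R.Gm * R.s) < 2 ^ v ∧ R.Gm * R.s * 2 * R.s < 2 ^ v ∧
    R.A * (R.Gm * R.s) * R.s < 2 ^ v ∧ R.Mp < 2 ^ v ∧
    off + 2 + 2 * (R.A * (R.Gm * R.s) + R.Gm * R.s * 2 * R.s + R.A * (R.Gm * R.s) * R.s +
      R.A * (R.Gm * R.s) * R.s + R.Mp) + 1 < 2 ^ v := by
  have h1 := Nat.le_mul_of_pos_right (R.A * (R.Gm * R.s)) hR.s_pos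
  have h2 := Nat.le_mul_of_pos_left (R.Gm * R.s) hR.A_pos
  have h3 : R.Gm * R.s * 2 * R.s ≤ 2 * (R.A * (R.Gm * R.s) * R.s) := by
    nlinarith [Nat.mul_le_mul_right R.s h2]
  have hr := hb.room
  rw [RedParams.slots] at hr
  generalize R.A * (R.Gm * R.s) * R.s = x at *
  generalize R.Gm * R.s * 2 * R.s = y at *
  generalize R.A * (R.Gm * R.s) = z at *
  generalize R.Gm * R.s = w at *
  omega

theorem ParamsAt.emitFrame (hP : ParamsAt R off s) {s' : State}
    (hf : Frame [rk, rck, rPtr] [16] s s') : ParamsAt R off s' :=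
  hP.frame hf (by decide) (by decide)

theorem BuildBd.of_mem (hR : R.Valid) (hb : BuildBd R v off lim) {e : ℕ × ℕ}
    (he : e ∈ R.allEdges) : e.1 < lim ∧ e.2 < lim := by
  obtain ⟨g1, g2⟩ := hR.lt_of_mem e he
  exact ⟨g1.trans hb.Bl_lim, g2.trans hb.Bl_lim⟩

theorem Runs.emitOut (hR : R.Valid) (hb : BuildBd R v off lim) (hP : ParamsAt R off s)
    (hE : Emitted off lim l s)
    (hl : off + l.length + 2 * (R.A * (R.Gm * R.s)) + 1 < 2 ^ v) :
    Runs v emitOut s (fun s' => Frame [rk, rck, rPtr] [16] s s' ∧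
      Emitted off lim (l ++ words R.outEdges) s') (R.A * (R.Gm * R.s) * 80 + 9) := by
  obtain ⟨b1, b2, b3, b4, b5, -⟩ := hb.lt hR
  have hc := hb.consts
  have h2 := hb.s_lt
  have h3 := hb.A_lt
  have h4 := hb.Bl_lt
  have hs := hR.s_pos
  refine Runs.emitLoop (N := R.A * (R.Gm * R.s)) (by have := hb.v_pos; omega) hE rfl rfl rfl rfl ?_ ?_ b2 hl
    (fun k hk s' hf hsk => ⟨?_, ?_⟩) (fun k hk _ s' hf hsk => ?_) (fun k hk hC => ?_) (by decide) (by decide)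
  · simp only [Expr.bd_mul, Expr.bd_var, hP.A_eq, hP.Gs_eq]; omega
  · simp only [Expr.eval_mul, Expr.eval_var, hP.A_eq, hP.Gs_eq]
  · rw [Expr.bd_lit]; omega
  · simp
  · have hP' := hP.emitFrame hf
    obtain ⟨α, hα, t, ht, rfl⟩ := Nat.lt_mul_iff_exists_digits.1 hk
    have ht2 : t % R.s < R.s := Nat.mod_lt _ hs
    have ht3 : t / R.s < R.Gm := Nat.div_lt_of_lt_mul (by rwa [mul_comm])
    have ed := Nat.digits_div (q := α) ht
    have em := Nat.digits_mod (q := α) ht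
    have e1 : (Expr.var rk / Expr.var rGs).eval s' = α := by
      simp only [Expr.eval_div, Expr.eval_var, hsk, hP'.Gs_eq, ed]
    have e2 : (Expr.var rk % Expr.var rGs % Expr.var rs).eval s' = t % R.s := by
      simp only [Expr.eval_mod, Expr.eval_var, hsk, hP'.Gs_eq, hP'.s_eq, em]
    have e3 : (Expr.lit 2 * Expr.var rA + Expr.var rk % Expr.var rGs / Expr.var rs).eval s' =
        2 * R.A + t / R.s := by
      simp only [Expr.eval_add, Expr.eval_mul, Expr.eval_lit, Expr.eval_mod, Expr.eval_div,
        Expr.eval_var, hsk, hP'.Gs_eq, hP'.s_eq, hP'.A_eq, em]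
    have f1 := hP'.eval_entry (row := .var rk / .var rGs) (i := .var rk % .var rGs % .var rs)
      (by rw [e1]; omega) (by rw [e2]; exact ht2)
    have f2 := hP'.eval_entry (row := .lit 2 * .var rA + .var rk % .var rGs / .var rs)
      (i := .var rk % .var rGs % .var rs) (by rw [e3]; omega) (by rw [e2]; exact ht2)
    rw [e1, e2] at f1
    rw [e3, e2] at f2
    have g1 := hP'.bd_entry hR (V := 2 ^ v) (row := .var rk / .var rGs)
      (i := .var rk % .var rGs % .var rs) (by rw [e1]; omega) (by rw [e2]; exact ht2) (by omega) h2
      (by simp only [Expr.bd_div, Expr.bd_var, hsk, hP'.Gs_eq]; omega)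
      (by simp only [Expr.bd_mod, Expr.bd_var, hsk, hP'.Gs_eq, hP'.s_eq]; omega)
    have g2 := hP'.bd_entry hR (V := 2 ^ v)
      (row := .lit 2 * .var rA + .var rk % .var rGs / .var rs)
      (i := .var rk % .var rGs % .var rs) (by rw [e3]; omega) (by rw [e2]; exact ht2) (by omega) h2
      (by simp only [Expr.bd_add, Expr.bd_mul, Expr.bd_lit, Expr.bd_div, Expr.bd_mod, Expr.bd_var,
            hsk, hP'.Gs_eq, hP'.s_eq, hP'.A_eq]; omega)
      (by simp only [Expr.bd_mod, Expr.bd_var, hsk, hP'.Gs_eq, hP'.s_eq]; omega)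
    refine ⟨⟨?_, ?_⟩, ?_, ?_⟩
    · simp only [Expr.bd_div, Expr.bd_var, hsk, hP'.Gs_eq]; omega
    · simp only [Expr.bd_add, Expr.bd_mul, Expr.bd_lit, Expr.bd_mod, Expr.bd_var, hsk, hP'.Gs_eq,
        hP'.Bl_eq, g1, g2, and_true]; omega
    · rw [e1, ed]
    · simp only [Expr.eval_add, Expr.eval_mul, Expr.eval_lit, Expr.eval_mod, Expr.eval_var, hsk,
        hP'.Gs_eq, hP'.Bl_eq, f1, f2, ed, em, RedParams.bit]
  · exact hb.of_mem hR (List.mem_append_left _ (mem_pairList.2 ⟨k, hk, hC, rfl⟩))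

theorem Runs.emitMid (hR : R.Valid) (hb : BuildBd R v off lim) (hP : ParamsAt R off s)
    (hE : Emitted off lim l s)
    (hl : off + l.length + 2 * (R.Gm * R.s * 2 * R.s) + 1 < 2 ^ v) :
    Runs v emitMid s (fun s' => Frame [rk, rck, rPtr] [16] s s' ∧
      Emitted off lim (l ++ words R.midEdges) s') (R.Gm * R.s * 2 * R.s * 80 + 9) := by
  obtain ⟨b1, b2, b3, b4, b5, -⟩ := hb.lt hR
  have hc := hb.consts
  have h2 := hb.s_lt
  have h4 := hb.Bl_lt
  refine Runs.emitLoop (N := R.Gm * R.s * 2 * R.s) (by have := hb.v_pos; omega) hE rfl rfl rfl rfl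
    ?_ ?_ b3 hl (fun k hk s' hf hsk => ⟨?_, ?_⟩) (fun k hk _ s' hf hsk => ?_)
    (fun k hk hC => ?_) (by decide) (by decide)
  · simp only [Expr.bd_mul, Expr.bd_var, Expr.bd_lit, hP.s_eq, hP.Gs_eq]; omega
  · simp only [Expr.eval_mul, Expr.eval_var, Expr.eval_lit, hP.s_eq, hP.Gs_eq]
  · rw [Expr.bd_lit]; omega
  · simp
  · have hP' := hP.emitFrame hf
    refine ⟨⟨?_, ?_⟩, ?_, ?_⟩
    · simp only [Expr.bd_add, Expr.bd_mul, Expr.bd_lit, Expr.bd_div, Expr.bd_var, hsk, hP'.s_eq,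
        hP'.Bl_eq]; omega
    · simp only [Expr.bd_add, Expr.bd_mul, Expr.bd_lit, Expr.bd_div, Expr.bd_mod, Expr.bd_var, hsk,
        hP'.s_eq, hP'.Bl_eq]; omega
    · simp only [Expr.eval_add, Expr.eval_mul, Expr.eval_lit, Expr.eval_div, Expr.eval_var, hsk,
        hP'.s_eq, hP'.Bl_eq]
    · simp only [Expr.eval_add, Expr.eval_mul, Expr.eval_lit, Expr.eval_div, Expr.eval_mod,
        Expr.eval_var, hsk, hP'.s_eq, hP'.Bl_eq]
  · refine hb.of_mem hR ?_
    simp only [RedParams.allEdges, List.mem_append]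
    exact .inr (.inl (mem_pairList.2 ⟨k, hk, hC, rfl⟩))

theorem Runs.emitDirect (hR : R.Valid) (hb : BuildBd R v off lim) (hP : ParamsAt R off s)
    (hE : Emitted off lim l s)
    (hl : off + l.length + 2 * (R.A * (R.Gm * R.s) * R.s) + 1 < 2 ^ v) :
    Runs v emitDirect s (fun s' => Frame [rk, rck, rPtr] [16] s s' ∧
      Emitted off lim (l ++ words R.directEdges) s') (R.A * (R.Gm * R.s) * R.s * 80 + 9) := by
  obtain ⟨b1, b2, b3, b4, b5, -⟩ := hb.lt hR
  have hc := hb.consts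
  have h2 := hb.s_lt
  have h3 := hb.A_lt
  have h4 := hb.Bl_lt
  have hs := hR.s_pos
  refine Runs.emitLoop (N := R.A * (R.Gm * R.s) * R.s) (by have := hb.v_pos; omega) hE rfl rfl rfl
    rfl ?_ ?_ b4 hl (fun k hk s' hf hsk => ?_) (fun k hk _ s' hf hsk => ?_)
    (fun k hk hC => ?_) (by decide) (by decide)
  · simp only [Expr.bd_mul, Expr.bd_var, hP.s_eq, hP.A_eq, hP.Gs_eq]; omega
  · simp only [Expr.eval_mul, Expr.eval_var, hP.s_eq, hP.A_eq, hP.Gs_eq]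
  · have hP' := hP.emitFrame hf
    have e1 : (Expr.var rA + Expr.var rk / Expr.var rs / Expr.var rGs).eval s' =
        R.A + k / R.s / (R.Gm * R.s) := by
      simp only [Expr.eval_add, Expr.eval_div, Expr.eval_var, hsk, hP'.Gs_eq, hP'.s_eq, hP'.A_eq]
    have e2 : (Expr.var rk / Expr.var rs % Expr.var rGs % Expr.var rs).eval s' =
        k / R.s % (R.Gm * R.s) % R.s := by
      simp only [Expr.eval_mod, Expr.eval_div, Expr.eval_var, hsk, hP'.Gs_eq, hP'.s_eq]
    have h5 : k / R.s / (R.Gm * R.s) < R.A := by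
      refine Nat.div_lt_of_lt_mul (Nat.div_lt_of_lt_mul (hk.trans_eq (by ring)))
    have h6 : k / R.s % (R.Gm * R.s) % R.s < R.s := Nat.mod_lt _ hs
    have f1 := hP'.eval_entry (row := .var rA + .var rk / .var rs / .var rGs)
      (i := .var rk / .var rs % .var rGs % .var rs) (by rw [e1]; omega) (by rw [e2]; exact h6)
    rw [e1, e2] at f1
    refine ⟨hP'.bd_entry hR (by rw [e1]; omega) (by rw [e2]; exact h6) (by omega) h2 ?_ ?_, ?_⟩
    · simp only [Expr.bd_add, Expr.bd_div, Expr.bd_var, hsk, hP'.Gs_eq, hP'.s_eq, hP'.A_eq]; omega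
    · simp only [Expr.bd_mod, Expr.bd_div, Expr.bd_var, hsk, hP'.Gs_eq, hP'.s_eq]; omega
    · rw [f1]
  · have hP' := hP.emitFrame hf
    refine ⟨⟨?_, ?_⟩, ?_, ?_⟩
    · simp only [Expr.bd_add, Expr.bd_mul, Expr.bd_lit, Expr.bd_div, Expr.bd_mod, Expr.bd_var, hsk,
        hP'.s_eq, hP'.Bl_eq, hP'.Gs_eq]; omega
    · simp only [Expr.bd_add, Expr.bd_mul, Expr.bd_div, Expr.bd_mod, Expr.bd_var, hsk,
        hP'.s_eq, hP'.Bl_eq, hP'.Gs_eq]; omega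
    · simp only [Expr.eval_add, Expr.eval_mul, Expr.eval_lit, Expr.eval_div, Expr.eval_mod,
        Expr.eval_var, hsk, hP'.s_eq, hP'.Bl_eq, hP'.Gs_eq]
    · simp only [Expr.eval_add, Expr.eval_mul, Expr.eval_div, Expr.eval_mod,
        Expr.eval_var, hsk, hP'.s_eq, hP'.Bl_eq, hP'.Gs_eq]
  · refine hb.of_mem hR ?_
    simp only [RedParams.allEdges, List.mem_append]
    exact .inr (.inr (.inl (mem_pairList.2 ⟨k, hk, hC, rfl⟩)))

theorem Runs.emitSlack (hR : R.Valid) (hb : BuildBd R v off lim) (hP : ParamsAt R off s)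
    (hE : Emitted off lim l s)
    (hl : off + l.length + 2 * (R.A * (R.Gm * R.s) * R.s) + 1 < 2 ^ v) :
    Runs v emitSlack s (fun s' => Frame [rk, rck, rPtr] [16] s s' ∧
      Emitted off lim (l ++ words R.slackEdges) s') (R.A * (R.Gm * R.s) * R.s * 80 + 9) := by
  obtain ⟨b1, b2, b3, b4, b5, -⟩ := hb.lt hR
  have hc := hb.consts
  have h2 := hb.s_lt
  have h3 := hb.A_lt
  have h4 := hb.Bl_lt
  refine Runs.emitLoop (N := R.A * (R.Gm * R.s) * R.s) (by have := hb.v_pos; omega) hE rfl rfl rfl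
    rfl ?_ ?_ b4 hl (fun k hk s' hf hsk => ?_) (fun k hk _ s' hf hsk => ?_)
    (fun k hk hC => ?_) (by decide) (by decide)
  · simp only [Expr.bd_mul, Expr.bd_var, hP.s_eq, hP.A_eq, hP.Gs_eq]; omega
  · simp only [Expr.eval_mul, Expr.eval_var, hP.s_eq, hP.A_eq, hP.Gs_eq]
  · have hP' := hP.emitFrame hf
    refine ⟨?_, ?_⟩
    · simp only [Expr.bd_add, Expr.bd_sub, Expr.bd_lit, Expr.bd_div, Expr.bd_mod, Expr.bd_var, hsk,
        hP'.s_eq, hP'.Gs_eq]; omega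
    · simp only [Expr.eval_add, Expr.eval_sub, Expr.eval_lit, Expr.eval_div, Expr.eval_mod,
        Expr.eval_var, hsk, hP'.s_eq, hP'.Gs_eq]
  · have hP' := hP.emitFrame hf
    refine ⟨⟨?_, ?_⟩, ?_, ?_⟩
    · simp only [Expr.bd_add, Expr.bd_mul, Expr.bd_lit, Expr.bd_div, Expr.bd_mod, Expr.bd_var, hsk,
        hP'.s_eq, hP'.Bl_eq, hP'.Gs_eq]; omega
    · simp only [Expr.bd_add, Expr.bd_mul, Expr.bd_div, Expr.bd_mod, Expr.bd_var, hsk,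
        hP'.s_eq, hP'.Bl_eq, hP'.Gs_eq]; omega
    · simp only [Expr.eval_add, Expr.eval_mul, Expr.eval_lit, Expr.eval_div, Expr.eval_mod,
        Expr.eval_var, hsk, hP'.s_eq, hP'.Bl_eq, hP'.Gs_eq]
    · simp only [Expr.eval_add, Expr.eval_mul, Expr.eval_div, Expr.eval_mod,
        Expr.eval_var, hsk, hP'.s_eq, hP'.Bl_eq, hP'.Gs_eq]
  · refine hb.of_mem hR ?_
    simp only [RedParams.allEdges, List.mem_append]
    exact .inr (.inr (.inr (.inl (mem_pairList.2 ⟨k, hk, hC, rfl⟩))))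

theorem Runs.emitPad (hR : R.Valid) (hb : BuildBd R v off lim) (hP : ParamsAt R off s)
    (hE : Emitted off lim l s) (hl : off + l.length + 2 * R.Mp + 1 < 2 ^ v) :
    Runs v emitPad s (fun s' => Frame [rk, rck, rPtr] [16] s s' ∧
      Emitted off lim (l ++ words R.padEdges) s') (R.Mp * 80 + 9) := by
  have b5 := (hb.lt hR).2.2.2.2.1
  have hc := hb.consts
  have h4 := hb.Bl_lt
  refine Runs.emitLoop (N := R.Mp) (by have := hb.v_pos; omega) hE rfl rfl rfl
    rfl ?_ ?_ b5 hl (fun k hk s' hf hsk => ⟨?_, ?_⟩) (fun k hk _ s' hf hsk => ?_)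
    (fun k hk hC => ?_) (by decide) (by decide)
  · rw [Expr.bd_var, hP.Mp_eq]; omega
  · rw [Expr.eval_var, hP.Mp_eq]
  · rw [Expr.bd_lit]; omega
  · simp
  · have hP' := hP.emitFrame hf
    refine ⟨⟨?_, ?_⟩, ?_, ?_⟩
    · simp only [Expr.bd_add, Expr.bd_mul, Expr.bd_lit, Expr.bd_div, Expr.bd_var, hsk, hP'.Bl_eq]
      omega
    · simp only [Expr.bd_add, Expr.bd_mul, Expr.bd_lit, Expr.bd_mod, Expr.bd_var, hsk, hP'.Bl_eq]
      omega
    · simp only [Expr.eval_add, Expr.eval_mul, Expr.eval_lit, Expr.eval_div, Expr.eval_var, hsk,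
        hP'.Bl_eq]
    · simp only [Expr.eval_add, Expr.eval_mul, Expr.eval_lit, Expr.eval_mod, Expr.eval_var, hsk,
        hP'.Bl_eq]
  · refine hb.of_mem hR ?_
    simp only [RedParams.allEdges, List.mem_append]
    exact .inr (.inr (.inr (.inr (mem_pairList.2 ⟨k, hk, hC, rfl⟩))))

/-- The encoding of the graph of the reduction. -/
def _root_.RedParams.graphWords (R : RedParams) : List ℕ :=
  8 * R.Bl :: R.allEdges.length :: words R.allEdges

theorem _root_.RedParams.length_allEdges_le (R : RedParams) : R.allEdges.length ≤
    R.A * (R.Gm * R.s) + R.Gm * R.s * 2 * R.s + R.A * (R.Gm * R.s) * R.s +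
      R.A * (R.Gm * R.s) * R.s + R.Mp := by
  have h1 : R.outEdges.length ≤ _ := length_pairList_le _ _ _
  have h2 : R.midEdges.length ≤ _ := length_pairList_le _ _ _
  have h3 : R.directEdges.length ≤ _ := length_pairList_le _ _ _
  have h4 : R.slackEdges.length ≤ _ := length_pairList_le _ _ _
  have h5 : R.padEdges.length ≤ _ := length_pairList_le _ _ _
  simp only [RedParams.allEdges, List.length_append]
  linarith

theorem _root_.RedParams.Valid.slots_ge (hR : R.Valid) :
    R.A * (R.Gm * R.s) + R.Gm * R.s * 2 * R.s + R.A * (R.Gm * R.s) * R.s +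
      R.A * (R.Gm * R.s) * R.s + R.Mp ≤ R.slots := by
  have h1 := Nat.le_mul_of_pos_right (R.A * (R.Gm * R.s)) hR.s_pos
  have h2 := Nat.le_mul_of_pos_left (R.Gm * R.s) hR.A_pos
  rw [RedParams.slots]
  nlinarith [Nat.mul_le_mul_right R.s h2]

/-- Write the encoding of the graph to the window. -/
def buildProg : Prog :=
  .seq (put 16 (.var rOff) (.lit 8 * .var rBl)) (.seq (assign rPtr (.var rOff + .lit 2))
    (.seq emitOut (.seq emitMid (.seq emitDirect (.seq emitSlack (.seq emitPad
      (put 16 (.var rOff + .lit 1) ((.var rPtr - .var rOff - .lit 2) / .lit 2))))))))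

theorem Runs.buildProg (hR : R.Valid) (hb : BuildBd R v off lim) (hP : ParamsAt R off s)
    (hz : ∀ i, off ≤ i → s.mem 16 i = 0) (hlt : ∀ i, s.mem 16 i < lim) :
    Runs v buildProg s (fun s' => Frame [rk, rck, rPtr] [16] s s' ∧
      (∀ i, s'.mem 16 (off + i) = R.graphWords.getD i 0) ∧ ∀ i, s'.mem 16 i < lim)
      (R.slots * 80 + 80) := by
  obtain ⟨b1, b2, b3, b4, b5, b6⟩ := hb.lt hR
  have hc := hb.consts
  have hv : 1 ≤ v := by have := hb.v_pos; omega
  have hoff : off < 2 ^ v := by have := hb.room; omega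
  have h4 := hb.Bl_lt
  have hA := hR.A_pos
  have hAB := hR.A_le_Bl
  set s₁ := (s.setMem 16 off (8 * R.Bl)).setReg rPtr (off + 2) with hs₁
  have hF₁ : Frame [rk, rck, rPtr] [16] s s₁ :=
    ((Frame.refl _ _ _).setMem (by simp) _ _).setReg (by simp) _
  have hP₁ : ParamsAt R off s₁ := hP.emitFrame hF₁
  -- The `0` stands for the number of edges, which depends on the table. It is recovered at the end
  -- from the position of the write pointer.
  have hE₁ : Emitted off lim [8 * R.Bl, 0] s₁ := by
    refine ⟨State.reg_setReg_self _ _ _, fun i => ?_, fun j => ?_⟩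
    · change (s.setMem 16 off (8 * R.Bl)).mem 16 (off + i) = _
      rw [State.mem_setMem]
      rcases i with _ | _ | i
      · simp
      · rw [if_neg (by omega), hz _ (by omega)]; rfl
      · rw [if_neg (by omega), hz _ (by omega)]; rfl
    · change (s.setMem 16 off (8 * R.Bl)).mem 16 j < lim
      rw [State.mem_setMem]
      split_ifs
      · exact hb.Bl_lim
      · exact hlt j
  have n1 : R.outEdges.length ≤ R.A * (R.Gm * R.s) := length_pairList_le _ _ _
  have n2 : R.midEdges.length ≤ R.Gm * R.s * 2 * R.s := length_pairList_le _ _ _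
  have n3 : R.directEdges.length ≤ R.A * (R.Gm * R.s) * R.s := length_pairList_le _ _ _
  have n4 : R.slackEdges.length ≤ R.A * (R.Gm * R.s) * R.s := length_pairList_le _ _ _
  have hsl := hR.slots_ge
  have hal := R.length_allEdges_le
  refine Runs.le (T := 1 + (3 + 1) + (3 + 1 + ((R.A * (R.Gm * R.s) * 80 + 9) +
    ((R.Gm * R.s * 2 * R.s * 80 + 9) + ((R.A * (R.Gm * R.s) * R.s * 80 + 9) +
    ((R.A * (R.Gm * R.s) * R.s * 80 + 9) + ((R.Mp * 80 + 9) + (3 + (7 + 1))))))))) ?_ (by omega)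
  refine Runs.put_seq (j := off) (x := 8 * R.Bl) rfl rfl hv ?_ ?_ ?_ ?_ ?_
  · rw [Expr.bd_var, hP.off_eq]; exact hoff
  · simp only [Expr.bd_mul, Expr.bd_lit, Expr.bd_var, hP.Bl_eq]; omega
  · rw [Expr.eval_var, hP.off_eq]
  · simp only [Expr.eval_mul, Expr.eval_lit, Expr.eval_var, hP.Bl_eq]
  refine Runs.assign_seq (x := off + 2) rfl hv ?_ ?_ ?_
  · simp only [Expr.bd_add, Expr.bd_lit, Expr.bd_var]
    change s.reg rOff < _ ∧ _
    rw [hP.off_eq]; omega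
  · simp only [Expr.eval_add, Expr.eval_lit, Expr.eval_var]
    change s.reg rOff + 2 = _
    rw [hP.off_eq]
  refine (Runs.emitOut hR hb hP₁ hE₁ (by simp; omega)).seq fun s₂ ⟨f₂, E₂⟩ => ?_
  refine (Runs.emitMid hR hb (hP₁.emitFrame f₂) E₂
    (by simp only [List.length_append, length_words, List.length_cons, List.length_nil]; omega)).seq
    fun s₃ ⟨f₃, E₃⟩ => ?_
  replace f₃ := f₂.trans f₃
  refine (Runs.emitDirect hR hb (hP₁.emitFrame f₃) E₃
    (by simp only [List.length_append, length_words, List.length_cons, List.length_nil]; omega)).seq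
    fun s₄ ⟨f₄, E₄⟩ => ?_
  replace f₄ := f₃.trans f₄
  refine (Runs.emitSlack hR hb (hP₁.emitFrame f₄) E₄
    (by simp only [List.length_append, length_words, List.length_cons, List.length_nil]; omega)).seq
    fun s₅ ⟨f₅, E₅⟩ => ?_
  replace f₅ := f₄.trans f₅
  refine (Runs.emitPad hR hb (hP₁.emitFrame f₅) E₅
    (by simp only [List.length_append, length_words, List.length_cons, List.length_nil]; omega)).seq
    fun s₆ ⟨f₆, E₆⟩ => ?_
  replace f₆ := f₅.trans f₆
  have hP₆ := hP₁.emitFrame f₆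
  simp only [List.append_assoc, ← words_append] at E₆
  change Emitted off lim ([8 * R.Bl, 0] ++ words R.allEdges) s₆ at E₆
  have hp := E₆.ptr
  rw [List.length_append, length_words, List.length_cons, List.length_cons, List.length_nil] at hp
  refine Runs.put' (j := off + 1) (x := R.allEdges.length) rfl rfl hv ?_ ?_ ?_ ?_ ⟨?_, fun i => ?_,
    fun j => ?_⟩
  · simp only [Expr.bd_add, Expr.bd_lit, Expr.bd_var, hP₆.off_eq]; omega
  · simp only [Expr.bd_div, Expr.bd_sub, Expr.bd_lit, Expr.bd_var, hP₆.off_eq, hp]; omega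
  · simp only [Expr.eval_add, Expr.eval_lit, Expr.eval_var, hP₆.off_eq]
  · simp only [Expr.eval_div, Expr.eval_sub, Expr.eval_lit, Expr.eval_var, hP₆.off_eq, hp]; omega
  · exact (hF₁.trans f₆).setMem (by simp) _ _
  · rw [State.mem_setMem, E₆.cell, RedParams.graphWords]
    rcases i with _ | _ | i
    · simp
    · simp
    · rw [if_neg (by omega)]; rfl
  · rw [State.mem_setMem]
    split_ifs
    · have := hb.slots_lim; omega
    · exact E₆.lt j

end Emit

end WordRAM

namespace WordRAM

/-! ### Evaluating the candidates found by the flow values -/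

notation "rBest" => (8 : ℕ)
notation "rp" => (28 : ℕ)
notation "rcp" => (29 : ℕ)
notation "rCand" => (30 : ℕ)
notation "rg" => (31 : ℕ)
notation "rcg" => (34 : ℕ)

theorem _root_.RedParams.unsat_eq_sum (R : RedParams) (α β γ : ℕ) : R.unsat α β γ =
    ∑ i ∈ Finset.range R.s, R.u α i * R.u (R.A + β) i * R.u (2 * R.A + γ) i := by
  rw [RedParams.unsat]
  refine Finset.sum_congr rfl fun i hi => ?_
  have hi' := Finset.mem_range.1 hi
  rw [RedParams.full, RedParams.bit, Nat.digits_mod hi', Nat.digits_div hi']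
  ring

/-- Add up the slots that are unsatisfied by the candidate and `rg`. -/
def slotLoop : Prog := forLoop ri rci (.var rs) (assign racc (.var racc +
  .entry (.var rCand / .var rA) (.var ri) * .entry (.var rA + .var rCand % .var rA) (.var ri) *
    .entry (.lit 2 * .var rA + .var rg) (.var ri)))

section Scan

variable {R : RedParams} {v off lim : ℕ} {s : State}

theorem Runs.slotLoop {k γ : ℕ} (hR : R.Valid) (hb : BuildBd R v off lim) (hP : ParamsAt R off s)
    (hk : k < R.A * R.A) (hkv : k < 2 ^ v) (hγ : γ < R.Gm) (hcand : s.reg rCand = k)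
    (hrg : s.reg rg = γ) (hacc : s.reg racc = 0) :
    Runs v slotLoop s (fun s' => Frame [ri, rci, racc] [] s s' ∧
      s'.reg racc = R.unsat (k / R.A) (k % R.A) γ) (R.s * 60 + 5) := by
  have hc := hb.consts
  have h2 := hb.s_lt
  have h3 := hb.A_lt
  have hv : 1 ≤ v := by have := hb.v_pos; omega
  have hg : R.Gm < 2 ^ v := (Nat.le_mul_of_pos_right _ hR.s_pos).trans_lt (hb.lt hR).1
  have hka : k / R.A < R.A := Nat.div_lt_of_lt_mul hk
  have hkb : k % R.A < R.A := Nat.mod_lt _ hR.A_pos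
  refine (Runs.forLoop (v := v) (N := R.s) (T := 50) (fun i s' => Frame [ri, rci, racc] [] s s' ∧
    s'.reg racc = ∑ i ∈ Finset.range i,
      R.u (k / R.A) i * R.u (R.A + k % R.A) i * R.u (2 * R.A + γ) i)
    (by norm_num) (by norm_num) (by norm_num) hv rfl (by rw [Expr.bd_var, hP.s_eq]; exact h2)
    (by rw [Expr.eval_var, hP.s_eq]) h2 ?_ ?_ ?_ ?_).le ?_
  · rintro k s' x y ⟨h1, h2⟩
    exact ⟨(h1.setReg (by simp) _).setReg (by simp) _, by simpa [State.reg_setReg] using h2⟩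
  · exact ⟨.refl _ _ _, by simpa using hacc⟩
  · rintro i hi s' ⟨hF, hs⟩ hsi
    have hP' := hP.frame hF (by decide) (by simp)
    have c1 : s'.reg rCand = k := (hF.reg _ (by simp)).trans hcand
    have c2 : s'.reg rg = γ := (hF.reg _ (by simp)).trans hrg
    have e0 : (Expr.var ri).eval s' = i := hsi
    have e1 : (Expr.var rCand / Expr.var rA).eval s' = k / R.A := by
      simp only [Expr.eval_div, Expr.eval_var, c1, hP'.A_eq]
    have e2 : (Expr.var rA + Expr.var rCand % Expr.var rA).eval s' = R.A + k % R.A := by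
      simp only [Expr.eval_add, Expr.eval_mod, Expr.eval_var, c1, hP'.A_eq]
    have e3 : (Expr.lit 2 * Expr.var rA + Expr.var rg).eval s' = 2 * R.A + γ := by
      simp only [Expr.eval_add, Expr.eval_mul, Expr.eval_lit, Expr.eval_var, c2, hP'.A_eq]
    have hib : (Expr.var ri).Bd (2 ^ v) s' := by rw [Expr.bd_var, hsi]; omega
    have f1 := hP'.eval_entry (row := .var rCand / .var rA) (i := .var ri) (by rw [e1]; omega)
      (by rw [e0]; exact hi)
    have f2 := hP'.eval_entry (row := .var rA + .var rCand % .var rA) (i := .var ri)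
      (by rw [e2]; omega) (by rw [e0]; exact hi)
    have f3 := hP'.eval_entry (row := .lit 2 * .var rA + .var rg) (i := .var ri)
      (by rw [e3]; omega) (by rw [e0]; exact hi)
    have g1 := hP'.bd_entry hR (V := 2 ^ v) (row := .var rCand / .var rA) (i := .var ri)
      (by rw [e1]; omega) (by rw [e0]; exact hi) (by omega) h2
      (by simp only [Expr.bd_div, Expr.bd_var, c1, hP'.A_eq]; omega) hib
    have g2 := hP'.bd_entry hR (V := 2 ^ v) (row := .var rA + .var rCand % .var rA) (i := .var ri)
      (by rw [e2]; omega) (by rw [e0]; exact hi) (by omega) h2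
      (by simp only [Expr.bd_add, Expr.bd_mod, Expr.bd_var, c1, hP'.A_eq]; omega) hib
    have g3 := hP'.bd_entry hR (V := 2 ^ v) (row := .lit 2 * .var rA + .var rg) (i := .var ri)
      (by rw [e3]; omega) (by rw [e0]; exact hi) (by omega) h2
      (by simp only [Expr.bd_add, Expr.bd_mul, Expr.bd_lit, Expr.bd_var, c2, hP'.A_eq]; omega) hib
    rw [e1, e0] at f1
    rw [e2, e0] at f2
    rw [e3, e0] at f3
    have hle : ∑ i ∈ Finset.range i,
        R.u (k / R.A) i * R.u (R.A + k % R.A) i * R.u (2 * R.A + γ) i ≤ i := by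
      refine (Finset.sum_le_card_nsmul _ _ 1 fun j _ => ?_).trans (by simp)
      exact Nat.mul_le_mul (Nat.mul_le_mul (hR.u_le _ _) (hR.u_le _ _)) (hR.u_le _ _)
    refine Runs.le (Runs.assign' (x := ∑ i ∈ Finset.range (i + 1),
      R.u (k / R.A) i * R.u (R.A + k % R.A) i * R.u (2 * R.A + γ) i) rfl hv ?_ ?_ ⟨?_, ?_, ?_, ?_⟩)
      (by decide)
    · simp only [Expr.bd_add, Expr.bd_mul, Expr.bd_var, hs, g1, g2, g3, and_true]; omega
    · simp only [Expr.eval_add, Expr.eval_mul, Expr.eval_var, hs, f1, f2, f3,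
        Finset.sum_range_succ]
    · rw [State.reg_setReg_of_ne (by norm_num), hsi]
    · rw [State.reg_setReg_of_ne (by norm_num)]
    · exact hF.setReg (by simp) _
    · rw [State.reg_setReg_self]
  · rintro s' ⟨h1, h2⟩
    exact ⟨h1, by rw [h2, R.unsat_eq_sum]⟩
  · rw [show (Expr.var rs).size = 1 from rfl]; omega

/-- Improve the best value by the candidate. -/
def candLoop : Prog := forLoop rg rcg (.var rGm) (.seq (assign racc (.lit 0)) (.seq slotLoop
  (assign rBest (.var rBest - (.var rBest - .var racc)))))

theorem _root_.RedParams.Valid.unsat_le (hR : R.Valid) (α β γ : ℕ) : R.unsat α β γ ≤ R.s := by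
  rw [R.unsat_eq_sum]
  refine (Finset.sum_le_card_nsmul _ _ 1 fun j _ => ?_).trans (by simp)
  exact Nat.mul_le_mul (Nat.mul_le_mul (hR.u_le _ _) (hR.u_le _ _)) (hR.u_le _ _)

/-- The counts are exact whatever candidate is given, so a common lower bound `μ` survives. The
doubly truncated difference in the program is a minimum. -/
theorem Runs.candLoop {k b μ : ℕ} (hR : R.Valid) (hb : BuildBd R v off lim) (hP : ParamsAt R off s)
    (hk : k < R.A * R.A) (hkv : k < 2 ^ v) (hcand : s.reg rCand = k) (hbest : s.reg rBest = b)
    (hbv : b < 2 ^ v) (hμb : μ ≤ b) (hμ : ∀ γ < R.Gm, μ ≤ R.unsat (k / R.A) (k % R.A) γ) :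
    Runs v candLoop s (fun s' => Frame [rg, rcg, ri, rci, racc, rBest] [] s s' ∧
      s'.reg rBest ≤ b ∧ μ ≤ s'.reg rBest ∧
        ∀ γ < R.Gm, s'.reg rBest ≤ R.unsat (k / R.A) (k % R.A) γ)
      (R.Gm * (R.s * 60 + 30) + 5) := by
  have hc := hb.consts
  have h2 := hb.s_lt
  have hv : 1 ≤ v := by have := hb.v_pos; omega
  have hg : R.Gm < 2 ^ v := (Nat.le_mul_of_pos_right _ hR.s_pos).trans_lt (hb.lt hR).1
  refine (Runs.forLoop (v := v) (N := R.Gm) (T := 2 + (R.s * 60 + 5 + 6))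
    (fun j s' => Frame [rg, rcg, ri, rci, racc, rBest] [] s s' ∧ s'.reg rBest ≤ b ∧
      μ ≤ s'.reg rBest ∧ ∀ γ < j, s'.reg rBest ≤ R.unsat (k / R.A) (k % R.A) γ)
    (by norm_num) (by norm_num) (by norm_num) hv rfl (by rw [Expr.bd_var, hP.Gm_eq]; exact hg)
    (by rw [Expr.eval_var, hP.Gm_eq]) hg ?_ ?_ ?_ (fun _ h => h)).le ?_
  · rintro k s' x y ⟨h1, h2⟩
    exact ⟨(h1.setReg (by simp) _).setReg (by simp) _, by simpa [State.reg_setReg] using h2⟩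
  · exact ⟨.refl _ _ _, hbest.le, hbest ▸ hμb, fun γ hγ => absurd hγ (by omega)⟩
  · rintro γ hγ s' ⟨hF, h3, h4, h5⟩ hsγ
    refine Runs.assign_seq (x := 0) rfl hv (by rw [Expr.bd_lit]; omega) rfl ?_
    set s₁ := s'.setReg racc 0 with hs₁
    have hF₁ : Frame [rg, rcg, ri, rci, racc, rBest] [] s s₁ := hF.setReg (by simp) _
    refine (Runs.slotLoop (γ := γ) hR hb (hP.frame hF₁ (by decide) (by simp)) hk hkv hγ
      ((hF₁.reg _ (by simp)).trans hcand) (by simpa [hs₁, State.reg_setReg] using hsγ)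
      (by simp [hs₁, State.reg_setReg])).seq fun s₂ ⟨f₂, e₂⟩ => ?_
    have eb : s₂.reg rBest = s'.reg rBest := by
      rw [f₂.reg _ (by simp), hs₁, State.reg_setReg_of_ne (by norm_num)]
    have hu := hR.unsat_le (k / R.A) (k % R.A) γ
    refine (Runs.assign' (x := s₂.reg rBest - (s₂.reg rBest - s₂.reg racc)) rfl hv ?_ ?_
      ⟨?_, ?_, ?_, ?_, ?_, fun γ' hγ' => ?_⟩)
    · simp only [Expr.bd_sub, Expr.bd_var, eb, e₂]; omega
    · simp only [Expr.eval_sub, Expr.eval_var]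
    · rw [State.reg_setReg_of_ne (by norm_num), f₂.reg _ (by simp), hs₁,
        State.reg_setReg_of_ne (by norm_num), hsγ]
    · rw [State.reg_setReg_of_ne (by norm_num), f₂.reg _ (by simp), hs₁,
        State.reg_setReg_of_ne (by norm_num)]
    · exact (hF₁.trans (f₂.mono (by simp) (by simp))).setReg (by simp) _
    · rw [State.reg_setReg_self, eb]; omega
    · rw [State.reg_setReg_self, eb, e₂]; have := hμ γ hγ; omega
    · rw [State.reg_setReg_self, eb, e₂]
      by_cases hh : γ' = γ
      · rw [hh]; omega
      · have := h5 γ' (by omega); omega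
  · rw [show (Expr.var rGm).size = 1 from rfl,
      show 2 + (R.s * 60 + 5 + 6) + 9 = R.s * 60 + 22 by omega]
    have := Nat.mul_le_mul_left R.Gm (show R.s * 60 + 22 ≤ R.s * 60 + 30 by omega)
    omega

/-- The expression that flags the pair `rk`. -/
def flagExpr : Expr := .var rGs - .load 17 (.var rOff + ((.var rk / .var rA) * (.lit 8 * .var rBl) +
  (.var rBl + (.var rk % .var rA * .var rs + .var rp))))

/-- Find the last flagged pair. -/
def findLoop : Prog := forLoop rk rck (.var rA * .var rA) (cond flagExpr (assign rCand (.var rk)) .skip)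

/-- Cell of the output table for a pair and a threshold. -/
def _root_.RedParams.cell (R : RedParams) (k p : ℕ) : ℕ :=
  k / R.A * (8 * R.Bl) + (R.Bl + (k % R.A * R.s + p))

/-- Apart from the word bound nothing is assumed about array `17`, which may be garbage after a
wrong guess. If no pair is flagged, the initial `0` remains, which is a legitimate candidate as
well. -/
theorem Runs.findLoop {p : ℕ} (hR : R.Valid) (hb : BuildBd R v off lim) (hP : ParamsAt R off s)
    (hAA : R.A * R.A < 2 ^ v) (hm : ∀ i, s.mem 17 i < 2 ^ v) (hp : p < R.s) (hrp : s.reg rp = p)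
    (hcand : s.reg rCand = 0) :
    Runs v findLoop s (fun s' => Frame [rk, rck, rCand] [] s s' ∧ s'.reg rCand < R.A * R.A ∧
      ((∃ k < R.A * R.A, s.mem 17 (off + R.cell k p) < R.Gm * R.s) →
        s.mem 17 (off + R.cell (s'.reg rCand) p) < R.Gm * R.s)) (R.A * R.A * 50 + 7) := by
  have hc := hb.consts
  have h2 := hb.s_lt
  have h3 := hb.A_lt
  have h4 := hb.Bl_lt
  have hG := (hb.lt hR).1
  have hoff : off < 2 ^ v := by have := hb.room; omega
  have hv : 1 ≤ v := by have := hb.v_pos; omega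
  have hA0 : 0 < R.A * R.A := Nat.mul_pos hR.A_pos hR.A_pos
  refine (Runs.forLoop (v := v) (N := R.A * R.A) (T := 40)
    (fun j s' => Frame [rk, rck, rCand] [] s s' ∧ s'.reg rCand < R.A * R.A ∧
      ((∃ k < j, s.mem 17 (off + R.cell k p) < R.Gm * R.s) →
        s.mem 17 (off + R.cell (s'.reg rCand) p) < R.Gm * R.s))
    (by norm_num) (by norm_num) (by norm_num) hv rfl
    (by simp only [Expr.bd_mul, Expr.bd_var, hP.A_eq]; omega)
    (by simp only [Expr.eval_mul, Expr.eval_var, hP.A_eq]) hAA ?_ ?_ ?_ (fun _ h => h)).le ?_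
  · rintro k s' x y ⟨h1, h2⟩
    exact ⟨(h1.setReg (by simp) _).setReg (by simp) _, by simpa [State.reg_setReg] using h2⟩
  · exact ⟨.refl _ _ _, by omega, fun ⟨k, hk, _⟩ => absurd hk (by omega)⟩
  · rintro k hk s' ⟨hF, h5, h6⟩ hsk
    have hP' := hP.frame hF (by decide) (by simp)
    have c1 : s'.reg rp = p := (hF.reg _ (by simp)).trans hrp
    have hm' : s'.mem 17 = s.mem 17 := hF.mem _ (by simp)
    have he : flagExpr.eval s' = R.Gm * R.s - s.mem 17 (off + R.cell k p) := by
      simp only [flagExpr, Expr.eval_add, Expr.eval_sub, Expr.eval_mul, Expr.eval_div,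
        Expr.eval_mod, Expr.eval_lit, Expr.eval_var, Expr.eval_load, hsk, c1, hP'.A_eq, hP'.Bl_eq,
        hP'.s_eq, hP'.off_eq, hP'.Gs_eq, hm', RedParams.cell]
    refine Runs.le (Runs.cond (T := 2) rfl hv ?_ (fun h0 => ?_) fun h0 => ?_) (by decide)
    · simp only [flagExpr, Expr.bd_add, Expr.bd_sub, Expr.bd_mul, Expr.bd_div,
        Expr.bd_mod, Expr.bd_lit, Expr.bd_var, Expr.bd_load, hsk, c1, hP'.A_eq, hP'.Bl_eq,
        hP'.s_eq, hP'.off_eq, hP'.Gs_eq, hm', hm, and_true]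
      omega
    · rw [he] at h0
      refine Runs.assign' (x := k) rfl hv (by rw [Expr.bd_var, hsk]; omega)
        (by rw [Expr.eval_var, hsk]) ⟨?_, ?_, hF.setReg (by simp) _, ?_, fun _ => ?_⟩
      · rw [State.reg_setReg_of_ne (by norm_num), hsk]
      · rw [State.reg_setReg_of_ne (by norm_num)]
      · rw [State.reg_setReg_self]; exact hk
      · rw [State.reg_setReg_self]; omega
    · rw [he] at h0
      refine (Runs.skip ⟨hsk, rfl, hF, h5, ?_⟩).le (by norm_num)
      rintro ⟨k', hk', hlt⟩
      refine h6 ⟨k', ?_, hlt⟩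
      rcases Nat.lt_succ_iff_lt_or_eq.1 hk' with h | h
      · exact h
      · rw [h] at hlt; omega
  · rw [show (Expr.var rA * Expr.var rA).size = 3 from rfl]; omega

/-- For every threshold find a pair and improve the best value. -/
def scanProg : Prog := forLoop rp rcp (.var rs) (.seq (assign rCand (.lit 0)) (.seq findLoop candLoop))

/-- One candidate per threshold suffices, since any flagged pair has a third-block assignment that
is as good as the threshold demands. This costs about `A * A + Gm * s` per threshold, whereas
evaluating all triples would cost `A * A * Gm * s`. Only the last conclusion relies on correct flow
values. -/
theorem Runs.scanProg {b μ : ℕ} (hR : R.Valid) (hb : BuildBd R v off lim) (hP : ParamsAt R off s)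
    (hAA : R.A * R.A < 2 ^ v) (hm : ∀ i, s.mem 17 i < 2 ^ v) (hbest : s.reg rBest = b)
    (hbs : b < R.s) (hμb : μ ≤ b)
    (hμ : ∀ α < R.A, ∀ β < R.A, ∀ γ < R.Gm, μ ≤ R.unsat α β γ) :
    Runs v scanProg s (fun s' =>
      Frame [rp, rcp, rCand, rk, rck, rg, rcg, ri, rci, racc, rBest] [] s s' ∧
      s'.reg rBest ≤ b ∧ μ ≤ s'.reg rBest ∧
      ((∀ α < R.A, ∀ β < R.A, ∀ p < R.s,
        s.mem 17 (off + (α * (8 * R.Bl) + (R.Bl + (β * R.s + p)))) < R.Gm * R.s ↔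
          ∃ γ < R.Gm, R.unsat α β γ + p + 1 < R.s) →
        ∀ α < R.A, ∀ β < R.A, ∀ γ < R.Gm, s'.reg rBest ≤ R.unsat α β γ))
      (R.s * (R.A * R.A * 50 + R.Gm * (R.s * 60 + 30) + 40) + 5) := by
  have hc := hb.consts
  have h2 := hb.s_lt
  have hv : 1 ≤ v := by have := hb.v_pos; omega
  have hA0 : 0 < R.A * R.A := Nat.mul_pos hR.A_pos hR.A_pos
  refine (Runs.forLoop (v := v) (N := R.s)
    (T := 2 + (R.A * R.A * 50 + 7 + (R.Gm * (R.s * 60 + 30) + 5)))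
    (fun j s' => Frame [rp, rcp, rCand, rk, rck, rg, rcg, ri, rci, racc, rBest] [] s s' ∧
      s'.reg rBest ≤ b ∧ μ ≤ s'.reg rBest ∧ ∀ p < j,
        ∃ k < R.A * R.A, ((∃ k < R.A * R.A, s.mem 17 (off + R.cell k p) < R.Gm * R.s) →
          s.mem 17 (off + R.cell k p) < R.Gm * R.s) ∧
          ∀ γ < R.Gm, s'.reg rBest ≤ R.unsat (k / R.A) (k % R.A) γ)
    (by norm_num) (by norm_num) (by norm_num) hv rfl (by rw [Expr.bd_var, hP.s_eq]; exact h2)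
    (by rw [Expr.eval_var, hP.s_eq]) h2 ?_ ?_ ?_ ?_).le ?_
  · rintro k s' x y ⟨h1, h2⟩
    exact ⟨(h1.setReg (by simp) _).setReg (by simp) _, by simpa [State.reg_setReg] using h2⟩
  · exact ⟨.refl _ _ _, hbest.le, hbest ▸ hμb, fun γ hγ => absurd hγ (by omega)⟩
  · rintro p hp s' ⟨hF, h3, h4, h5⟩ hsp
    refine Runs.assign_seq (x := 0) rfl hv (by rw [Expr.bd_lit]; omega) rfl ?_
    set s₁ := s'.setReg rCand 0 with hs₁
    have hF₁ : Frame [rp, rcp, rCand, rk, rck, rg, rcg, ri, rci, racc, rBest] [] s s₁ :=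
      hF.setReg (by simp) _
    have hm₁ : s₁.mem 17 = s.mem 17 := hF₁.mem _ (by simp)
    refine (Runs.findLoop (p := p) hR hb (hP.frame hF₁ (by decide) (by simp)) hAA
      (by rw [hm₁]; exact hm) hp (by simpa [hs₁, State.reg_setReg] using hsp)
      (by simp [hs₁, State.reg_setReg])).seq fun s₂ ⟨f₂, e₂, e₃⟩ => ?_
    rw [hm₁] at e₃
    have hF₂ : Frame [rp, rcp, rCand, rk, rck, rg, rcg, ri, rci, racc, rBest] [] s s₂ :=
      hF₁.trans (f₂.mono (by simp) (by simp))
    have eb : s₂.reg rBest = s'.reg rBest := by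
      rw [f₂.reg _ (by simp), hs₁, State.reg_setReg_of_ne (by norm_num)]
    refine (Runs.candLoop (k := s₂.reg rCand) (b := s'.reg rBest) (μ := μ) hR hb
      (hP.frame hF₂ (by decide) (by simp)) e₂ (by omega) rfl eb (by omega) h4
      (fun γ hγ => hμ _ (Nat.div_lt_of_lt_mul e₂) _ (Nat.mod_lt _ hR.A_pos) γ hγ)).mono ?_ le_rfl
    rintro s₃ ⟨f₃, g1, g2, g3⟩
    refine ⟨?_, ?_, hF₂.trans (f₃.mono (by simp) (by simp)), g1.trans h3, g2, fun p' hp' => ?_⟩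
    · rw [f₃.reg _ (by simp), f₂.reg _ (by simp), hs₁, State.reg_setReg_of_ne (by norm_num), hsp]
    · rw [f₃.reg _ (by simp), f₂.reg _ (by simp), hs₁, State.reg_setReg_of_ne (by norm_num)]
    · rcases Nat.lt_succ_iff_lt_or_eq.1 hp' with h | rfl
      · obtain ⟨k, q1, q2, q3⟩ := h5 p' h
        exact ⟨k, q1, q2, fun γ hγ => g1.trans (q3 γ hγ)⟩
      · exact ⟨_, e₂, e₃, g3⟩
  · rintro s' ⟨hF, h3, h4, h5⟩
    refine ⟨hF, h3, h4, fun hflow α hα β hβ γ hγ => ?_⟩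
    by_cases hw : R.unsat α β γ + 1 < R.s
    · have hp : R.s - 2 - R.unsat α β γ < R.s := by omega
      obtain ⟨k, q1, q2, q3⟩ := h5 _ hp
      have hcell : R.cell (α * R.A + β) (R.s - 2 - R.unsat α β γ) =
          α * (8 * R.Bl) + (R.Bl + (β * R.s + (R.s - 2 - R.unsat α β γ))) := by
        rw [RedParams.cell, Nat.digits_div hβ, Nat.digits_mod hβ]
      have hfl := q2 ⟨α * R.A + β, Nat.lt_mul_iff_exists_digits.2 ⟨α, hα, β, hβ, rfl⟩, by
        rw [hcell]; exact (hflow α hα β hβ _ hp).2 ⟨γ, hγ, by omega⟩⟩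
      obtain ⟨γ', hγ', hu⟩ := (hflow _ (Nat.div_lt_of_lt_mul q1) _ (Nat.mod_lt _ hR.A_pos) _ hp).1 hfl
      have := q3 γ' hγ'
      omega
    · omega
  · rw [show (Expr.var rs).size = 1 from rfl]
    have := Nat.mul_le_mul_left R.s (show 2 + (R.A * R.A * 50 + 7 + (R.Gm * (R.s * 60 + 30) + 5)) + 9 ≤
      R.A * R.A * 50 + R.Gm * (R.s * 60 + 30) + 40 by omega)
    omega

end Scan

end WordRAM

namespace WordRAM

/-! ### One guess -/

notation "rZ" => (3 : ℕ)
notation "rL" => (4 : ℕ)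
notation "rF" => (5 : ℕ)
notation "rgg" => (11 : ℕ)
notation "rgm" => (13 : ℕ)

/-- Set the registers `128, …, 127 + k` to `0`. -/
def zeroRegs : ℕ → Prog
  | 0 => .skip
  | k + 1 => .seq (zeroRegs k) (.const (k + 128) 0)

theorem Runs.zeroRegs {v : ℕ} {s : State} : ∀ k, Runs v (zeroRegs k) s (fun s' =>
    s'.mem = s.mem ∧ (∀ r < 128, s'.reg r = s.reg r) ∧ (∀ r < k, s'.reg (r + 128) = 0) ∧
      ∀ r, k ≤ r → s'.reg (r + 128) = s.reg (r + 128)) (k + 1)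
  | 0 => (Runs.skip ⟨rfl, fun _ _ => rfl, fun r hr => absurd hr (by omega), fun _ _ => rfl⟩).le
      (by omega)
  | k + 1 => by
    refine Runs.seq (T := k + 1) (T' := 1) (Runs.zeroRegs k) ?_
    rintro s₁ ⟨h1, h2, h3, h4⟩ s₀ hs
    refine ⟨_, 1, s₁.setReg (k + 128) 0, .const s₀ _ _ (Nat.two_pow_pos _), le_rfl, hs.setReg _ _,
      h1, fun r hr => ?_, fun r hr => ?_, fun r hr => ?_⟩
    · rw [State.reg_setReg_of_ne (by omega), h2 r hr]
    · rw [State.reg_setReg]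
      split_ifs with h
      · rfl
      · exact h3 r (by omega)
    · rw [State.reg_setReg_of_ne (by omega), h4 r (by omega)]

/-- What is known after a limited simulation. -/
structure LimPost (lim off fuel : ℕ) (p : Prog) (s s' : State) : Prop where
  reg : ∀ r < 64, r ∉ [rFuel, rGuard, rAddr] → s'.reg r = s.reg r
  regBound : ∀ r, p.regBound ≤ r → s'.reg (r + 128) = s.reg (r + 128)
  mem : ∀ A < 16, s'.mem A = s.mem A
  window : ∀ A i, (i < off ∨ off + lim ≤ i) → s'.mem (A + 16) i = s.mem (A + 16) i
  lt : ∀ A i, s'.mem (A + 16) i < lim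
  sim : ∀ σ σ' t B', B' ≤ lim → Represents lim off σ s → Exec B' p σ σ' t → t ≤ fuel →
    Represents lim off σ' s'

theorem Runs.limited {v lim off fuel : ℕ} {p : Prog} {s : State} (hv : 1 ≤ v) (hlim : lim ≤ 2 ^ v)
    (hoff : off < 2 ^ v) (hfuel : fuel < 2 ^ v) (hp : p.constBound ≤ 2 ^ v)
    (h : LimInv lim off fuel s) :
    Runs v p.limited s (LimPost lim off fuel p s) (p.limitedCost * (fuel + 1)) := by
  intro s₀ hs
  have e1 : ∀ r < 64, s₀.reg r = s.reg r := fun r hr => hs.2 r (.inl hr)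
  have e2 : ∀ r, s₀.reg (r + 128) = s.reg (r + 128) := fun r => hs.2 _ (.inr (by omega))
  obtain ⟨S', t', f', a1, a2, a3, a4, a5, a6⟩ := Prog.limited_spec (B := 2 ^ (32 * v)) (lim := lim)
    (off := off) (Nat.pow_le_pow_right (by norm_num) (by omega)) hv hlim hoff hfuel p hp fuel le_rfl s₀
    ⟨(e1 _ (by norm_num)).trans h.hlim, (e1 _ (by norm_num)).trans h.hoff,
      (e1 _ (by norm_num)).trans h.hfuel, (e1 _ (by norm_num)).trans h.one,
      fun r => by rw [e2]; exact h.reg r, fun A i => by rw [hs.1]; exact h.mem A i⟩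
  refine ⟨S', t', S', a1, by omega, .refl _, fun r hr hn => ?_, fun r hr => ?_, fun A hA => ?_,
    fun A i hi => ?_, a2.mem, fun σ σ' t B' hB hR hE ht => ?_⟩
  · simp only [List.mem_cons, List.not_mem_nil, or_false, not_or] at hn
    rw [a5.reg r (by omega) hn.1 hn.2.1 hn.2.2, e1 r hr]
  · rw [a5.regBound r hr, e2]
  · rw [a5.mem A hA, hs.1]
  · rw [a5.window A i hi, hs.1]
  · exact (a6 σ σ' t B' hB ⟨fun r => by rw [hR.1, e2], fun A i hi => by rw [hR.2 A i hi, hs.1]⟩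
      hE ht).1

/-- The registers and arrays that a guess leaves alone. -/
structure Keep (s s' : State) : Prop where
  reg : ∀ r < 13, r ≠ rOff → r ≠ rBest → s'.reg r = s.reg r
  mem0 : s'.mem 0 = s.mem 0
  mem2 : s'.mem 2 = s.mem 2

theorem Keep.trans {s s' s'' : State} (h : Keep s s') (h' : Keep s' s'') : Keep s s'' :=
  ⟨fun r h1 h2 h3 => (h'.reg r h1 h2 h3).trans (h.reg r h1 h2 h3), h'.mem0.trans h.mem0,
    h'.mem2.trans h.mem2⟩

theorem Frame.keep {L M : List ℕ} {s s' : State} (h : Frame L M s s')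
    (hL : ∀ r ∈ L, 13 ≤ r ∨ r = rOff ∨ r = rBest) (hM : 0 ∉ M ∧ 2 ∉ M) : Keep s s' :=
  ⟨fun r h1 h2 h3 => h.reg r fun hr => by have := hL r hr; omega, h.mem 0 hM.1, h.mem 2 hM.2⟩

/-- The constants of the program are in place. -/
structure Setup (Φ : CNFFormula) (v L F lim : ℕ) (s : State) : Prop where
  input : InputAt v Φ.n Φ.codes s
  pow : ∀ i ≤ Φ.n + L, s.mem 2 i = 2 ^ i
  Z_eq : s.reg rZ = 2 ^ L
  L_eq : s.reg rL = L
  F_eq : s.reg rF = F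
  lim_eq : s.reg rLim = lim

theorem Setup.keep {Φ : CNFFormula} {v L F lim : ℕ} {s s' : State} (h : Setup Φ v L F lim s)
    (hk : Keep s s') : Setup Φ v L F lim s' := by
  have e : ∀ r < 7, s'.reg r = s.reg r := fun r hr => hk.reg r (by omega) (by omega) (by omega)
  exact ⟨⟨(e _ (by norm_num)).trans h.input.rn_eq, (e _ (by norm_num)).trans h.input.rm_eq,
    (e _ (by norm_num)).trans h.input.rs_eq, fun i => by rw [hk.mem0, h.input.mem0],
    fun i hi => by rw [hk.mem2, h.input.pow i hi]⟩, fun i hi => by rw [hk.mem2, h.pow i hi],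
    (e _ (by norm_num)).trans h.Z_eq, (e _ (by norm_num)).trans h.L_eq,
    (e _ (by norm_num)).trans h.F_eq, (e _ (by norm_num)).trans h.lim_eq⟩

/-- The memory behind `off` is unused. -/
structure Window (lim bound off : ℕ) (s : State) : Prop where
  off_eq : s.reg rOff = off
  lt : ∀ A i, s.mem (A + 16) i < lim
  zero : ∀ A i, off ≤ i → s.mem (A + 16) i = 0
  reg : ∀ r, bound ≤ r → s.reg (r + 128) = 0

theorem Window.frame {lim bound off : ℕ} {L M : List ℕ} {s s' : State} (h : Window lim bound off s)
    (hf : Frame L M s s') (hL : ∀ r ∈ L, r ≠ rOff ∧ r < 128) (hM : ∀ A ∈ M, A < 16) :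
    Window lim bound off s' := by
  have hm : ∀ A, s'.mem (A + 16) = s.mem (A + 16) := fun A =>
    hf.mem _ fun hA => by have := hM _ hA; omega
  refine ⟨(hf.reg _ fun hr => (hL _ hr).1 rfl).trans h.off_eq, fun A i => by rw [hm]; exact h.lt A i,
    fun A i hi => by rw [hm]; exact h.zero A i hi, fun r hr => ?_⟩
  rw [hf.reg _ fun hr' => by have := (hL _ hr').2; omega, h.reg r hr]

/-- The parameters of the reduction for a guess. -/
def guessParams (Φ : CNFFormula) (L a g : ℕ) : RedParams where
  A := 2 ^ a
  Gm := 2 ^ min a g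
  s := Φ.m + 1
  Bl := 2 ^ a * 2 ^ L
  Mp := 2 ^ a * 2 ^ L * 2 ^ g
  u := unsatTable Φ.codes a

/-- Bounds for a guess. -/
structure GuessBd (Φ : CNFFormula) (p : Prog) (v L F lim : ℕ) : Prop where
  v_pos : 4 ≤ v
  input : InputBd v Φ.n Φ.codes
  Z_ge : 5 * (Φ.m + 1) ^ 2 ≤ 2 ^ L
  lim_ge : 256 * 2 ^ Φ.n * (2 ^ L) ^ 3 ≤ lim
  lim_le : lim ≤ 2 ^ v
  F_lt : F < 2 ^ v
  const : p.constBound ≤ 2 ^ v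

/-- The guess is within the limits. -/
def GuessOk (Φ : CNFFormula) (F a g : ℕ) : Prop :=
  Φ.n ≤ 2 * a + min a g ∧ 2 * a + min a g ≤ Φ.n + 4 ∧ 2 ^ a * 2 ^ a ≤ F

section Params

variable {Φ : CNFFormula} {p : Prog} {v L F lim a g off : ℕ}

theorem GuessBd.m_le (hb : GuessBd Φ p v L F lim) : 2 * (Φ.m + 1) ≤ 2 ^ L :=
  le_trans (by nlinarith [Nat.zero_le Φ.m]) hb.Z_ge

/-- The minimum with `a` keeps the slots within a block of nodes, with `2 ^ L` absorbing the number
of clause slots; `g ≤ a + L` makes the padding fit into its bipartite piece. -/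
theorem guessParams_valid (hZ : 5 * (Φ.m + 1) ^ 2 ≤ 2 ^ L) (hg : g ≤ a + L) :
    (guessParams Φ L a g).Valid := by
  have hm : 2 * (Φ.m + 1) ≤ 2 ^ L := le_trans (by nlinarith [Nat.zero_le Φ.m]) hZ
  have hG : 2 ^ min a g ≤ 2 ^ a := Nat.pow_le_pow_right (by norm_num) (min_le_left _ _)
  have hgp : 2 ^ g ≤ 2 ^ a * 2 ^ L := by
    rw [← pow_add]; exact Nat.pow_le_pow_right (by norm_num) hg
  refine ⟨Nat.succ_le_succ (Nat.zero_le _), Nat.one_le_two_pow, Nat.one_le_two_pow, ?_, ?_, ?_,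
    fun r i => unsatTable_le _ _ _ _⟩
  · exact Nat.mul_le_mul_left _ (show Φ.m + 1 ≤ 2 ^ L by omega)
  · calc 2 * (2 ^ min a g * (Φ.m + 1)) = 2 ^ min a g * (2 * (Φ.m + 1)) := by ring
      _ ≤ _ := Nat.mul_le_mul hG hm
  · change 2 ^ a * 2 ^ L * 2 ^ g ≤ 2 * (2 ^ a * 2 ^ L) * (2 * (2 ^ a * 2 ^ L))
    exact Nat.mul_le_mul (by omega) (by omega)

/-- From `g ≤ a + L` follows `g ≤ min a g + L`, so truncating the third block at `a` loses only a
factor `2 ^ L` against the padding. -/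
theorem guessParams_slots_le (hZ : 5 * (Φ.m + 1) ^ 2 ≤ 2 ^ L) (hg : g ≤ a + L) :
    (guessParams Φ L a g).slots ≤ 2 * (2 ^ a * 2 ^ min a g * (2 ^ L) ^ 2) := by
  have h1 : 2 ^ g ≤ 2 ^ min a g * 2 ^ L := by
    rw [← pow_add]
    exact Nat.pow_le_pow_right (by norm_num) (by omega)
  have hL : 1 ≤ 2 ^ L := Nat.one_le_two_pow
  have h2 : 2 ^ a * 2 ^ min a g * (5 * (Φ.m + 1) ^ 2) ≤ 2 ^ a * 2 ^ min a g * (2 ^ L) ^ 2 :=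
    Nat.mul_le_mul_left _ (hZ.trans (by nlinarith))
  have h3 : 2 ^ a * 2 ^ L * 2 ^ g ≤ 2 ^ a * 2 ^ L * (2 ^ min a g * 2 ^ L) :=
    Nat.mul_le_mul_left _ h1
  calc (guessParams Φ L a g).slots
      = 2 ^ a * 2 ^ min a g * (5 * (Φ.m + 1) ^ 2) + 2 ^ a * 2 ^ L * 2 ^ g := by
        simp only [RedParams.slots, guessParams]; ring
    _ ≤ 2 ^ a * 2 ^ min a g * (2 ^ L) ^ 2 + 2 ^ a * 2 ^ L * (2 ^ min a g * 2 ^ L) :=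
        Nat.add_le_add h2 h3
    _ = _ := by ring

/-- An admissible guess has `2 * a + min a g ≤ n + 4`, hence the factor `16`; every quantity needed
is a small multiple of `16 * 2 ^ n * (2 ^ L) ^ 3`, for which the factor `256` in `lim_ge` leaves
room. -/
theorem GuessBd.build (hb : GuessBd Φ p v L F lim) (hok : GuessOk Φ F a g) (hg : g ≤ a + L)
    (hoff : off + 2 * lim + 10 < 2 ^ v) : BuildBd (guessParams Φ L a g) v off lim := by
  have hP := hb.lim_ge
  have hL : 1 ≤ 2 ^ L := Nat.one_le_two_pow
  have hsq : 2 ^ L ≤ (2 ^ L) ^ 2 := by nlinarith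
  have hcu : (2 ^ L) ^ 2 ≤ (2 ^ L) ^ 3 := by nlinarith [sq_nonneg (2 ^ L)]
  have hn : 2 ^ a * 2 ^ min a g ≤ 16 * 2 ^ Φ.n := by
    rw [← pow_add, show 16 * 2 ^ Φ.n = 2 ^ (Φ.n + 4) by ring]
    exact Nat.pow_le_pow_right (by norm_num) (by have := hok.2.1; omega)
  have hna : 2 ^ a ≤ 16 * 2 ^ Φ.n := le_trans (Nat.le_mul_of_pos_right _ (Nat.two_pow_pos _)) hn
  have h1 := guessParams_slots_le (Φ := Φ) hb.Z_ge hg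
  have h2 : 2 ^ a * 2 ^ min a g * (2 ^ L) ^ 2 ≤ 16 * 2 ^ Φ.n * (2 ^ L) ^ 3 := Nat.mul_le_mul hn hcu
  have h3 : 2 ^ a * 2 ^ L ≤ 16 * 2 ^ Φ.n * (2 ^ L) ^ 3 := Nat.mul_le_mul hna (hsq.trans hcu)
  have h4 : 2 ^ a * 1 ≤ 16 * 2 ^ Φ.n * (2 ^ L) ^ 3 := Nat.mul_le_mul hna (by nlinarith)
  have h5 : 1 ≤ 2 ^ Φ.n * (2 ^ L) ^ 3 := Nat.mul_pos (Nat.two_pow_pos _) (by positivity)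
  have h6 : 1 * 2 ^ L ≤ 2 ^ Φ.n * (2 ^ L) ^ 3 := Nat.mul_le_mul Nat.one_le_two_pow (hsq.trans hcu)
  have hm := hb.m_le
  have hlv := hb.lim_le
  have e : 256 * 2 ^ Φ.n * (2 ^ L) ^ 3 = 256 * (2 ^ Φ.n * (2 ^ L) ^ 3) := by ring
  have e' : 16 * 2 ^ Φ.n * (2 ^ L) ^ 3 = 16 * (2 ^ Φ.n * (2 ^ L) ^ 3) := by ring
  rw [e] at hP
  rw [e'] at h2 h3 h4
  generalize 2 ^ Φ.n * (2 ^ L) ^ 3 = X at *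
  refine ⟨hb.v_pos, ?_, by omega, by omega, ?_, ?_, ?_⟩
  · change 8 * (2 ^ a * 2 ^ L) < lim; omega
  · change Φ.m + 1 < 2 ^ v; omega
  · change 2 * 2 ^ a < 2 ^ v; omega
  · change 2 ^ a * 2 ^ L < 2 ^ v; omega

/-- One window holds both the encoded graph and the rows of the output table that are read, namely
those of the sources. -/
theorem GuessBd.window (hb : GuessBd Φ p v L F lim) (hok : GuessOk Φ F a g) (hg : g ≤ a + L) :
    2 * (guessParams Φ L a g).slots + 2 ≤ lim ∧ 2 ^ a * (8 * (2 ^ a * 2 ^ L)) ≤ lim := by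
  have hP := hb.lim_ge
  have hL : 1 ≤ 2 ^ L := Nat.one_le_two_pow
  have hsq : 2 ^ L ≤ (2 ^ L) ^ 2 := by nlinarith
  have hcu : (2 ^ L) ^ 2 ≤ (2 ^ L) ^ 3 := by nlinarith [sq_nonneg (2 ^ L)]
  have hn : 2 ^ a * 2 ^ min a g ≤ 16 * 2 ^ Φ.n := by
    rw [← pow_add, show 16 * 2 ^ Φ.n = 2 ^ (Φ.n + 4) by ring]
    exact Nat.pow_le_pow_right (by norm_num) (by have := hok.2.1; omega)
  have hn' : 2 ^ a * 2 ^ a ≤ 16 * 2 ^ Φ.n := by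
    rw [← pow_add, show 16 * 2 ^ Φ.n = 2 ^ (Φ.n + 4) by ring]
    exact Nat.pow_le_pow_right (by norm_num) (by have := hok.2.1; omega)
  have h1 := guessParams_slots_le (Φ := Φ) hb.Z_ge hg
  have h2 : 2 ^ a * 2 ^ min a g * (2 ^ L) ^ 2 ≤ 16 * 2 ^ Φ.n * (2 ^ L) ^ 3 := Nat.mul_le_mul hn hcu
  have h3 : 2 ^ a * 2 ^ a * 2 ^ L ≤ 16 * 2 ^ Φ.n * (2 ^ L) ^ 3 :=
    Nat.mul_le_mul hn' (hsq.trans hcu)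
  have h5 : 1 ≤ 2 ^ Φ.n * (2 ^ L) ^ 3 := Nat.mul_pos (Nat.two_pow_pos _) (by positivity)
  have e : 256 * 2 ^ Φ.n * (2 ^ L) ^ 3 = 256 * (2 ^ Φ.n * (2 ^ L) ^ 3) := by ring
  have e' : 16 * 2 ^ Φ.n * (2 ^ L) ^ 3 = 16 * (2 ^ Φ.n * (2 ^ L) ^ 3) := by ring
  rw [e] at hP
  rw [e'] at h2 h3
  generalize 2 ^ Φ.n * (2 ^ L) ^ 3 = X at *
  refine ⟨by omega, ?_⟩
  calc 2 ^ a * (8 * (2 ^ a * 2 ^ L)) = 8 * (2 ^ a * 2 ^ a * 2 ^ L) := by ring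
    _ ≤ lim := by omega

/-- The guess is right: the program `p` computes the flow values within the limits. -/
def GuessRight (Φ : CNFFormula) (p : Prog) (L F lim a g : ℕ) : Prop :=
  ∃ (h : (guessParams Φ L a g).Valid) (B t : ℕ) (σ : State), B ≤ lim ∧ t ≤ F ∧
    Exec B p (init (RedParams.graph h).encode) σ t ∧ (RedParams.graph h).AllPairsMaxFlow (σ.mem 1)

/-- The main part of a guess. -/
def guessBody (p : Prog) : Prog :=
  .seq (assign rGs (.var rGm * .var rs)) (.seq (assign rBl (.var rA * .var rZ))
    (.seq (assign rMp (.var rBl * .load 2 (.var rgg))) (.seq tableProg (.seq buildProg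
      (.seq (zeroRegs p.regBound) (.seq (assign rFuel (.var rF)) (.seq (assign rOne (.lit 1))
        (.seq p.limited (.seq scanProg (assign rOff (.var rOff + .var rLim)))))))))))

/-- Result of a guess: the best value `b` has not increased, stays above the optimum, and is the
optimum if the guess was right. -/
def BestPost (Φ : CNFFormula) (b : ℕ) (right : Prop) (s : State) : Prop :=
  s.reg rBest ≤ b ∧ Φ.minUnsat ≤ s.reg rBest ∧ (right → s.reg rBest = Φ.minUnsat)

/-- Running time of the main part of a guess. -/
def guessTime (Φ : CNFFormula) (p : Prog) (L F a g : ℕ) : ℕ :=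
  4 + (4 + (5 + ((3 * 2 ^ a * (Φ.m * (2 * Φ.n * 80 + 50) + 40) + 10) +
    (((guessParams Φ L a g).slots * 80 + 80) + ((p.regBound + 1) + (2 + (2 +
      (p.limitedCost * (F + 1) + (((Φ.m + 1) * (2 ^ a * 2 ^ a * 50 +
        2 ^ min a g * ((Φ.m + 1) * 60 + 30) + 40) + 5) + 4)))))))))

/-- Clearing the memory between guesses would be too expensive, so each simulation gets a fresh
window that is still zero; only the finitely many registers of `p` are reset. The bounds for the
best value need no property of `p`, and correct flow values enter only if the guess is right. -/
theorem Runs.guessBody {b : ℕ} {s : State} (hb : GuessBd Φ p v L F lim) (hok : GuessOk Φ F a g)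
    (hg : g ≤ a + L) (hoff : off + 2 * lim + 10 < 2 ^ v) (hS : Setup Φ v L F lim s)
    (hW : Window lim p.regBound off s) (hra : s.reg ra = a) (hrg : s.reg rgg = g)
    (hrA : s.reg rA = 2 ^ a) (hrGm : s.reg rGm = 2 ^ min a g) (hbest : s.reg rBest = b)
    (hbm : b ≤ Φ.m) (hμ : Φ.minUnsat ≤ b) (hpg : s.mem 2 g = 2 ^ g) :
    Runs v (guessBody p) s (fun s' => Keep s s' ∧ Window lim p.regBound (off + lim) s' ∧
      BestPost Φ b (GuessRight Φ p L F lim a g) s') (guessTime Φ p L F a g) := by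
  set R := guessParams Φ L a g with hRdef
  have hR : R.Valid := guessParams_valid hb.Z_ge hg
  have hB : BuildBd R v off lim := hb.build hok hg hoff
  have hc := hB.consts
  have hv : 1 ≤ v := by have := hb.v_pos; omega
  have hm : Φ.codes.length = Φ.m := Φ.codes_length
  have hs2 := hB.s_lt
  have hA2 := hB.A_lt
  have hBl2 := hB.Bl_lt
  have hG2 : 2 ^ min a g < 2 ^ v :=
    (Nat.le_mul_of_pos_right _ hR.s_pos).trans_lt (hB.lt hR).1
  have hmv := hb.m_le
  have hlv := hb.lim_le
  have hlim0 : 0 < lim := (Nat.zero_le _).trans_lt (hW.lt 0 0)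
  have hZ2 : 2 ^ L < 2 ^ v :=
    (Nat.le_mul_of_pos_left _ (Nat.two_pow_pos a)).trans_lt (show 2 ^ a * 2 ^ L < 2 ^ v from hBl2)
  have hgp : 2 ^ g < 2 ^ v := by
    have h1 : R.Mp < 2 ^ v := (hB.lt hR).2.2.2.2.1
    exact (Nat.le_mul_of_pos_left _ (by positivity)).trans_lt h1
  have hgv : g < 2 ^ v := (Nat.lt_two_pow_self).trans hgp
  have hav : a < 2 ^ v := by
    have : a < 2 ^ a := Nat.lt_two_pow_self
    have : 2 * 2 ^ a < 2 ^ v := hA2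
    omega
  have hA8 : 8 * 2 ^ a < 2 ^ v :=
    (Nat.mul_le_mul_left 8 (Nat.le_mul_of_pos_right _ (Nat.two_pow_pos L))).trans_lt
      ((show 8 * (2 ^ a * 2 ^ L) < lim from hB.Bl_lim).trans_le hlv)
  have hs : s.reg rs = Φ.m + 1 := by rw [hS.input.rs_eq, hm]
  refine Runs.assign_seq (x := 2 ^ min a g * (Φ.m + 1)) rfl hv ?_ ?_ ?_
  · simp only [Expr.bd_mul, Expr.bd_var, hrGm, hs]; omega
  · simp only [Expr.eval_mul, Expr.eval_var, hrGm, hs]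
  refine Runs.assign_seq (x := 2 ^ a * 2 ^ L) rfl hv ?_ ?_ ?_
  · simp only [Expr.bd_mul, Expr.bd_var, State.reg_setReg]
    norm_num [hrA, hS.Z_eq]; omega
  · simp only [Expr.eval_mul, Expr.eval_var, State.reg_setReg]
    norm_num [hrA, hS.Z_eq]
  refine Runs.assign_seq (x := 2 ^ a * 2 ^ L * 2 ^ g) rfl hv ?_ ?_ ?_
  · change _ ∧ _ ∧ s.mem 2 _ < 2 ^ v
    simp only [Expr.bd_var, Expr.eval_var, State.reg_setReg]
    norm_num [hrg, hpg]
    exact ⟨hBl2, hgv, hgp⟩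
  · change _ * s.mem 2 _ = _
    simp only [Expr.eval_var, State.reg_setReg]
    norm_num [hrg, hpg]
  set s₁ := ((s.setReg rGs (2 ^ min a g * (Φ.m + 1))).setReg rBl (2 ^ a * 2 ^ L)).setReg rMp
    (2 ^ a * 2 ^ L * 2 ^ g) with hs₁
  have hF₁ : Frame [rGs, rBl, rMp] [] s s₁ :=
    (((Frame.refl _ _ _).setReg (by simp) _).setReg (by simp) _).setReg (by simp) _
  have hK₁ : Keep s s₁ := hF₁.keep (by decide) (by simp)
  have hS₁ := hS.keep hK₁
  have hW₁ : Window lim p.regBound off s₁ := hW.frame hF₁ (by decide) (by simp)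
  have htab := Runs.tableProg (a := a) hS₁.input hb.input ((hF₁.reg _ (by decide)).trans hra)
    ((hF₁.reg _ (by decide)).trans hrA) hav (by omega) (by rw [hm]; exact hs2)
  rw [hm] at htab
  refine htab.seq fun s₂ ⟨hF₂, hT₂⟩ => ?_
  have hK₂ : Keep s s₂ := hK₁.trans (hF₂.keep (by decide) (by simp))
  have hS₂ := hS.keep hK₂
  have hW₂ : Window lim p.regBound off s₂ := hW₁.frame hF₂ (by decide) (by simp)
  have hP₂ : ParamsAt R off s₂ := by
    refine ⟨?_, ?_, ?_, ?_, ?_, ?_, hW₂.off_eq, fun row hr i hi => ?_⟩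
    · rw [hS₂.input.rs_eq, hm]; rfl
    · rw [hF₂.reg _ (by decide), hF₁.reg _ (by decide), hrA]; rfl
    · rw [hF₂.reg _ (by decide), hF₁.reg _ (by decide), hrGm]; rfl
    · rw [hF₂.reg _ (by decide), hs₁]; simp [State.reg_setReg, hRdef, guessParams]
    · rw [hF₂.reg _ (by decide), hs₁]; simp [State.reg_setReg, hRdef, guessParams]
    · rw [hF₂.reg _ (by decide), hs₁]; simp [State.reg_setReg, hRdef, guessParams]
    · have hG : 2 ^ min a g ≤ 2 ^ a := Nat.pow_le_pow_right (by norm_num) (min_le_left _ _)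
      have hr' : row < 2 * 2 ^ a + 2 ^ min a g := hr
      have := hT₂ row (by omega) i (by rw [hm]; exact hi)
      rw [hm] at this
      exact this
  refine (Runs.buildProg hR hB hP₂ (hW₂.zero 0) (hW₂.lt 0)).seq fun s₃ ⟨hF₃, hE₃, hlt₃⟩ => ?_
  have hK₃ : Keep s s₃ := hK₂.trans (hF₃.keep (by decide) (by simp))
  have hP₃ := hP₂.emitFrame hF₃
  have hm₃ : ∀ A, A ≠ 0 → s₃.mem (A + 16) = s₂.mem (A + 16) := fun A hA =>
    hF₃.mem _ (by simpa using hA)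
  refine (Runs.zeroRegs p.regBound).seq fun s₄ ⟨z1, z2, z3, z4⟩ => ?_
  have hK₄ : Keep s s₄ := hK₃.trans ⟨fun r hr _ _ => z2 r (by omega), by rw [z1], by rw [z1]⟩
  have hS₄ := hS.keep hK₄
  refine Runs.assign_seq (x := F) rfl hv ?_ ?_ ?_
  · rw [Expr.bd_var, hS₄.F_eq]; exact hb.F_lt
  · rw [Expr.eval_var, hS₄.F_eq]
  refine Runs.assign_seq (x := 1) rfl hv (by rw [Expr.bd_lit]; omega) rfl ?_
  set s₅ := (s₄.setReg rFuel F).setReg rOne 1 with hs₅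
  have hF₅ : Frame [rFuel, rOne] [] s₄ s₅ :=
    ((Frame.refl _ _ _).setReg (by simp) _).setReg (by simp) _
  have hK₅ : Keep s s₅ := hK₄.trans (hF₅.keep (by decide) (by simp))
  have hS₅ := hS.keep hK₅
  have hr₅ : ∀ r, s₅.reg (r + 128) = 0 := fun r => by
    rw [hF₅.reg _ (by simp)]
    rcases lt_or_ge r p.regBound with h | h
    · exact z3 r h
    · rw [z4 r h, hF₃.reg _ (by simp), hW₂.reg r h]
  have hm₅ : s₅.mem = s₃.mem := z1
  have hm₅' : ∀ A i, s₅.mem (A + 16) i < lim := fun A i => by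
    rw [hm₅]
    by_cases hA : A = 0
    · subst hA; exact hlt₃ i
    · rw [hm₃ A hA]; exact hW₂.lt A i
  have hu₅ : ∀ r < 128, r ∉ [rFuel, rOne] → s₅.reg r = s₃.reg r := fun r hr hr' => by
    rw [hF₅.reg r hr', z2 r hr]
  refine (Runs.limited (lim := lim) (off := off) (fuel := F) hv hlv (by omega) hb.F_lt hb.const
    ⟨hS₅.lim_eq, (hu₅ _ (by norm_num) (by decide)).trans hP₃.off_eq, ?_, ?_, fun r => ?_,
      hm₅'⟩).seq fun s₆ h₆ => ?_
  · rw [hs₅]; simp [State.reg_setReg]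
  · rw [hs₅]; simp [State.reg_setReg]
  · rw [hr₅]; exact hlim0
  have hK₆ : Keep s s₆ := hK₅.trans ⟨fun r hr _ _ => h₆.reg r (by omega) (by simp; omega),
    h₆.mem 0 (by norm_num), h₆.mem 2 (by norm_num)⟩
  have hu₆ : ∀ r < 40, s₆.reg r = s₃.reg r := fun r hr => by
    rw [h₆.reg r (by omega) (by simp; omega), hu₅ r (by omega) (by simp; omega)]
  have hP₆ : ParamsAt R off s₆ := by
    refine ⟨?_, ?_, ?_, ?_, ?_, ?_, ?_, fun row hr i hi => ?_⟩
    · rw [hu₆ _ (by norm_num), hP₃.s_eq]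
    · rw [hu₆ _ (by norm_num), hP₃.A_eq]
    · rw [hu₆ _ (by norm_num), hP₃.Gm_eq]
    · rw [hu₆ _ (by norm_num), hP₃.Gs_eq]
    · rw [hu₆ _ (by norm_num), hP₃.Bl_eq]
    · rw [hu₆ _ (by norm_num), hP₃.Mp_eq]
    · rw [hu₆ _ (by norm_num), hP₃.off_eq]
    · rw [h₆.mem 3 (by norm_num), hm₅, hP₃.table row hr i hi]
  have hn3 : Φ.n ≤ 3 * a := by have := hok.1; omega
  have hGle : 2 ^ min a g ≤ 2 ^ a := Nat.pow_le_pow_right (by norm_num) (min_le_left _ _)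
  have hunsat : ∀ α < 2 ^ a, ∀ β < 2 ^ a, ∀ γ < 2 ^ min a g,
      R.unsat α β γ = Φ.numUnsat (CNFFormula.joined Φ.n a α β γ) := fun α hα β hβ γ hγ =>
    CNFFormula.unsat_eq_numUnsat rfl rfl rfl hn3 hα hβ (by omega)
  have hAA : R.A * R.A < 2 ^ v := hok.2.2.trans_lt hb.F_lt
  refine (Runs.scanProg (b := b) (μ := Φ.minUnsat) hR hB hP₆ hAA
    (fun i => (h₆.lt 1 i).trans_le hlv) ?_ (show b < Φ.m + 1 by omega) hμ
    (fun α hα β hβ γ hγ => ?_)).seq fun s₇ ⟨hF₇, c1, c2, c3⟩ => ?_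
  · rw [hu₆ _ (by norm_num), hF₃.reg _ (by decide), hF₂.reg _ (by decide), hF₁.reg _ (by decide),
      hbest]
  · rw [hunsat α hα β hβ γ hγ]; exact Φ.minUnsat_le _
  have hK₇ : Keep s s₇ := hK₆.trans (hF₇.keep (by decide) (by simp))
  have hS₇ := hS.keep hK₇
  have hP₇ := hP₆.frame hF₇ (by decide) (by simp)
  have hm₇ : s₇.mem = s₆.mem := funext fun A => hF₇.mem A (by simp)
  refine Runs.assign' (x := off + lim) rfl hv ?_ ?_ ⟨?_, ⟨?_, fun A i => ?_, fun A i hi => ?_,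
    fun r hr => ?_⟩, ?_, ?_, fun hright => ?_⟩
  · simp only [Expr.bd_add, Expr.bd_var, hP₇.off_eq, hS₇.lim_eq]; omega
  · simp only [Expr.eval_add, Expr.eval_var, hP₇.off_eq, hS₇.lim_eq]
  · refine hK₇.trans ⟨fun r _ h _ => ?_, rfl, rfl⟩
    rw [State.reg_setReg_of_ne h]
  · rw [State.reg_setReg_self]
  · change s₇.mem (A + 16) i < lim
    rw [hm₇]; exact h₆.lt A i
  · change s₇.mem (A + 16) i = 0
    rw [hm₇, h₆.window A i (by omega), hm₅]
    by_cases hA : A = 0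
    · subst hA
      obtain ⟨j, rfl⟩ : ∃ j, i = off + j := ⟨i - off, by omega⟩
      rw [hE₃, List.getD_eq_default]
      have h1 := R.length_allEdges_le
      have h2 := hR.slots_ge
      have h3 : 2 * R.slots + 2 ≤ lim := (hb.window hok hg).1
      simp only [RedParams.graphWords, List.length_cons, length_words]
      omega
    · rw [hm₃ A hA]; exact hW₂.zero A i (by omega)
  · rw [State.reg_setReg_of_ne (show r + 128 ≠ 7 by omega), hF₇.reg _ (by simp),
      h₆.regBound r hr, hr₅]
  · rw [State.reg_setReg_of_ne (by norm_num)]; exact c1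
  · rw [State.reg_setReg_of_ne (by norm_num)]; exact c2
  · rw [State.reg_setReg_of_ne (by norm_num)]
    refine le_antisymm ?_ c2
    obtain ⟨h, B', t, σ, hBl, htF, hex, hflow⟩ := hright
    obtain ⟨x, hx⟩ := Φ.exists_numUnsat_eq
    obtain ⟨α, hα, β, hβ, γ, hγ, rfl⟩ := CNFFormula.exists_joined hok.1 (min_le_left _ _) x
    rw [← hx, ← hunsat α hα β hβ γ hγ]
    refine c3 (fun α hα β hβ q hq => ?_) α hα β hβ γ hγ
    -- Inside the window the state looks like the initial state on the encoded graph: zero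
    -- registers, the graph in simulated array `0`, and nothing in the other arrays.
    have hrep : Represents lim off (init (RedParams.graph h).encode) s₅ := by
      refine ⟨fun r => (hr₅ r).symm, fun A i _ => ?_⟩
      rw [hm₅]
      by_cases hA : A = 0
      · subst hA
        rw [hE₃, RedParams.graph_encode]; rfl
      · rw [hm₃ A hA, hW₂.zero A _ (by omega)]
        simp [init, hA]
    have hrep' := h₆.sim _ _ _ _ hBl hrep hex htF
    have hAB := hR.A_le_Bl
    have hsk := hR.sink_lt hβ hq
    have hcell : α * (8 * R.Bl) + (R.Bl + (β * R.s + q)) < lim := by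
      have h1 : (α + 1) * (8 * R.Bl) ≤ 2 ^ a * (8 * (2 ^ a * 2 ^ L)) := Nat.mul_le_mul_right _ hα
      have h2 := (hb.window hok hg).2
      rw [Nat.succ_mul] at h1
      omega
    have hne : RedParams.node h α ≠ RedParams.node h (R.Bl + (β * R.s + q)) := by
      intro he
      have := congrArg Fin.val he
      rw [RedParams.node_val h (show α < 8 * R.Bl by omega),
        RedParams.node_val h (show R.Bl + (β * R.s + q) < 8 * R.Bl by omega)] at this
      omega
    have hfl := hflow _ _ hne
    rw [RedParams.node_val h (show α < 8 * R.Bl by omega),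
      RedParams.node_val h (show R.Bl + (β * R.s + q) < 8 * R.Bl by omega)] at hfl
    change IsMaxFlowValue _ _ _ ((σ.mem 1 (α * (8 * R.Bl) + (R.Bl + (β * R.s + q))) : ℕ) : ℝ) at hfl
    rw [← hrep'.2 1 _ hcell]
    exact (h.isMaxFlowValue_iff hα hβ hq hfl).2

end Params

end WordRAM

namespace WordRAM

/-! ### All guesses -/

/-- The condition `GuessOk`. -/
def guardExpr : Expr := .lit 1 - ((.var rn - (.lit 2 * .var ra + .var rgm)) +
  ((.lit 2 * .var ra + .var rgm) - (.var rn + .lit 4)) + (.var rA * .var rA - .var rF))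

/-- One guess. -/
def guessProg (p : Prog) : Prog :=
  .seq (assign rgm (.var ra - (.var ra - .var rgg))) (.seq (assign rA (.load 2 (.var ra)))
    (.seq (assign rGm (.load 2 (.var rgm))) (cond guardExpr (guessBody p) .skip)))

section Guess

variable {Φ : CNFFormula} {p : Prog} {v L F lim a g off : ℕ}

/-- The guard is `1` minus a sum of truncated differences, so it is nonzero exactly if all three
inequalities of `GuessOk` hold. Guesses that fail it are skipped, and hence the time bound is only
needed for admissible ones. -/
theorem Runs.guessProg {b T : ℕ} {s : State} (hb : GuessBd Φ p v L F lim)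
    (hT : ∀ a g, a ≤ Φ.n → g ≤ a + L → GuessOk Φ F a g → guessTime Φ p L F a g ≤ T) (hT1 : 1 ≤ T)
    (ha : a ≤ Φ.n) (hg : g ≤ a + L) (hoff : off + 2 * lim + 10 < 2 ^ v) (hS : Setup Φ v L F lim s)
    (hW : Window lim p.regBound off s) (hra : s.reg ra = a) (hrg : s.reg rgg = g)
    (hbest : s.reg rBest = b) (hbm : b ≤ Φ.m) (hμ : Φ.minUnsat ≤ b) :
    Runs v (guessProg p) s (fun s' => Keep s s' ∧
      (∃ off' ≤ off + lim, Window lim p.regBound off' s') ∧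
      BestPost Φ b (GuessOk Φ F a g ∧ GuessRight Φ p L F lim a g) s') (T + 50) := by
  have hv : 1 ≤ v := by have := hb.v_pos; omega
  have h16 : 16 ≤ 2 ^ v := by
    simpa using Nat.pow_le_pow_right (n := 2) (by norm_num) hb.v_pos
  have hnv := hb.input.n_lt
  have hlv := hb.lim_le
  have hLv : L < 2 ^ v := by
    have h1 := hb.lim_ge
    have h2 : L < 2 ^ L := Nat.lt_two_pow_self
    have h3 : 2 ^ L ≤ (2 ^ L) ^ 3 := Nat.le_self_pow (by norm_num) _
    have h4 := Nat.le_mul_of_pos_left ((2 ^ L) ^ 3) (show 0 < 256 * 2 ^ Φ.n by positivity)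
    omega
  have hap : 2 ^ a ≤ 2 ^ Φ.n := Nat.pow_le_pow_right (by norm_num) ha
  have hgp : 2 ^ min a g ≤ 2 ^ a := Nat.pow_le_pow_right (by norm_num) (min_le_left _ _)
  have hpn := hb.input.pow_lt
  have hpa : s.mem 2 a = 2 ^ a := hS.input.pow a ha
  have hpg : s.mem 2 g = 2 ^ g := hS.pow g (by omega)
  have hpm : s.mem 2 (min a g) = 2 ^ min a g := hS.pow _ (by omega)
  have hgv : g < 2 ^ v := by
    have h1 := hb.lim_ge
    have h2 : L < 2 ^ L := Nat.lt_two_pow_self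
    have h3 : 2 ^ L ≤ (2 ^ L) ^ 3 := Nat.le_self_pow (by norm_num) _
    have h4 := Nat.mul_le_mul (show 256 * Φ.n ≤ 256 * 2 ^ Φ.n from
      Nat.mul_le_mul_left _ Nat.lt_two_pow_self.le) (h2.le.trans h3)
    have h5 : 1 ≤ (2 ^ L) ^ 3 := Nat.pos_of_ne_zero (by positivity)
    have h6 : 1 ≤ 2 ^ Φ.n := Nat.one_le_two_pow
    have h7 : Φ.n < 2 ^ Φ.n := Nat.lt_two_pow_self
    have h8 : Φ.n + L < 256 * 2 ^ Φ.n * (2 ^ L) ^ 3 := by nlinarith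
    omega
  refine Runs.le (T := 6 + (3 + (3 + (guardExpr.size + (T + 1))))) ?_
    (by rw [show guardExpr.size = 25 by rfl]; omega)
  refine Runs.assign_seq (x := min a g) rfl hv ?_ ?_ ?_
  · simp only [Expr.bd_sub, Expr.bd_var, hra, hrg]; omega
  · simp only [Expr.eval_sub, Expr.eval_var, hra, hrg]; omega
  refine Runs.assign_seq (x := 2 ^ a) rfl hv ?_ ?_ ?_
  · change s.reg ra < _ ∧ s.mem 2 (s.reg ra) < _
    rw [hra, hpa]; omega
  · change s.mem 2 (s.reg ra) = _
    rw [hra, hpa]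
  refine Runs.assign_seq (x := 2 ^ min a g) rfl hv ?_ ?_ ?_
  · change min a g < _ ∧ s.mem 2 (min a g) < _
    rw [hpm]; omega
  · change s.mem 2 (min a g) = _
    rw [hpm]
  set s₁ := ((s.setReg rgm (min a g)).setReg rA (2 ^ a)).setReg rGm (2 ^ min a g) with hs₁
  have hF₁ : Frame [rgm, rA, rGm] [] s s₁ :=
    (((Frame.refl _ _ _).setReg (by simp) _).setReg (by simp) _).setReg (by simp) _
  have hK₁ : Keep s s₁ := hF₁.keep (by decide) (by simp)
  have hS₁ := hS.keep hK₁
  have hW₁ : Window lim p.regBound off s₁ := hW.frame hF₁ (by decide) (by simp)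
  have e1 : s₁.reg ra = a := (hF₁.reg _ (by decide)).trans hra
  have e2 : s₁.reg rgm = min a g := by simp [hs₁, State.reg_setReg]
  have e3 : s₁.reg rA = 2 ^ a := by simp [hs₁, State.reg_setReg]
  have e4 : s₁.reg rBest = b := (hF₁.reg _ (by decide)).trans hbest
  have he : guardExpr.eval s₁ = 1 - ((Φ.n - (2 * a + min a g)) + (2 * a + min a g - (Φ.n + 4)) +
      (2 ^ a * 2 ^ a - F)) := by
    simp only [guardExpr, Expr.eval_sub, Expr.eval_add, Expr.eval_mul, Expr.eval_lit, Expr.eval_var,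
      e1, e2, e3, hS₁.F_eq, hS₁.input.rn_eq]
  refine Runs.cond rfl hv ?_ (fun h0 => ?_) fun h0 => ?_
  · simp only [guardExpr, Expr.bd_sub, Expr.bd_add, Expr.bd_mul, Expr.bd_lit, Expr.bd_var,
      e1, e2, e3, hS₁.F_eq, hS₁.input.rn_eq]
    have := hb.F_lt
    omega
  · rw [he] at h0
    have hok : GuessOk Φ F a g := ⟨by omega, by omega, by omega⟩
    refine (Runs.guessBody hb hok hg hoff hS₁ hW₁ e1 ((hF₁.reg _ (by decide)).trans hrg) e3
      (by simp [hs₁, State.reg_setReg]) e4 hbm hμ (by rw [hF₁.mem _ (by simp)]; exact hpg)).mono ?_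
      (hT a g ha hg hok)
    rintro s' ⟨c1, c2, c3, c4, c5⟩
    exact ⟨hK₁.trans c1, ⟨_, le_rfl, c2⟩, c3, c4, fun h => c5 h.2⟩
  · rw [he] at h0
    refine (Runs.skip ⟨hK₁, ⟨off, by omega, hW₁⟩, e4.le, e4 ▸ hμ, ?_⟩).le (by omega)
    rintro ⟨⟨h1, h2, h3⟩, -⟩
    omega

theorem Setup.frame {R M : List ℕ} {s s' : State} (h : Setup Φ v L F lim s) (hf : Frame R M s s')
    (hR : ∀ r ∈ R, 7 ≤ r) (hM : 0 ∉ M ∧ 2 ∉ M) : Setup Φ v L F lim s' := by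
  have e : ∀ r < 7, s'.reg r = s.reg r := fun r hr => hf.reg r fun hr' => by
    have := hR r hr'; omega
  exact ⟨⟨(e _ (by norm_num)).trans h.input.rn_eq, (e _ (by norm_num)).trans h.input.rm_eq,
    (e _ (by norm_num)).trans h.input.rs_eq, fun i => by rw [hf.mem _ hM.1, h.input.mem0],
    fun i hi => by rw [hf.mem _ hM.2, h.input.pow i hi]⟩,
    fun i hi => by rw [hf.mem _ hM.2, h.pow i hi],
    (e _ (by norm_num)).trans h.Z_eq, (e _ (by norm_num)).trans h.L_eq,
    (e _ (by norm_num)).trans h.F_eq, (e _ (by norm_num)).trans h.lim_eq⟩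

/-- Invariant of the loops over all guesses, after at most `k` guesses; `right` says that one of
them was right. -/
structure GuessInv (Φ : CNFFormula) (p : Prog) (v L F lim k : ℕ) (right : Prop) (s : State) :
    Prop where
  setup : Setup Φ v L F lim s
  window : ∃ off ≤ k * lim, Window lim p.regBound off s
  best : BestPost Φ Φ.m right s

theorem GuessInv.setReg {k : ℕ} {right : Prop} {s : State} (h : GuessInv Φ p v L F lim k right s)
    {i c : ℕ} (x y : ℕ) (hi : 9 ≤ i ∧ i < 128) (hc : 9 ≤ c ∧ c < 128) :
    GuessInv Φ p v L F lim k right ((s.setReg i x).setReg c y) := by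
  have hf : Frame [i, c] [] s ((s.setReg i x).setReg c y) :=
    ((Frame.refl _ _ _).setReg (by simp) _).setReg (by simp) _
  obtain ⟨off, h1, h2⟩ := h.window
  refine ⟨h.setup.frame hf (by simp; omega) (by simp), ⟨off, h1, h2.frame hf (by simp; omega) (by simp)⟩, ?_⟩
  have : ((s.setReg i x).setReg c y).reg rBest = s.reg rBest := hf.reg _ (by simp; omega)
  rw [BestPost, this]
  exact h.best

theorem GuessInv.mono {k k' : ℕ} {right right' : Prop} {s : State}
    (h : GuessInv Φ p v L F lim k right s) (hk : k ≤ k') (hr : right' → right) :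
    GuessInv Φ p v L F lim k' right' s := by
  obtain ⟨off, h1, h2⟩ := h.window
  exact ⟨h.setup, ⟨off, h1.trans (Nat.mul_le_mul_right _ hk), h2⟩, h.best.1, h.best.2.1,
    fun h' => h.best.2.2 (hr h')⟩

/-- All guesses. -/
def searchProg (p : Prog) : Prog := forLoop ra 10 (.var rn + .lit 1)
  (forLoop rgg 12 (.var ra + .var rL + .lit 1) (guessProg p))

/-- There are at most `(n + 1) * (n + L + 1)` guesses and each consumes at most one window of length
`lim`, whence `hroom`. The best value is nonincreasing and never below the optimum, so a single
right guess settles it. -/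
theorem Runs.searchProg {T : ℕ} {s : State} (hb : GuessBd Φ p v L F lim)
    (hT : ∀ a g, a ≤ Φ.n → g ≤ a + L → GuessOk Φ F a g → guessTime Φ p L F a g ≤ T) (hT1 : 1 ≤ T)
    (hroom : ((Φ.n + 1) * (Φ.n + L + 1) + 2) * lim + 10 < 2 ^ v)
    (h0 : GuessInv Φ p v L F lim 0 False s) :
    Runs v (searchProg p) s (fun s' => GuessInv Φ p v L F lim ((Φ.n + 1) * (Φ.n + L + 1))
      (∃ a ≤ Φ.n, ∃ g ≤ a + L, GuessOk Φ F a g ∧ GuessRight Φ p L F lim a g) s')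
      ((Φ.n + 1) * ((Φ.n + L + 1) * (T + 59) + 19) + 9) := by
  have hv : 1 ≤ v := by have := hb.v_pos; omega
  have h1v : 1 < 2 ^ v := Nat.one_lt_two_pow (by omega)
  have hnv := hb.input.n_lt
  have hlim0 : 0 < lim := by
    obtain ⟨off, -, hW⟩ := h0.window
    exact (Nat.zero_le _).trans_lt (hW.lt 0 0)
  have hnL : Φ.n + L + 1 < 2 ^ v := by
    have h1 : 1 * (Φ.n + L + 1) ≤ (Φ.n + 1) * (Φ.n + L + 1) := Nat.mul_le_mul_right _ (by omega)
    have h2 := Nat.le_mul_of_pos_right ((Φ.n + 1) * (Φ.n + L + 1) + 2) hlim0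
    omega
  refine (Runs.forLoop (v := v) (N := Φ.n + 1) (T := (Φ.n + L + 1) * (T + 59) + 10)
    (fun k s' => GuessInv Φ p v L F lim (k * (Φ.n + L + 1))
      (∃ a < k, ∃ g ≤ a + L, GuessOk Φ F a g ∧ GuessRight Φ p L F lim a g) s')
    (by norm_num) (by norm_num) (by norm_num) hv rfl ?_ ?_ (by omega) ?_ ?_ ?_ ?_).le ?_
  · simp only [Expr.bd_add, Expr.bd_var, Expr.bd_lit, h0.setup.input.rn_eq]; omega
  · simp only [Expr.eval_add, Expr.eval_var, Expr.eval_lit, h0.setup.input.rn_eq]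
  · intro k s' x y h
    exact h.setReg x y (by norm_num) (by norm_num)
  · refine h0.mono (by simp) ?_
    rintro ⟨a, ha, -⟩
    omega
  · intro a ha s₁ h₁ hra
    refine (Runs.forLoop (v := v) (N := a + L + 1) (T := T + 50)
      (fun k s' => (s'.reg ra = a ∧ s'.reg 10 = s₁.reg 10) ∧
        GuessInv Φ p v L F lim (a * (Φ.n + L + 1) + k)
        ((∃ a' < a, ∃ g ≤ a' + L, GuessOk Φ F a' g ∧ GuessRight Φ p L F lim a' g) ∨
          ∃ g < k, GuessOk Φ F a g ∧ GuessRight Φ p L F lim a g) s')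
      (by norm_num) (by norm_num) (by norm_num) hv rfl ?_ ?_ (by omega) ?_ ?_ ?_ ?_).le ?_
    · simp only [Expr.bd_add, Expr.bd_var, Expr.bd_lit, hra, h₁.setup.L_eq]; omega
    · simp only [Expr.eval_add, Expr.eval_var, Expr.eval_lit, hra, h₁.setup.L_eq]
    · rintro k s' x y ⟨⟨h1, h2⟩, h3⟩
      refine ⟨⟨?_, ?_⟩, h3.setReg x y (by norm_num) (by norm_num)⟩
      · simpa [State.reg_setReg] using h1
      · simpa [State.reg_setReg] using h2
    · refine ⟨⟨hra, rfl⟩, h₁.mono (by omega) ?_⟩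
      rintro (h | ⟨g, hg, -⟩)
      · exact h
      · omega
    · rintro g hg s₂ ⟨⟨h1, h2⟩, h3⟩ hrg
      obtain ⟨off, ho, hW⟩ := h3.window
      obtain ⟨b1, b2, b3⟩ := h3.best
      have hidx : a * (Φ.n + L + 1) + g ≤ (Φ.n + 1) * (Φ.n + L + 1) := by
        calc a * (Φ.n + L + 1) + g ≤ a * (Φ.n + L + 1) + (Φ.n + L + 1) := by omega
          _ = (a + 1) * (Φ.n + L + 1) := by ring
          _ ≤ _ := Nat.mul_le_mul_right _ (by omega)
      have hoff : off + 2 * lim + 10 < 2 ^ v := by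
        have := Nat.mul_le_mul_right lim hidx
        rw [Nat.add_mul] at hroom
        omega
      refine (Runs.guessProg hb hT hT1 (by omega) (by omega) hoff h3.setup hW h1 hrg rfl b1 b2).mono
        ?_ le_rfl
      rintro s₃ ⟨k1, ⟨off', ho', hW'⟩, k2, k3, k4⟩
      refine ⟨(k1.reg _ (by norm_num) (by norm_num) (by norm_num)).trans hrg,
        k1.reg _ (by norm_num) (by norm_num) (by norm_num),
        ⟨(k1.reg _ (by norm_num) (by norm_num) (by norm_num)).trans h1,
        (k1.reg _ (by norm_num) (by norm_num) (by norm_num)).trans h2⟩,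
        h3.setup.keep k1, ⟨off', ?_, hW'⟩, k2.trans b1, k3, ?_⟩
      · rw [← add_assoc, Nat.succ_mul]; omega
      · rintro (h | ⟨g', hg', h⟩)
        · have := b3 (.inl h); omega
        · rcases Nat.lt_succ_iff_lt_or_eq.1 hg' with h' | rfl
          · have := b3 (.inr ⟨g', h', h⟩); omega
          · exact k4 h
    · rintro s₃ ⟨⟨h1, h2⟩, h3⟩
      refine ⟨h1, h2, h3.mono ?_ ?_⟩
      · rw [Nat.succ_mul]; omega
      · rintro ⟨a', ha', g, hg, h⟩
        rcases Nat.lt_succ_iff_lt_or_eq.1 ha' with h' | rfl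
        · exact .inl ⟨a', h', g, hg, h⟩
        · exact .inr ⟨g, by omega, h⟩
    · rw [show (Expr.var ra + Expr.var rL + Expr.lit 1).size = 5 from rfl]
      have := Nat.mul_le_mul_right (T + 59) (show a + L + 1 ≤ Φ.n + L + 1 by omega)
      rw [show T + 50 + 9 = T + 59 by omega]
      omega
  · intro s' h
    refine h.mono le_rfl ?_
    rintro ⟨a, ha, h⟩
    exact ⟨a, by omega, h⟩
  · rw [show (Expr.var rn + Expr.lit 1).size = 3 from rfl,
      show (Φ.n + L + 1) * (T + 59) + 10 + 9 = (Φ.n + L + 1) * (T + 59) + 19 by omega]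
    omega

end Guess

end WordRAM

/-! ### The whole program -/

namespace CNFFormula

/-- Exponent of a power of two that is about `5 * (m + 1) ^ 2`. -/
def zExp (Φ : CNFFormula) : ℕ := Nat.clog 2 (5 * (Φ.m + 1) ^ 2)

theorem le_two_pow_zExp (Φ : CNFFormula) : 5 * (Φ.m + 1) ^ 2 ≤ 2 ^ Φ.zExp :=
  Nat.le_pow_clog (by norm_num) _

theorem two_pow_zExp_le (Φ : CNFFormula) : 2 ^ Φ.zExp ≤ 10 * (Φ.m + 1) ^ 2 := by
  have h1 : 1 < 5 * (Φ.m + 1) ^ 2 := by nlinarith [Nat.zero_le Φ.m]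
  have h := Nat.pow_pred_clog_lt_self (b := 2) (by norm_num) h1
  have h2 : 0 < Φ.zExp := Nat.clog_pos (by norm_num) h1
  rw [← zExp] at h
  obtain ⟨k, hk⟩ : ∃ k, Φ.zExp = k + 1 := ⟨Φ.zExp - 1, by omega⟩
  rw [hk] at h ⊢
  rw [Nat.pred_eq_sub_one, Nat.add_sub_cancel] at h
  rw [pow_succ]; omega

end CNFFormula

namespace WordRAM

notation "rT" => (35 : ℕ)
notation "rX" => (36 : ℕ)

/-- Fuel of a guess. -/
def fuelOf (r C : ℕ) (Φ : CNFFormula) : ℕ :=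
  2 ^ (Φ.n - Φ.n / r) * (2 ^ Φ.zExp) ^ 3 * (256 * C)

/-- Limit for the values in the simulation. -/
def limOf (C κ : ℕ) (Φ : CNFFormula) : ℕ :=
  (C + 2) * (11 * (256 * 2 ^ Φ.n * (2 ^ Φ.zExp) ^ 3)) ^ (κ + 2)

/-- Find a power of two above `5 * (m + 1) ^ 2`. -/
def zLoop : Prog := forLoop rk rck (.lit 5 * (.var rs * .var rs))
  (cond (.lit 5 * (.var rs * .var rs) - .var rZ)
    (.seq (assign rZ (.lit 2 * .var rZ)) (assign rL (.var rL + .lit 1))) .skip)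

/-- Tabulate the powers of two. -/
def powLoop : Prog := forLoop rk rck (.var rn + .var rL + .lit 1)
  (.seq (put 2 (.var rk) (.var rT)) (assign rT (.lit 2 * .var rT)))

/-- Multiply `rLim` by a power of `rX`. -/
def limLoop (κ : ℕ) : Prog := forLoop rk rck (.lit (κ + 2)) (assign rLim (.var rLim * .var rX))

/-- Preparations. -/
def preProg (r C κ : ℕ) : Prog :=
  .seq (assign rn (.load 0 (.lit 0))) (.seq (assign rm (.load 0 (.lit 1)))
    (.seq (assign rs (.var rm + .lit 1)) (.seq (assign rZ (.lit 1)) (.seq zLoop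
      (.seq (assign rT (.lit 1)) (.seq powLoop
        (.seq (assign rF (.load 2 (.var rn - .var rn / .lit r) * (.var rZ * .var rZ * .var rZ) *
          .lit (256 * C)))
        (.seq (assign rX (.lit 11 * (.lit 256 * .load 2 (.var rn) * (.var rZ * .var rZ * .var rZ))))
          (.seq (assign rLim (.lit (C + 2))) (.seq (limLoop κ) (assign rBest (.var rm))))))))))))

section Pre

variable {Φ : CNFFormula} {v : ℕ} {s : State}

/-- The exponent is below `5 * (m + 1) ^ 2`, so this many rounds are enough; rounds after the target
has been reached do nothing. -/
theorem Runs.zLoop {N : ℕ} (hv : 3 ≤ v) (hs : s.reg rs = Φ.m + 1) (hN : N = 5 * (Φ.m + 1) ^ 2)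
    (hZ : s.reg rZ = 1) (hL : s.reg rL = 0) (hZv : 2 * 2 ^ Φ.zExp < 2 ^ v) :
    Runs v zLoop s (fun s' => Frame [rk, rck, rZ, rL] [] s s' ∧ s'.reg rZ = 2 ^ Φ.zExp ∧
      s'.reg rL = Φ.zExp) (N * 30 + 9) := by
  have h8 : 8 ≤ 2 ^ v := by simpa using Nat.pow_le_pow_right (n := 2) (by norm_num) hv
  have hle := Φ.le_two_pow_zExp
  have hsq : Φ.m + 1 ≤ (Φ.m + 1) ^ 2 := Nat.le_self_pow (by norm_num) _
  have hLlt : Φ.zExp < 2 ^ Φ.zExp := Nat.lt_two_pow_self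
  have hclog : ∀ l, l < Φ.zExp ↔ 2 ^ l < 5 * (Φ.m + 1) ^ 2 := fun l => by
    rw [CNFFormula.zExp, Nat.lt_clog_iff_pow_lt (by norm_num)]
  have hle' : Φ.zExp ≤ N := by
    by_contra! h
    rw [hclog, hN] at h
    exact absurd h (not_lt.2 Nat.lt_two_pow_self.le)
  refine (Runs.forLoop (v := v) (N := N) (T := 18) (fun k s' => Frame [rk, rck, rZ, rL] [] s s' ∧
    s'.reg rZ = 2 ^ min k Φ.zExp ∧ s'.reg rL = min k Φ.zExp)
    (by norm_num) (by norm_num) (by norm_num) (by omega) rfl ?_ ?_ (by omega) ?_ ?_ ?_ ?_).le ?_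
  · simp only [Expr.bd_mul, Expr.bd_lit, Expr.bd_var, hs]; omega
  · simp only [Expr.eval_mul, Expr.eval_lit, Expr.eval_var, hs, hN]; ring
  · rintro k s' x y ⟨h1, h2, h3⟩
    exact ⟨(h1.setReg (by simp) _).setReg (by simp) _, by simpa [State.reg_setReg] using h2,
      by simpa [State.reg_setReg] using h3⟩
  · exact ⟨.refl _ _ _, by simpa using hZ, by simpa using hL⟩
  · rintro k hk s' ⟨hF, h2, h3⟩ hsk
    have e1 : s'.reg rs = Φ.m + 1 := (hF.reg _ (by simp)).trans hs
    have hmp : 2 ^ min k Φ.zExp ≤ 2 ^ Φ.zExp := Nat.pow_le_pow_right (by norm_num) (min_le_right _ _)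
    have he : (Expr.lit 5 * (Expr.var rs * Expr.var rs) - Expr.var rZ).eval s' =
        5 * (Φ.m + 1) ^ 2 - 2 ^ min k Φ.zExp := by
      simp only [Expr.eval_sub, Expr.eval_mul, Expr.eval_lit, Expr.eval_var, e1, h2, pow_two]
    refine Runs.le (Runs.cond (T := 8) rfl (by omega) ?_ (fun h0 => ?_) fun h0 => ?_) (by decide)
    · simp only [Expr.bd_sub, Expr.bd_mul, Expr.bd_lit, Expr.bd_var, e1, h2]; omega
    · rw [he] at h0
      have hlt := (hclog (min k Φ.zExp)).2 (by omega)
      have hmin : min k Φ.zExp = k := by omega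
      have hmin' : min (k + 1) Φ.zExp = k + 1 := by omega
      rw [hmin] at h2 h3 hmp
      refine Runs.assign_seq (T := 4) (x := 2 ^ (k + 1)) rfl (by omega) ?_ ?_ ?_
      · simp only [Expr.bd_mul, Expr.bd_lit, Expr.bd_var, h2]; omega
      · simp only [Expr.eval_mul, Expr.eval_lit, Expr.eval_var, h2]; ring
      refine Runs.assign' (x := k + 1) rfl (by omega) ?_ ?_ ⟨?_, ?_, ?_, ?_, ?_⟩
      · simp only [Expr.bd_add, Expr.bd_lit, Expr.bd_var, State.reg_setReg]
        norm_num [h3]; omega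
      · simp [State.reg_setReg, h3]
      · simpa [State.reg_setReg] using hsk
      · simp [State.reg_setReg]
      · exact (hF.setReg (by simp) _).setReg (by simp) _
      · simp [State.reg_setReg, hmin']
      · simp [State.reg_setReg, hmin']
    · rw [he] at h0
      have hge := (hclog (min k Φ.zExp)).not.2 (by omega)
      have hmin : min (k + 1) Φ.zExp = min k Φ.zExp := by omega
      exact (Runs.skip ⟨hsk, rfl, hF, by rw [h2, hmin], by rw [h3, hmin]⟩).le (by norm_num)
  · rintro s' ⟨h1, h2, h3⟩
    rw [min_eq_right hle'] at h2 h3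
    exact ⟨h1, h2, h3⟩
  · rw [show (Expr.lit 5 * (Expr.var rs * Expr.var rs)).size = 5 from rfl]; omega

/-- The machine has no shifts, so the powers of two are tabulated once; bit extraction and the
parameters of a guess read them from array `2`. -/
theorem Runs.powLoop {n L : ℕ} (hv : 3 ≤ v) (hn : s.reg rn = n) (hL : s.reg rL = L)
    (hT : s.reg rT = 1) (hp : 2 ^ (n + L + 1) < 2 ^ v) :
    Runs v powLoop s (fun s' => Frame [rk, rck, rT] [2] s s' ∧ ∀ i ≤ n + L, s'.mem 2 i = 2 ^ i)
      ((n + L + 1) * 20 + 9) := by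
  have h8 : 8 ≤ 2 ^ v := by simpa using Nat.pow_le_pow_right (n := 2) (by norm_num) hv
  have hlt : n + L + 1 < 2 ^ (n + L + 1) := Nat.lt_two_pow_self
  refine (Runs.forLoop (v := v) (N := n + L + 1) (T := 7) (fun k s' =>
    Frame [rk, rck, rT] [2] s s' ∧ s'.reg rT = 2 ^ k ∧ ∀ i < k, s'.mem 2 i = 2 ^ i)
    (by norm_num) (by norm_num) (by norm_num) (by omega) rfl ?_ ?_ (by omega) ?_ ?_ ?_ ?_).le ?_
  · simp only [Expr.bd_add, Expr.bd_lit, Expr.bd_var, hn, hL]; omega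
  · simp only [Expr.eval_add, Expr.eval_lit, Expr.eval_var, hn, hL]
  · rintro k s' x y ⟨h1, h2, h3⟩
    exact ⟨(h1.setReg (by simp) _).setReg (by simp) _, by simpa [State.reg_setReg] using h2, h3⟩
  · exact ⟨.refl _ _ _, by simpa using hT, fun i hi => absurd hi (by omega)⟩
  · rintro k hk s' ⟨hF, h2, h3⟩ hsk
    have hkp : 2 ^ k < 2 ^ v :=
      (Nat.pow_le_pow_right (by norm_num) hk.le).trans_lt hp
    refine Runs.put_seq (T := 4) (j := k) (x := 2 ^ k) rfl rfl (by omega) ?_ ?_ hsk h2 ?_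
    · rw [Expr.bd_var, hsk]; omega
    · rw [Expr.bd_var, h2]; exact hkp
    refine Runs.assign' (x := 2 ^ (k + 1)) rfl (by omega) ?_ ?_ ⟨?_, ?_, ?_, ?_, fun i hi => ?_⟩
    · change 2 < _ ∧ s'.reg rT < _
      rw [h2]; omega
    · change 2 * s'.reg rT = _
      rw [h2]; ring
    · rw [State.reg_setReg_of_ne (by norm_num)]; exact hsk
    · rw [State.reg_setReg_of_ne (by norm_num)]; rfl
    · exact (hF.setMem (by simp) _ _).setReg (by simp) _
    · rw [State.reg_setReg_self]
    · change (s'.setMem 2 k (2 ^ k)).mem 2 i = _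
      rw [State.mem_setMem]
      split_ifs with h
      · rw [h.2]
      · exact h3 i (by omega)
  · rintro s' ⟨h1, h2, h3⟩
    exact ⟨h1, fun i hi => h3 i (by omega)⟩
  · rw [show (Expr.var rn + Expr.var rL + Expr.lit 1).size = 5 from rfl]; omega

theorem Runs.limLoop {κ c X : ℕ} (hv : 1 ≤ v) (hlim : s.reg rLim = c) (hX : s.reg rX = X)
    (hc : 1 ≤ c) (hX2 : 2 ≤ X) (hb : c * X ^ (κ + 2) < 2 ^ v) :
    Runs v (limLoop κ) s (fun s' => Frame [rk, rck, rLim] [] s s' ∧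
      s'.reg rLim = c * X ^ (κ + 2)) ((κ + 2) * 15 + 9) := by
  have hpow : ∀ k ≤ κ + 2, c * X ^ k < 2 ^ v := fun k hk =>
    (Nat.mul_le_mul_left _ (Nat.pow_le_pow_right (by omega) hk)).trans_lt hb
  have hκ : κ + 2 < 2 ^ v := by
    have h1 : κ + 2 < X ^ (κ + 2) := Nat.lt_pow_self (by omega)
    have h2 := Nat.le_mul_of_pos_left (X ^ (κ + 2)) hc
    omega
  have hXv : X < 2 ^ v := by
    have h1 := hpow 1 (by omega)
    rw [pow_one] at h1
    exact (Nat.le_mul_of_pos_left _ hc).trans_lt h1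
  refine (Runs.forLoop (v := v) (N := κ + 2) (T := 4) (fun k s' => Frame [rk, rck, rLim] [] s s' ∧
    s'.reg rLim = c * X ^ k)
    (by norm_num) (by norm_num) (by norm_num) hv rfl (by rw [Expr.bd_lit]; omega) rfl hκ
    ?_ ?_ ?_ (fun _ h => h)).le ?_
  · rintro k s' x y ⟨h1, h2⟩
    exact ⟨(h1.setReg (by simp) _).setReg (by simp) _, by simpa [State.reg_setReg] using h2⟩
  · exact ⟨.refl _ _ _, by simpa using hlim⟩
  · rintro k hk s' ⟨hF, h2⟩ hsk
    have e1 : s'.reg rX = X := (hF.reg _ (by simp)).trans hX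
    refine Runs.assign' (x := c * X ^ (k + 1)) rfl hv ?_ ?_ ⟨?_, ?_, hF.setReg (by simp) _, ?_⟩
    · simp only [Expr.bd_mul, Expr.bd_var, h2, e1]
      exact ⟨hpow k hk.le, hXv⟩
    · simp only [Expr.eval_mul, Expr.eval_var, h2, e1]; ring
    · rw [State.reg_setReg_of_ne (by norm_num)]; exact hsk
    · rw [State.reg_setReg_of_ne (by norm_num)]
    · rw [State.reg_setReg_self]
  · rw [show (Expr.lit (κ + 2)).size = 1 from rfl]; omega

end Pre

end WordRAM

/-! ### The whole program: limits, preparation and output. -/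

namespace WordRAM

/-- Bounds for the whole program. -/
structure MainBd (Φ : CNFFormula) (p : Prog) (r C κ v : ℕ) : Prop where
  v_pos : 4 ≤ v
  enc : Φ.encode.length + 1 < 2 ^ v
  const : p.constBound ≤ 2 ^ v
  r_lt : r < 2 ^ v
  room : ((Φ.n + 1) * (Φ.n + Φ.zExp + 1) + 2) * limOf C κ Φ + 10 < 2 ^ v

section Main

variable {Φ : CNFFormula} {p : Prog} {r C κ v : ℕ}

theorem limOf_ge (Φ : CNFFormula) (C κ : ℕ) :
    (C + 2) * (11 * (256 * 2 ^ Φ.n * (2 ^ Φ.zExp) ^ 3)) ≤ limOf C κ Φ :=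
  Nat.mul_le_mul_left _ (Nat.le_self_pow (by omega) _)

theorem MainBd.lim_lt (hb : MainBd Φ p r C κ v) : limOf C κ Φ < 2 ^ v := by
  have h1 := hb.room
  have h2 := Nat.le_mul_of_pos_left (limOf C κ Φ)
    (show 0 < (Φ.n + 1) * (Φ.n + Φ.zExp + 1) + 2 by omega)
  omega

theorem encode_eq_clauseWords (Φ : CNFFormula) :
    Φ.encode = Φ.n :: Φ.m :: clauseWords Φ.codes := Φ.encode_eq

theorem MainBd.inputBd (hb : MainBd Φ p r C κ v) : InputBd v Φ.n Φ.codes := by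
  have h1 := limOf_ge Φ C κ
  have h2 := hb.lim_lt
  have h3 := hb.enc
  have h4 : 1 ≤ (2 ^ Φ.zExp) ^ 3 := Nat.pos_of_ne_zero (by positivity)
  have h5 := Nat.le_mul_of_pos_right (256 * 2 ^ Φ.n) h4
  have h6 := Nat.le_mul_of_pos_left (11 * (256 * 2 ^ Φ.n * (2 ^ Φ.zExp) ^ 3))
    (show 0 < C + 2 by omega)
  have h7 : Φ.n < 2 ^ Φ.n := Nat.lt_two_pow_self
  rw [encode_eq_clauseWords, List.length_cons, List.length_cons] at h3
  refine ⟨by have := hb.v_pos; omega, fun c hc => Φ.clause_length_le hc,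
    fun c hc l hl => Φ.lit_lt hc hl, by omega, by omega, by omega⟩

theorem fuelOf_le (Φ : CNFFormula) (r C κ : ℕ) : fuelOf r C Φ ≤ limOf C κ Φ := by
  refine le_trans ?_ (limOf_ge Φ C κ)
  have h1 : 2 ^ (Φ.n - Φ.n / r) ≤ 2 ^ Φ.n := Nat.pow_le_pow_right (by norm_num) (Nat.sub_le _ _)
  calc fuelOf r C Φ = C * (256 * 2 ^ (Φ.n - Φ.n / r) * (2 ^ Φ.zExp) ^ 3) := by
        rw [fuelOf]; ring
    _ ≤ (C + 2) * (256 * 2 ^ Φ.n * (2 ^ Φ.zExp) ^ 3) := by gcongr; omega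
    _ ≤ _ := Nat.mul_le_mul_left _ (by omega)

theorem MainBd.guessBd (hb : MainBd Φ p r C κ v) :
    GuessBd Φ p v Φ.zExp (fuelOf r C Φ) (limOf C κ Φ) := by
  refine ⟨hb.v_pos, hb.inputBd, Φ.le_two_pow_zExp, le_trans ?_ (limOf_ge Φ C κ), hb.lim_lt.le,
    (fuelOf_le Φ r C κ).trans_lt hb.lim_lt, hb.const⟩
  nlinarith [Nat.zero_le (256 * 2 ^ Φ.n * (2 ^ Φ.zExp) ^ 3), Nat.zero_le C]

theorem Runs.preProg (hb : MainBd Φ p r C κ v) (hC : 1 ≤ C) :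
    Runs v (preProg r C κ) (init Φ.encode)
      (GuessInv Φ p v Φ.zExp (fuelOf r C Φ) (limOf C κ Φ) 0 False)
      (5 * (Φ.m + 1) ^ 2 * 30 + (Φ.n + Φ.zExp + 1) * 20 + κ * 15 + 130) := by
  have hG := hb.guessBd
  have hI := hb.inputBd
  have hv : 1 ≤ v := by have := hb.v_pos; omega
  have h16 : 16 ≤ 2 ^ v := by
    simpa using Nat.pow_le_pow_right (n := 2) (by norm_num) hb.v_pos
  have hlt := hb.lim_lt
  have hge := limOf_ge Φ C κ
  have hm2 := hG.m_le
  have hFl := fuelOf_le Φ r C κ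
  set L := Φ.zExp with hL
  have hZ1 : 1 ≤ 2 ^ L := Nat.one_le_two_pow
  have hN1 : 1 ≤ 2 ^ Φ.n := Nat.one_le_two_pow
  have hnlt : Φ.n < 2 ^ Φ.n := Nat.lt_two_pow_self
  have hZ3 : 2 ^ L ≤ (2 ^ L) ^ 3 := Nat.le_self_pow (by norm_num) _
  have hX : 256 * (2 ^ Φ.n * 2 ^ L) ≤ 256 * 2 ^ Φ.n * (2 ^ L) ^ 3 := by
    rw [← mul_assoc]; exact Nat.mul_le_mul_left _ hZ3
  have hNZ : 2 ^ L ≤ 2 ^ Φ.n * 2 ^ L := Nat.le_mul_of_pos_left _ hN1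
  have hNZ' : 2 ^ Φ.n ≤ 2 ^ Φ.n * 2 ^ L := Nat.le_mul_of_pos_right _ hZ1
  have hCX := Nat.le_mul_of_pos_left (11 * (256 * 2 ^ Φ.n * (2 ^ L) ^ 3)) (show 0 < C + 2 by omega)
  have hXC := Nat.le_mul_of_pos_right (C + 2) (show 0 < 11 * (256 * 2 ^ Φ.n * (2 ^ L) ^ 3) by positivity)
  have hC256 : 256 * C < 2 ^ v := by
    have h1 : (C + 2) * 256 ≤ (C + 2) * (11 * (256 * 2 ^ Φ.n * (2 ^ L) ^ 3)) :=
      Nat.mul_le_mul_left _ (by omega)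
    omega
  have hpow : 2 ^ (Φ.n + L + 1) < 2 ^ v := by
    rw [pow_succ, pow_add]; omega
  have henc := encode_eq_clauseWords Φ
  have i0 : (init Φ.encode).mem 0 0 = Φ.n := by simp [init, henc]
  have i1 : (init Φ.encode).mem 0 1 = Φ.m := by simp [init, henc]
  refine Runs.le (T := 3 + (3 + (4 + (2 + ((5 * (Φ.m + 1) ^ 2 * 30 + 9) + (2 +
    (((Φ.n + L + 1) * 20 + 9) + (15 + (13 + (2 + (((κ + 2) * 15 + 9) + 2))))))))))) ?_ (by omega)
  refine Runs.assign_seq (x := Φ.n) rfl hv ?_ ?_ ?_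
  · change 0 < _ ∧ (init Φ.encode).mem 0 0 < _
    rw [i0]; omega
  · exact i0
  refine Runs.assign_seq (x := Φ.m) rfl hv ?_ ?_ ?_
  · change 1 < _ ∧ (init Φ.encode).mem 0 1 < _
    rw [i1]; omega
  · exact i1
  refine Runs.assign_seq (x := Φ.m + 1) rfl hv ?_ ?_ ?_
  · simp only [Expr.bd_add, Expr.bd_var, Expr.bd_lit, State.reg_setReg]
    norm_num; omega
  · simp [State.reg_setReg]
  refine Runs.assign_seq (x := 1) rfl hv (by rw [Expr.bd_lit]; omega) rfl ?_
  set s₁ := ((((init Φ.encode).setReg rn Φ.n).setReg rm Φ.m).setReg rs (Φ.m + 1)).setReg rZ 1 with hs₁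
  refine (Runs.zLoop (Φ := Φ) (N := 5 * (Φ.m + 1) ^ 2) (by have := hb.v_pos; omega)
    (by simp [hs₁, State.reg_setReg]) rfl (by simp [hs₁, State.reg_setReg])
    (by simp [hs₁, State.reg_setReg, init]) (show 2 * 2 ^ L < 2 ^ v by omega)).seq fun s₂ ⟨F₂, z₂, l₂⟩ => ?_
  have n₂ : s₂.reg rn = Φ.n := by rw [F₂.reg _ (by decide)]; simp [hs₁, State.reg_setReg]
  have m₂ : s₂.reg rm = Φ.m := by rw [F₂.reg _ (by decide)]; simp [hs₁, State.reg_setReg]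
  have k₂ : s₂.reg rs = Φ.m + 1 := by rw [F₂.reg _ (by decide)]; simp [hs₁, State.reg_setReg]
  refine Runs.assign_seq (x := 1) rfl hv (by rw [Expr.bd_lit]; omega) rfl ?_
  have F₃ : Frame [rT] [] s₂ (s₂.setReg rT 1) := (Frame.refl _ _ _).setReg (by simp) _
  refine (Runs.powLoop (n := Φ.n) (L := L) (by have := hb.v_pos; omega)
    ((F₃.reg _ (by decide)).trans n₂) ((F₃.reg _ (by decide)).trans l₂) (State.reg_setReg_self _ _ _)
    hpow).seq fun s₄ ⟨F₄, p₄⟩ => ?_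
  have G₄ : Frame [rk, rck, rT] [2] s₂ s₄ := (F₃.mono (by simp) (by simp)).trans F₄
  have z₄ : s₄.reg rZ = 2 ^ L := (G₄.reg _ (by decide)).trans z₂
  have n₄ : s₄.reg rn = Φ.n := (G₄.reg _ (by decide)).trans n₂
  have q₄ : s₄.mem 2 (Φ.n - Φ.n / r) = 2 ^ (Φ.n - Φ.n / r) :=
    p₄ _ ((Nat.sub_le _ _).trans (Nat.le_add_right _ _))
  have q₄' : s₄.mem 2 Φ.n = 2 ^ Φ.n := p₄ _ (by omega)
  have hnr : 2 ^ (Φ.n - Φ.n / r) ≤ 2 ^ Φ.n := Nat.pow_le_pow_right (by norm_num) (Nat.sub_le _ _)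
  have hr := hb.r_lt
  refine Runs.assign_seq (x := fuelOf r C Φ) rfl hv ?_ ?_ ?_
  · simp only [Expr.bd_mul, Expr.bd_load, Expr.bd_sub, Expr.bd_div, Expr.bd_var, Expr.bd_lit,
      Expr.eval_sub, Expr.eval_div, Expr.eval_var, Expr.eval_lit, z₄, n₄, q₄]
    generalize 2 ^ (Φ.n - Φ.n / r) = y at hnr ⊢
    omega
  · simp only [Expr.eval_mul, Expr.eval_load, Expr.eval_sub, Expr.eval_div, Expr.eval_var,
      Expr.eval_lit, z₄, n₄, q₄, fuelOf, ← hL]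
    ring
  refine Runs.assign_seq (x := 11 * (256 * 2 ^ Φ.n * (2 ^ L) ^ 3)) rfl hv ?_ ?_ ?_
  · change 11 < _ ∧ (256 < _ ∧ s₄.reg rn < _ ∧ s₄.mem 2 (s₄.reg rn) < _) ∧
      (s₄.reg rZ < _ ∧ s₄.reg rZ < _) ∧ s₄.reg rZ < _
    rw [n₄, q₄', z₄]
    omega
  · change 11 * (256 * s₄.mem 2 (s₄.reg rn) * (s₄.reg rZ * s₄.reg rZ * s₄.reg rZ)) = _
    rw [n₄, q₄', z₄]; ring
  refine Runs.assign_seq (x := C + 2) rfl hv (by rw [Expr.bd_lit]; omega) rfl ?_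
  set s₅ := ((s₄.setReg rF (fuelOf r C Φ)).setReg rX (11 * (256 * 2 ^ Φ.n * (2 ^ L) ^ 3))).setReg rLim
    (C + 2) with hs₅
  have F₅ : Frame [rF, rX, rLim] [] s₄ s₅ :=
    (((Frame.refl _ _ _).setReg (by simp) _).setReg (by simp) _).setReg (by simp) _
  refine (Runs.limLoop (κ := κ) (c := C + 2) (X := 11 * (256 * 2 ^ Φ.n * (2 ^ L) ^ 3)) hv
    (State.reg_setReg_self _ _ _) (by simp [State.reg_setReg]) (by omega) (by omega) hlt).seq
    fun s₆ ⟨F₆, l₆⟩ => ?_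
  have G₆ : Frame [rF, rX, rLim, rk, rck] [] s₄ s₆ :=
    (F₅.mono (by simp) (by simp)).trans (F₆.mono (by simp) (by simp))
  have H₆ : Frame [rk, rck, rZ, rL, rT, rF, rX, rLim] [2] s₁ s₆ :=
    ((F₂.mono (by simp) (by simp)).trans (G₄.mono (by simp) (by simp))).trans
      (G₆.mono (by simp) (by simp))
  have m₆ : s₆.reg rm = Φ.m := by rw [H₆.reg _ (by decide)]; simp [hs₁, State.reg_setReg]
  have H₇ : Frame [rBest] [] s₆ (s₆.setReg rBest Φ.m) := (Frame.refl _ _ _).setReg (by simp) _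
  refine Runs.assign' (x := Φ.m) rfl hv (by rw [Expr.bd_var, m₆]; omega) m₆ ⟨⟨⟨?_, ?_, ?_, fun i => ?_,
    fun i hi => ?_⟩, fun i hi => ?_, ?_, ?_, ?_, ?_⟩, ⟨0, le_of_eq (zero_mul _).symm, ?_, fun A i => ?_,
    fun A i _ => ?_, fun j _ => ?_⟩, ?_, ?_, False.elim⟩
  · rw [H₇.reg _ (by decide), H₆.reg _ (by decide)]; simp [hs₁, State.reg_setReg]
  · rw [H₇.reg _ (by decide), m₆, Φ.codes_length]
  · rw [H₇.reg _ (by decide), H₆.reg _ (by decide), Φ.codes_length]; simp [hs₁, State.reg_setReg]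
  · rw [H₇.mem _ (by simp), H₆.mem _ (by simp), Φ.codes_length, ← henc]; simp [hs₁, State.setReg, init]
  · rw [H₇.mem _ (by simp), G₆.mem _ (by simp), p₄ i (by omega)]
  · rw [H₇.mem _ (by simp), G₆.mem _ (by simp), p₄ i hi]
  · rw [H₇.reg _ (by decide), G₆.reg _ (by decide), z₄]
  · rw [H₇.reg _ (by decide), G₆.reg _ (by decide), G₄.reg _ (by decide), l₂]
  · rw [H₇.reg _ (by decide), F₆.reg _ (by decide)]; simp [State.reg_setReg]
  · rw [H₇.reg _ (by decide), l₆]; rfl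
  · rw [H₇.reg _ (by decide), H₆.reg _ (by decide)]; simp [hs₁, State.reg_setReg, init]
  · rw [H₇.mem _ (by simp), H₆.mem _ (by simp)]; simp [hs₁, State.setReg, init]; omega
  · rw [H₇.mem _ (by simp), H₆.mem _ (by simp)]; simp [hs₁, State.setReg, init]
  · rw [H₇.reg _ (by simp), H₆.reg _ (by simp)]
    have e : ∀ k < 128, j + 128 ≠ k := fun k hk => by omega
    rw [hs₁, State.reg_setReg_of_ne (e _ (by norm_num)), State.reg_setReg_of_ne (e _ (by norm_num)),
      State.reg_setReg_of_ne (e _ (by norm_num)), State.reg_setReg_of_ne (e _ (by norm_num))]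
    rfl
  · rw [State.reg_setReg_self]
  · rw [State.reg_setReg_self]; exact Φ.minUnsat_le_m

/-- The program for MAX-CNF-SAT (`b = true`) or SAT (`b = false`), using the program `p` for
All-Pairs Max-Flow. -/
def mainProg (p : Prog) (r C κ : ℕ) (b : Bool) : Prog :=
  .seq (preProg r C κ) (.seq (searchProg p)
    (put 1 (.lit 0) (bif b then .var rm - .var rBest else .lit 1 - .var rBest)))

/-- Running time of the program if every guess takes time `T`. -/
def mainTime (κ : ℕ) (Φ : CNFFormula) (T : ℕ) : ℕ :=
  5 * (Φ.m + 1) ^ 2 * 30 + (Φ.n + Φ.zExp + 1) * 20 + κ * 15 + 130 +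
    ((Φ.n + 1) * ((Φ.n + Φ.zExp + 1) * (T + 59) + 19) + 9 + 5)

theorem exec_mainProg {T : ℕ} (hb : MainBd Φ p r C κ v) (hC : 1 ≤ C)
    (hT : ∀ a g, a ≤ Φ.n → g ≤ a + Φ.zExp → GuessOk Φ (fuelOf r C Φ) a g →
      guessTime Φ p Φ.zExp (fuelOf r C Φ) a g ≤ T) (hT1 : 1 ≤ T)
    (hright : ∃ a ≤ Φ.n, ∃ g ≤ a + Φ.zExp, GuessOk Φ (fuelOf r C Φ) a g ∧
      GuessRight Φ p Φ.zExp (fuelOf r C Φ) (limOf C κ Φ) a g) (b : Bool) :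
    ∃ s t, Exec (2 ^ (32 * v)) (mainProg p r C κ b) (init Φ.encode) s t ∧ t ≤ mainTime κ Φ T ∧
      s.mem 1 0 = bif b then Φ.m - Φ.minUnsat else 1 - Φ.minUnsat := by
  have hv : 1 ≤ v := by have := hb.v_pos; omega
  have h16 : 16 ≤ 2 ^ v := by
    simpa using Nat.pow_le_pow_right (n := 2) (by norm_num) hb.v_pos
  have hmv : Φ.m + 1 < 2 ^ v := by
    have h1 := hb.guessBd.m_le
    have h2 := limOf_ge Φ C κ
    have h3 := hb.lim_lt
    have h4 : 2 ^ Φ.zExp ≤ (2 ^ Φ.zExp) ^ 3 := Nat.le_self_pow (by norm_num) _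
    have h5 := Nat.le_mul_of_pos_left ((2 ^ Φ.zExp) ^ 3) (show 0 < 256 * 2 ^ Φ.n by positivity)
    have h6 := Nat.le_mul_of_pos_left (11 * (256 * 2 ^ Φ.n * (2 ^ Φ.zExp) ^ 3))
      (show 0 < C + 2 by omega)
    omega
  have hrun : Runs v (mainProg p r C κ b) (init Φ.encode)
      (fun s => s.mem 1 0 = bif b then Φ.m - Φ.minUnsat else 1 - Φ.minUnsat) (mainTime κ Φ T) := by
    refine (Runs.preProg hb hC).seq fun s₁ h₁ => ?_
    refine (Runs.searchProg hb.guessBd hT hT1 hb.room h₁).seq fun s₂ h₂ => ?_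
    have hbest := h₂.best.2.2 hright
    have hm := h₂.setup.input.rm_eq
    rw [Φ.codes_length] at hm
    have hle := Φ.minUnsat_le_m
    cases b
    · refine Runs.put' (j := 0) (x := 1 - Φ.minUnsat) rfl rfl hv (by rw [Expr.bd_lit]; omega) ?_ rfl ?_ ?_
      · simp only [cond_false, Expr.bd_sub, Expr.bd_lit, Expr.bd_var, hbest]; omega
      · simp only [cond_false, Expr.eval_sub, Expr.eval_lit, Expr.eval_var, hbest]
      · simp [State.mem_setMem]
    · refine Runs.put' (j := 0) (x := Φ.m - Φ.minUnsat) rfl rfl hv (by rw [Expr.bd_lit]; omega) ?_ rfl ?_ ?_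
      · simp only [cond_true, Expr.bd_sub, Expr.bd_var, hbest, hm]; omega
      · simp only [cond_true, Expr.eval_sub, Expr.eval_var, hbest, hm]
      · simp [State.mem_setMem]
  obtain ⟨s, t, s', h1, h2, h3, h4⟩ := hrun _ (.refl _)
  exact ⟨s, t, h1, h2, by rw [h3.1]; exact h4⟩

end Main

end WordRAM

namespace WordRAM

/-! ### The right guess -/

theorem length_pairList_true (N : ℕ) (f : ℕ → ℕ × ℕ) : (pairList N (fun _ => True) f).length = N := by
  simp [pairList]

section Density

variable {Φ : CNFFormula} {c : ℝ} {a g : ℕ}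

/-- Some guess fits the density. -/
theorem exists_guess (n L : ℕ) (hc : c ∈ Set.Icc (1 : ℝ) 2) : ∃ a ≤ n, ∃ g ≤ a + L,
    n ≤ 2 * a + min a g ∧ 2 * a + min a g ≤ n + 2 ∧
    (g : ℝ) ≤ (c - 1) * (a + L : ℕ) ∧ (c - 1) * (a + L : ℕ) < g + 1 := by
  obtain ⟨hc1, hc2⟩ := hc
  -- This is the padding exponent that makes the number of edges about the `c`-th power of the
  -- number of nodes.
  let G : ℕ → ℕ := fun a => ⌊(c - 1) * ((a + L : ℕ) : ℝ)⌋₊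
  have hex : ∃ a, n ≤ 2 * a + min a (G a) := ⟨n, by omega⟩
  classical
  have hnn : ∀ a : ℕ, 0 ≤ (c - 1) * ((a + L : ℕ) : ℝ) := fun a =>
    mul_nonneg (by linarith) (Nat.cast_nonneg _)
  refine ⟨Nat.find hex, Nat.find_min' hex (by omega), G (Nat.find hex), ?_, Nat.find_spec hex, ?_,
    Nat.floor_le (hnn _), Nat.lt_floor_add_one _⟩
  · refine Nat.floor_le_of_le ?_
    have : (0 : ℝ) ≤ ((Nat.find hex + L : ℕ) : ℝ) := Nat.cast_nonneg _
    nlinarith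
  · rcases hz : Nat.find hex with _ | k
    · simp
    · have hmin := Nat.find_min hex (m := k) (by omega)
      -- Since `c - 1 ≤ 1`, increasing `a` by one increases `2 * a + min a (G a)` by at most `3`;
      -- the least `a` that covers all variables therefore overshoots by at most `2`.
      have hstep : G (k + 1) ≤ G k + 1 := by
        rw [← Nat.floor_add_one (hnn k)]
        refine Nat.floor_le_floor ?_
        push_cast
        nlinarith
      omega

theorem le_length_allEdges : (guessParams Φ L a g).Mp ≤ (guessParams Φ L a g).allEdges.length := by
  have : (guessParams Φ L a g).padEdges.length = (guessParams Φ L a g).Mp :=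
    length_pairList_true _ _
  simp only [RedParams.allEdges, List.length_append]
  omega

/-- The factor `2 ^ L` absorbs `5 * s ^ 2`, so the edges other than the padding number at most `2 ^
(a + L + g)`, and the padding contributes exactly this amount. -/
theorem length_allEdges_guess_le (hZ : 5 * (Φ.m + 1) ^ 2 ≤ 2 ^ L) (hg : g ≤ a + L) :
    (guessParams Φ L a g).allEdges.length ≤ 2 * 2 ^ (a + L + g) := by
  have h1 := (guessParams Φ L a g).length_allEdges_le
  have h2 := (guessParams_valid hZ hg).slots_ge
  have hG : 2 ^ min a g ≤ 2 ^ g := Nat.pow_le_pow_right (by norm_num) (min_le_right _ _)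
  have h3 : 2 ^ a * (5 * (Φ.m + 1) ^ 2) * 2 ^ min a g ≤ 2 ^ a * 2 ^ L * 2 ^ g :=
    Nat.mul_le_mul (Nat.mul_le_mul_left _ hZ) hG
  have h4 : (guessParams Φ L a g).slots =
      2 ^ a * (5 * (Φ.m + 1) ^ 2) * 2 ^ min a g + 2 ^ a * 2 ^ L * 2 ^ g := by
    simp only [RedParams.slots, guessParams]; ring
  rw [pow_add, pow_add]
  omega

/-- Rounding in `g` puts `2 ^ (a + L + g)` within a factor `2` of `2 ^ (c * (a + L))`. The constant
`128` is this factor times `8 ^ 2`, a bound for the effect of the `8` blocks of nodes; logarithms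
play no role. -/
theorem hasDensity_graph (h : (guessParams Φ L a g).Valid) (hZ : 5 * (Φ.m + 1) ^ 2 ≤ 2 ^ L)
    (hc : c ∈ Set.Icc (1 : ℝ) 2) (hg : g ≤ a + L) (h1 : (g : ℝ) ≤ (c - 1) * (a + L : ℕ))
    (h2 : (c - 1) * (a + L : ℕ) < g + 1) :
    (RedParams.graph h).HasDensity c 128 0 := by
  obtain ⟨hc1, hc2⟩ := hc
  have hn : (RedParams.graph h).n = 8 * 2 ^ (a + L) := by
    rw [RedParams.graph_n, pow_add]; rfl
  have hm1 : 2 ^ (a + L + g) ≤ (RedParams.graph h).m := by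
    rw [RedParams.graph_m, pow_add, pow_add]; exact le_length_allEdges
  have hm2 : (RedParams.graph h).m ≤ 2 * 2 ^ (a + L + g) := by
    rw [RedParams.graph_m]; exact length_allEdges_guess_le hZ hg
  rw [EdgeListGraph.HasDensity]
  generalize (RedParams.graph h).n = N at *
  generalize (RedParams.graph h).m = M at *
  subst hn
  set X := a + L with hX
  have hm1' : (2 : ℝ) ^ ((X : ℝ) + g) ≤ M := by
    rw [← Nat.cast_add, Real.rpow_natCast]; exact_mod_cast hm1
  have hm2' : (M : ℝ) ≤ 2 * (2 : ℝ) ^ ((X : ℝ) + g) := by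
    rw [← Nat.cast_add, Real.rpow_natCast]; exact_mod_cast hm2
  have hN : (((8 * 2 ^ X : ℕ) : ℝ)) ^ c = 8 ^ c * 2 ^ (c * X) := by
    push_cast
    rw [Real.mul_rpow (by norm_num) (by positivity), ← Real.rpow_natCast, ← Real.rpow_mul (by norm_num),
      mul_comm c]
  have h8 : (8 : ℝ) ^ c ≤ 64 := by
    calc (8 : ℝ) ^ c ≤ 8 ^ (2 : ℝ) := Real.rpow_le_rpow_of_exponent_le (by norm_num) hc2
      _ = 64 := by norm_num
  have h8' : (1 : ℝ) ≤ 8 ^ c := Real.one_le_rpow (by norm_num) (by linarith)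
  refine ⟨?_, ?_, ?_⟩
  · have : 1 ≤ 2 ^ X := Nat.one_le_two_pow
    omega
  · rw [hN, pow_zero, mul_one]
    have h3 : (2 : ℝ) ^ (c * X) ≤ 2 * 2 ^ ((X : ℝ) + g) := by
      calc (2 : ℝ) ^ (c * X) ≤ 2 ^ (1 + ((X : ℝ) + g)) :=
            Real.rpow_le_rpow_of_exponent_le (by norm_num) (by linarith)
        _ = _ := by rw [Real.rpow_add (by norm_num), Real.rpow_one]
    have h4 : (0 : ℝ) < 2 ^ (c * X) := by positivity
    nlinarith
  · rw [hN, pow_zero, mul_one]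
    have h3 : (2 : ℝ) ^ ((X : ℝ) + g) ≤ 2 ^ (c * X) :=
      Real.rpow_le_rpow_of_exponent_le (by norm_num) (by linarith)
    have h4 : (0 : ℝ) < 2 ^ (c * X) := by positivity
    nlinarith

end Density

theorem sum_words_le {B : ℕ} : ∀ L : List (ℕ × ℕ), (∀ e ∈ L, e.1 ≤ B ∧ e.2 ≤ B) →
    (words L).sum ≤ 2 * L.length * B
  | [], _ => by simp [words]
  | e :: L, h => by
    have h1 := sum_words_le L fun e he => h e (List.mem_cons_of_mem _ he)
    have h2 := h e (by simp)
    rw [words] at h1 ⊢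
    rw [List.flatMap_cons, List.sum_append, List.length_cons]
    simp only [List.sum_cons, List.sum_nil]
    nlinarith

/-- The algorithm must write all flow values that are positive. -/
theorem sq_le_of_exec {R : RedParams} (h : R.Valid) {B t : ℕ} {p : Prog} {σ : State}
    (hex : Exec B p (init (RedParams.graph h).encode) σ t)
    (hflow : (RedParams.graph h).AllPairsMaxFlow (σ.mem 1)) : R.A * R.A ≤ t := by
  obtain ⟨W, hW, hW'⟩ := hex.card_changed_le 1
  refine le_trans ?_ hW
  have hs := h.s_pos
  have hAB := h.A_le_Bl
  -- The cells of threshold `0` for all pairs of a source and a second-block assignment are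
  -- distinct. Array `1` is initially zero while the correct entries are positive, so each of them
  -- must have been written.
  have hinj : ((Finset.range R.A ×ˢ Finset.range R.A).image
      fun e : ℕ × ℕ => e.1 * (8 * R.Bl) + (R.Bl + (e.2 * R.s + 0))).card = R.A * R.A := by
    rw [Finset.card_image_of_injOn, Finset.card_product, Finset.card_range]
    rintro ⟨α, β⟩ he ⟨α', β'⟩ he' heq
    simp only [Finset.coe_product, Finset.coe_range, Set.mem_prod, Set.mem_Iio] at he he'
    have h1 : β * R.s + 0 < R.Bl := h.sink_lt he.2 hs
    have h2 : β' * R.s + 0 < R.Bl := h.sink_lt he'.2 hs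
    change α * (8 * R.Bl) + (R.Bl + (β * R.s + 0)) = α' * (8 * R.Bl) + (R.Bl + (β' * R.s + 0)) at heq
    obtain ⟨rfl, h3⟩ := RedParams.digits_inj' (by omega) (by omega) heq
    obtain ⟨rfl, -⟩ := RedParams.digits_inj' hs hs (Nat.add_left_cancel h3)
    rfl
  rw [← hinj]
  refine Finset.card_le_card fun i hi => ?_
  obtain ⟨⟨α, β⟩, he, rfl⟩ := Finset.mem_image.1 hi
  rw [Finset.mem_product, Finset.mem_range, Finset.mem_range] at he
  obtain ⟨hα, hβ⟩ : α < R.A ∧ β < R.A := he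
  by_contra hnot
  have hzero := hW' _ hnot
  have hsk : β * R.s + 0 < R.Bl := h.sink_lt hβ hs
  have hne : RedParams.node h α ≠ RedParams.node h (R.Bl + (β * R.s + 0)) := by
    intro he'
    have := congrArg Fin.val he'
    rw [RedParams.node_val h (show α < 8 * R.Bl by omega),
      RedParams.node_val h (show R.Bl + (β * R.s + 0) < 8 * R.Bl by omega)] at this
    omega
  have hfl := hflow _ _ hne
  rw [RedParams.node_val h (show α < 8 * R.Bl by omega),
    RedParams.node_val h (show R.Bl + (β * R.s + 0) < 8 * R.Bl by omega)] at hfl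
  change IsMaxFlowValue _ _ _ ((σ.mem 1 (α * (8 * R.Bl) + (R.Bl + (β * R.s + 0))) : ℕ) : ℝ) at hfl
  have hpos := (h.isMaxFlowValue_iff hα hβ hs hfl).1
  rw [hzero] at hpos
  simp [init] at hpos

end WordRAM

/-! ### Fuel and limit suffice for the right guess. -/

namespace WordRAM

section Right

variable {Φ : CNFFormula} {p : Prog} {r C κ : ℕ} {ε c : ℝ}

/-- Guarantee of an algorithm for All-Pairs Max-Flow. -/
def FlowAlgorithm (ε c : ℝ) (p : Prog) (C κ : ℕ) : Prop :=
  ∀ G : EdgeListGraph, G.HasDensity c 128 0 → ∃ (w t : ℕ) (s : State),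
    (2 : ℝ) ^ w ≤ C * (((G.encode).length + (G.encode).sum : ℕ) +
      ((G.n : ℝ) * (G.m : ℝ)) ^ (1 - ε)) ^ κ ∧
    (∀ v ∈ G.encode, v < 2 ^ w) ∧ Exec (2 ^ w) p (init G.encode) s t ∧
    (t : ℝ) ≤ C * ((G.n : ℝ) * (G.m : ℝ)) ^ (1 - ε) ∧ G.AllPairsMaxFlow (s.mem 1)

/-- The input size includes the sum of the words, which is dominated by two node numbers per edge.
It is linear in the product of nodes and edges, so the word size granted to the flow algorithm is
polynomial in this product. -/
theorem encode_size_le {R : RedParams} (h : R.Valid) (hm : 1 ≤ R.allEdges.length) :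
    (RedParams.graph h).encode.length + (RedParams.graph h).encode.sum ≤
      10 * ((RedParams.graph h).n * (RedParams.graph h).m) := by
  have henc : (RedParams.graph h).encode = 8 * R.Bl :: R.allEdges.length :: words R.allEdges :=
    RedParams.graph_encode h
  have hs := sum_words_le (B := 8 * R.Bl) R.allEdges fun e he =>
    ⟨(h.lt_of_mem e he).1.le, (h.lt_of_mem e he).2.le⟩
  have hA := h.A_pos
  have hAB := h.A_le_Bl
  rw [henc, RedParams.graph_n, RedParams.graph_m]
  simp only [List.length_cons, List.sum_cons, length_words]
  have hN : 8 ≤ 8 * R.Bl := by omega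
  generalize 8 * R.Bl = N at *
  generalize R.allEdges.length = M at *
  nlinarith [Nat.mul_le_mul hN hm, Nat.mul_le_mul_left N hm, Nat.mul_le_mul_right M hN]

/-- Replacing `ε` by `1 / r` gives a bound with the natural exponent `n - n / r`, which the machine
can compute as its fuel. -/
theorem rpow_le_of_le_pow {P Z : ℝ} {n r : ℕ} {ε : ℝ} (hr : 1 ≤ r) (hrε : 1 / (r : ℝ) ≤ ε)
    (hP : 1 ≤ P) (hZ : 1 ≤ Z) (hPZ : P ≤ Z * 2 ^ n) : P ^ (1 - ε) ≤ Z * 2 ^ (n - n / r) := by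
  have hr0 : (0 : ℝ) < r := by exact_mod_cast hr
  have hrr : 1 / (r : ℝ) ≤ 1 := by
    rw [div_le_one hr0]; exact_mod_cast hr
  have hrp := div_pos one_pos hr0
  calc P ^ (1 - ε)
      ≤ P ^ (1 - 1 / (r : ℝ)) := Real.rpow_le_rpow_of_exponent_le hP (by linarith)
    _ ≤ (Z * 2 ^ n) ^ (1 - 1 / (r : ℝ)) := Real.rpow_le_rpow (by linarith) hPZ (by linarith)
    _ = Z ^ (1 - 1 / (r : ℝ)) * ((2 : ℝ) ^ n) ^ (1 - 1 / (r : ℝ)) :=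
        Real.mul_rpow (by linarith) (by positivity)
    _ ≤ Z * 2 ^ (n - n / r) := by
        refine mul_le_mul ?_ ?_ (by positivity) (by linarith)
        · calc _ ≤ Z ^ (1 : ℝ) := Real.rpow_le_rpow_of_exponent_le hZ (by linarith)
            _ = _ := Real.rpow_one _
        · rw [← Real.rpow_natCast, ← Real.rpow_natCast, ← Real.rpow_mul (by norm_num)]
          refine Real.rpow_le_rpow_of_exponent_le (by norm_num) ?_
          rw [Nat.cast_sub (Nat.div_le_self _ _)]
          have : ((n / r : ℕ) : ℝ) ≤ (n : ℝ) / r := Nat.cast_div_le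
          rw [mul_sub, mul_one, mul_one_div]
          linarith

theorem le_fuelOf {t : ℕ} {P : ℝ} (hr : 1 ≤ r) (hrε : 1 / (r : ℝ) ≤ ε) (hP : 1 ≤ P)
    (hPZ : P ≤ 64 * (2 ^ Φ.zExp) ^ 3 * 2 ^ Φ.n) (ht : (t : ℝ) ≤ C * P ^ (1 - ε)) :
    t ≤ fuelOf r C Φ := by
  have hZ : (1 : ℝ) ≤ (2 ^ Φ.zExp) ^ 3 := one_le_pow₀ (one_le_pow₀ (by norm_num))
  have h1 := rpow_le_of_le_pow hr hrε hP (by linarith) hPZ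
  have h2 : (t : ℝ) ≤ fuelOf r C Φ := by
    refine ht.trans ((mul_le_mul_of_nonneg_left h1 (Nat.cast_nonneg _)).trans ?_)
    rw [fuelOf]
    push_cast
    have h3 : (0 : ℝ) ≤ C * ((2 ^ Φ.zExp) ^ 3 * 2 ^ (Φ.n - Φ.n / r)) := by positivity
    linarith
  exact Nat.cast_le.1 h2

theorem le_limOf {B S : ℕ} {P : ℝ} (hε : 0 ≤ ε) (hP : 1 ≤ P)
    (hPZ : P ≤ 64 * (2 ^ Φ.zExp) ^ 3 * 2 ^ Φ.n) (hS : (S : ℝ) ≤ 10 * P)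
    (hB : (B : ℝ) ≤ C * (S + P ^ (1 - ε)) ^ κ) : B ≤ limOf C κ Φ := by
  have h1 : P ^ (1 - ε) ≤ P := by
    calc _ ≤ P ^ (1 : ℝ) := Real.rpow_le_rpow_of_exponent_le hP (by linarith)
      _ = _ := Real.rpow_one _
  have h2 : (0 : ℝ) ≤ P ^ (1 - ε) := Real.rpow_nonneg (by linarith) _
  have h0 : (0 : ℝ) ≤ (2 ^ Φ.zExp) ^ 3 * 2 ^ Φ.n := by positivity
  have h3 : (S : ℝ) + P ^ (1 - ε) ≤ 11 * (256 * 2 ^ Φ.n * (2 ^ Φ.zExp) ^ 3) := by linarith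
  have h4 : (1 : ℝ) ≤ 11 * (256 * 2 ^ Φ.n * (2 ^ Φ.zExp) ^ 3) := by linarith
  have h5 : (B : ℝ) ≤ limOf C κ Φ := by
    refine hB.trans ?_
    rw [limOf]
    push_cast
    have hS0 : (0 : ℝ) ≤ S := Nat.cast_nonneg _
    have hC0 : (0 : ℝ) ≤ C := Nat.cast_nonneg _
    refine mul_le_mul (by linarith) ?_ (by positivity) (by linarith)
    exact (pow_le_pow_left₀ (by linarith) h3 _).trans (pow_le_pow_right₀ h4 (by omega))
  exact Nat.cast_le.1 h5

/-- The third part of `GuessOk` is obtained from the run of the flow algorithm itself, through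
`sq_le_of_exec`. Sizes would not give it: for `c = 1` the square of `2 ^ a` is at least `2 ^ n`. -/
theorem exists_right_guess (hp : FlowAlgorithm ε c p C κ) (hc : c ∈ Set.Icc (1 : ℝ) 2)
    (hr : 3 ≤ r) (hrε : 1 / (r : ℝ) ≤ ε) (Φ : CNFFormula) :
    ∃ a ≤ Φ.n, ∃ g ≤ a + Φ.zExp, GuessOk Φ (fuelOf r C Φ) a g ∧
      GuessRight Φ p Φ.zExp (fuelOf r C Φ) (limOf C κ Φ) a g := by
  obtain ⟨a, ha, g, hg, h1, h2, h3, h4⟩ := exists_guess Φ.n Φ.zExp hc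
  have hZ := Φ.le_two_pow_zExp
  have hR : (guessParams Φ Φ.zExp a g).Valid := guessParams_valid hZ hg
  obtain ⟨w, t, σ, e1, -, e3, e4, e5⟩ := hp _ (hasDensity_graph hR hZ hc hg h3 h4)
  have hNM : (RedParams.graph hR).n * (RedParams.graph hR).m ≤
      64 * (2 ^ Φ.zExp) ^ 3 * 2 ^ Φ.n := by
    rw [RedParams.graph_n, RedParams.graph_m]
    have q1 := length_allEdges_guess_le hZ hg
    calc 8 * (2 ^ a * 2 ^ Φ.zExp) * (guessParams Φ Φ.zExp a g).allEdges.length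
        ≤ 8 * (2 ^ a * 2 ^ Φ.zExp) * (2 * 2 ^ (a + Φ.zExp + g)) := Nat.mul_le_mul_left _ q1
      _ = 16 * 2 ^ (2 * a + 2 * Φ.zExp + g) := by ring
      -- Uses `g ≤ min a g + L`, with `L` the exponent `Φ.zExp`, and that the three blocks overshoot
      -- the variables by at most `2`.
      _ ≤ 16 * 2 ^ (Φ.n + 2 + 3 * Φ.zExp) :=
          Nat.mul_le_mul_left _ (Nat.pow_le_pow_right (by norm_num) (by omega))
      _ = _ := by ring
  have hm1 : 1 ≤ (guessParams Φ Φ.zExp a g).allEdges.length :=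
    le_trans (Nat.pos_of_ne_zero (by simp [guessParams])) le_length_allEdges
  have hsz := encode_size_le hR hm1
  have hpos : 1 ≤ (RedParams.graph hR).n * (RedParams.graph hR).m := by
    rw [RedParams.graph_n, RedParams.graph_m]
    exact Nat.mul_pos (by simp [guessParams]) hm1
  have hsq := sq_le_of_exec hR e3 e5
  have hε : 0 ≤ ε := le_trans (by positivity) hrε
  rw [← Nat.cast_mul] at e1 e4
  have hposR : (1 : ℝ) ≤ ((RedParams.graph hR).n * (RedParams.graph hR).m : ℕ) :=
    Nat.one_le_cast.2 hpos
  have hNMR : (((RedParams.graph hR).n * (RedParams.graph hR).m : ℕ) : ℝ) ≤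
      64 * (2 ^ Φ.zExp) ^ 3 * 2 ^ Φ.n := by
    have := (Nat.cast_le (α := ℝ)).2 hNM
    push_cast at this ⊢
    exact this
  have hszR := (Nat.cast_le (α := ℝ)).2 hsz
  rw [Nat.cast_mul, Nat.cast_ofNat] at hszR
  have htF : t ≤ fuelOf r C Φ := le_fuelOf (by omega) hrε hposR hNMR e4
  exact ⟨a, ha, g, hg, ⟨h1, by omega, hsq.trans htF⟩, hR, 2 ^ w, t, σ,
    le_limOf hε hposR hNMR hszR (by rw [Nat.cast_pow, Nat.cast_ofNat]; exact e1), htF, e3, e5⟩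

end Right

end WordRAM

/-! ### Time bounds -/

namespace WordRAM

section Time

variable {Φ : CNFFormula} {p : Prog} {r C κ a g : ℕ}

/-- From `2 * a + b ≤ n + 4` and `b ≤ a` follows `a + b ≤ 2 * (n + 4) / 3`. Writing down the graph
thus costs about `2 ^ (2 * n / 3)`, and this is below `2 ^ (n - n / r)` because `r ≥ 3`. -/
theorem two_pow_add_le {n : ℕ} (hr : 3 ≤ r) (h : 2 * a + min a g ≤ n + 4) :
    2 ^ a * 2 ^ min a g ≤ 8 * 2 ^ (n - n / r) := by
  have h1 : n / r ≤ n / 3 := Nat.div_le_div_left hr (by norm_num)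
  have h2 : min a g ≤ a := min_le_left _ _
  rw [← pow_add, show 8 * 2 ^ (n - n / r) = 2 ^ (n - n / r + 3) by ring]
  refine Nat.pow_le_pow_right (by norm_num) ?_
  generalize n / r = q at *
  omega

/-- All work is charged to the fuel `F`: the guard `A * A ≤ F` pays for the scan and the table, and
`two_pow_add_le` for the graph. -/
theorem guessTime_le (hr : 3 ≤ r) (hC : 1 ≤ C) (hg : g ≤ a + Φ.zExp)
    (hok : GuessOk Φ (fuelOf r C Φ) a g) :
    guessTime Φ p Φ.zExp (fuelOf r C Φ) a g ≤
      (1000 + p.regBound + 2 * p.limitedCost) *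
        (fuelOf r C Φ * ((Φ.n + 1) * (2 ^ Φ.zExp) ^ 2)) := by
  obtain ⟨-, h2, h3⟩ := hok
  have hZ := Φ.le_two_pow_zExp
  have hs := guessParams_slots_le (Φ := Φ) hZ hg
  have hAG := two_pow_add_le hr h2
  have hFe : fuelOf r C Φ = 2 ^ (Φ.n - Φ.n / r) * (2 ^ Φ.zExp) ^ 3 * (256 * C) := rfl
  have hA1 : 1 ≤ 2 ^ a := Nat.one_le_two_pow
  have hGA : 2 ^ min a g ≤ 2 ^ a := Nat.pow_le_pow_right (by norm_num) (min_le_left _ _)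
  rw [guessTime]
  generalize (guessParams Φ Φ.zExp a g).slots = S at *
  generalize fuelOf r C Φ = F at *
  generalize 2 ^ (Φ.n - Φ.n / r) = Q at *
  generalize 2 ^ Φ.zExp = Z at *
  generalize 2 ^ min a g = G at *
  generalize 2 ^ a = A at *
  generalize Φ.m = m at *
  generalize Φ.n = n at *
  generalize p.regBound = ρ
  generalize p.limitedCost = ℓ
  have hmZ : m + 1 ≤ Z := by nlinarith
  have hZ1 : 1 ≤ Z := by omega
  have hAF : A ≤ F := le_trans (by nlinarith) h3
  have hF1 : 1 ≤ F := by omega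
  have hSF : S ≤ F * 1 := by
    calc S ≤ 2 * (A * G * Z ^ 2) := hs
      _ ≤ 2 * (8 * Q * Z ^ 2) := by gcongr
      _ = Q * Z ^ 2 * 16 := by ring
      _ ≤ Q * Z ^ 3 * (256 * C) := by
          gcongr
          · norm_num
          · omega
      _ = F * 1 := by rw [hFe]; ring
  have hX1 : F * 1 ≤ F * ((n + 1) * Z ^ 2) := Nat.mul_le_mul_left _ (by nlinarith [Nat.zero_le n])
  have hX2 : F * ((n + 1) * Z) ≤ F * ((n + 1) * Z ^ 2) := by gcongr; nlinarith
  have hX3 : F * (1 * Z ^ 2) ≤ F * ((n + 1) * Z ^ 2) := by gcongr; omega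
  have t1 : 3 * A * (m * (2 * n * 80 + 50) + 40) ≤ 480 * (F * ((n + 1) * Z)) := by
    calc 3 * A * (m * (2 * n * 80 + 50) + 40) ≤ 3 * F * ((m + 1) * (160 * (n + 1))) := by
          gcongr; nlinarith [Nat.zero_le n, Nat.zero_le m]
      _ ≤ 3 * F * (Z * (160 * (n + 1))) := by gcongr
      _ = _ := by ring
  have t2 : (m + 1) * (A * A * 50 + G * ((m + 1) * 60 + 30) + 40) ≤ 180 * (F * (1 * Z ^ 2)) := by
    calc (m + 1) * (A * A * 50 + G * ((m + 1) * 60 + 30) + 40)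
        ≤ Z * (F * 50 + F * (Z * 60 + 30) + 40) := by gcongr; omega
      _ ≤ Z * (F * Z * 50 + F * (Z * 60 + Z * 30) + F * Z * 40) := by
          have : 1 ≤ F * Z := Nat.mul_pos hF1 hZ1
          gcongr <;> nlinarith
      _ = _ := by ring
  generalize F * ((n + 1) * Z ^ 2) = X at *
  have t3 : ℓ * (F + 1) ≤ 2 * ℓ * X := by
    calc ℓ * (F + 1) ≤ ℓ * (2 * X) := Nat.mul_le_mul_left _ (by omega)
      _ = _ := by ring
  have t4 : ρ ≤ ρ * X := Nat.le_mul_of_pos_right _ (by omega)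
  have e : (1000 + ρ + 2 * ℓ) * X = 1000 * X + ρ * X + 2 * ℓ * X := by ring
  omega

theorem mainTime_le {T : ℕ} (hT : 1 ≤ T) :
    mainTime κ Φ T ≤ (300 + 15 * κ) * (T * ((Φ.n + 1) ^ 2 * 2 ^ Φ.zExp)) := by
  have hZ := Φ.le_two_pow_zExp
  have hL : Φ.zExp < 2 ^ Φ.zExp := Nat.lt_two_pow_self
  rw [mainTime]
  generalize 2 ^ Φ.zExp = Z at *
  generalize Φ.zExp = L at *
  generalize Φ.n = n at *
  have h1 : n + L + 1 ≤ (n + 1) * Z := by nlinarith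
  have h2 : (n + 1) * ((n + L + 1) * (T + 59) + 19) ≤ 79 * (T * ((n + 1) ^ 2 * Z)) := by
    calc (n + 1) * ((n + L + 1) * (T + 59) + 19)
        ≤ (n + 1) * ((n + 1) * Z * (60 * T) + 19 * ((n + 1) * Z * T)) := by
          have : 1 ≤ (n + 1) * Z * T := Nat.mul_pos (Nat.mul_pos (by omega) (by omega)) hT
          gcongr <;> omega
      _ = _ := by ring
  have h3 : (n + 1) * Z ≤ T * ((n + 1) ^ 2 * Z) := by
    calc (n + 1) * Z = 1 * ((n + 1) * Z) := by ring
      _ ≤ T * ((n + 1) ^ 2 * Z) := by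
          gcongr
          exact Nat.le_self_pow (by norm_num) _
  have h4 : Z ≤ (n + 1) * Z := Nat.le_mul_of_pos_left _ (by omega)
  generalize (n + 1) * Z = W at *
  generalize T * ((n + 1) ^ 2 * Z) = Y at *
  have h5 : κ * 15 ≤ 15 * κ * Y := by
    have := Nat.mul_le_mul_left (15 * κ) (show 1 ≤ Y by omega)
    omega
  have h6 : (300 + 15 * κ) * Y = 300 * Y + 15 * κ * Y := by ring
  omega

/-- Bound for the time of one guess. -/
def guessCost (p : Prog) (r C : ℕ) (Φ : CNFFormula) : ℕ :=
  (1000 + p.regBound + 2 * p.limitedCost) * (fuelOf r C Φ * ((Φ.n + 1) * (2 ^ Φ.zExp) ^ 2))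

theorem guessCost_pos (hC : 1 ≤ C) : 1 ≤ guessCost p r C Φ := by
  rw [guessCost, fuelOf]
  exact Nat.pos_of_ne_zero (by positivity)

/-- With `Z = 2 ^ Φ.zExp ≤ 10 * (m + 1) ^ 2`, the fuel contributes `Z ^ 3`, the cost of a guess per
fuel `Z ^ 2` and the number of guesses `Z`; the sixth power gives `10 ^ 6` and exponent `12`. -/
theorem mainTime_guessCost_le (hC : 1 ≤ C) : mainTime κ Φ (guessCost p r C Φ) ≤
    (300 + 15 * κ) * (1000 + p.regBound + 2 * p.limitedCost) * (256 * C) * 10 ^ 6 *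
      (2 ^ (Φ.n - Φ.n / r) * (Φ.n + 1) ^ 3 * (Φ.m + 1) ^ 12) := by
  refine (mainTime_le (guessCost_pos hC)).trans ?_
  rw [guessCost, fuelOf]
  have hZ := Nat.pow_le_pow_left Φ.two_pow_zExp_le 6
  generalize 2 ^ Φ.zExp = Z at *
  generalize 2 ^ (Φ.n - Φ.n / r) = Q
  generalize 1000 + p.regBound + 2 * p.limitedCost = c₀
  calc (300 + 15 * κ) * (c₀ * (Q * Z ^ 3 * (256 * C) * ((Φ.n + 1) * Z ^ 2)) * ((Φ.n + 1) ^ 2 * Z))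
      = (300 + 15 * κ) * c₀ * (256 * C) * (Q * (Φ.n + 1) ^ 3) * Z ^ 6 := by ring
    _ ≤ (300 + 15 * κ) * c₀ * (256 * C) * (Q * (Φ.n + 1) ^ 3) * (10 * (Φ.m + 1) ^ 2) ^ 6 :=
        Nat.mul_le_mul_left _ hZ
    _ = _ := by ring

end Time

end WordRAM

/-! ### Word length, and the reduction as a whole -/

namespace WordRAM

theorem exists_wordLength (M : ℕ) : ∃ v, M < 2 ^ v ∧ 2 ^ v ≤ 2 * (M + 1) := by
  refine ⟨Nat.log 2 (M + 1) + 1, ?_, ?_⟩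
  · have := Nat.lt_pow_succ_log_self (b := 2) (by norm_num) (M + 1)
    omega
  · rw [pow_succ, mul_comm]
    exact Nat.mul_le_mul_left _ (Nat.pow_log_le_self 2 (by omega))

section Word

variable {Φ : CNFFormula} {p : Prog} {r C κ v : ℕ}

theorem m_lt_length_encode (Φ : CNFFormula) : Φ.m + 1 < Φ.encode.length := by
  have h : Φ.clauses.length ≤ (Φ.clauses.flatMap fun c =>
      c.length :: c.map fun l => 2 * l.1.val + l.2.toNat).length := by
    induction Φ.clauses with
    | nil => simp
    | cons c L ih => rw [List.flatMap_cons, List.length_append, List.length_cons, List.length_cons]; omega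
  simp only [CNFFormula.encode, List.length_cons, CNFFormula.m]
  omega

theorem MainBd.encode_lt (hb : MainBd Φ p r C κ v) {x : ℕ} (hx : x ∈ Φ.encode) : x < 2 ^ v := by
  have hI := hb.inputBd
  have h1 := hI.n_lt
  have h2 := m_lt_length_encode Φ
  have h3 := hb.enc
  rw [Φ.encode_eq, List.mem_cons, List.mem_cons, List.mem_flatMap] at hx
  obtain rfl | rfl | ⟨c, hc, hx⟩ := hx
  · omega
  · omega
  · rw [List.mem_cons] at hx
    obtain rfl | hx := hx
    · have := hI.len c hc; omega
    · have := hI.lit c hc x hx; omega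

/-- Everything is measured by `y = 2 ^ n * length`. The number of windows contributes `y ^ 4`; the
base of the limit contributes `y ^ 7`, as one factor `2 ^ n` and three factors `Z ≤ 10 * y ^ 2`,
with constant `11 * 256 * 10 ^ 3 = 2816000`. -/
theorem room_le (Φ : CNFFormula) (C κ : ℕ) :
    ((Φ.n + 1) * (Φ.n + Φ.zExp + 1) + 2) * limOf C κ Φ ≤
      30 * ((C + 2) * 2816000 ^ (κ + 2)) * (2 ^ Φ.n * Φ.encode.length) ^ (7 * (κ + 2) + 4) := by
  have hm := m_lt_length_encode Φ
  have hn : Φ.n < 2 ^ Φ.n := Nat.lt_two_pow_self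
  have hL : Φ.zExp < 2 ^ Φ.zExp := Nat.lt_two_pow_self
  have hZ := Φ.two_pow_zExp_le
  have hy1 : 2 ^ Φ.n ≤ 2 ^ Φ.n * Φ.encode.length := Nat.le_mul_of_pos_right _ (by omega)
  have hy2 : Φ.encode.length ≤ 2 ^ Φ.n * Φ.encode.length := Nat.le_mul_of_pos_left _ (by omega)
  rw [limOf]
  generalize 2 ^ Φ.n * Φ.encode.length = y at *
  generalize 2 ^ Φ.zExp = Z at *
  generalize Φ.zExp = L at *
  generalize 2 ^ Φ.n = N at *
  have hZy : Z ≤ 10 * y ^ 2 := hZ.trans (by gcongr; omega)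
  have hy : 1 ≤ y := by omega
  have h1 : (Φ.n + 1) * (Φ.n + L + 1) + 2 ≤ 30 * y ^ 4 := by
    calc (Φ.n + 1) * (Φ.n + L + 1) + 2 ≤ y * (y + 10 * y ^ 2) + 2 :=
          Nat.add_le_add_right (Nat.mul_le_mul (by omega) (by omega)) 2
      _ ≤ 30 * y ^ 4 := by
          have e1 : y ^ 2 ≤ y ^ 4 := Nat.pow_le_pow_right hy (by norm_num)
          have e2 : y ^ 3 ≤ y ^ 4 := Nat.pow_le_pow_right hy (by norm_num)
          have e3 : 1 ≤ y ^ 4 := Nat.one_le_pow _ _ hy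
          have e4 : y * (y + 10 * y ^ 2) = y ^ 2 + 10 * y ^ 3 := by ring
          omega
  have h2 : 11 * (256 * N * Z ^ 3) ≤ 2816000 * y ^ 7 := by
    calc 11 * (256 * N * Z ^ 3) ≤ 11 * (256 * y * (10 * y ^ 2) ^ 3) := by gcongr
      _ = _ := by ring
  calc _ ≤ 30 * y ^ 4 * ((C + 2) * (2816000 * y ^ 7) ^ (κ + 2)) := by gcongr
    _ = _ := by rw [mul_pow, ← pow_mul, pow_add]; ring

/-- Factor in the bound for the word size. -/
def wordConst (p : Prog) (r C κ : ℕ) : ℕ :=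
  p.constBound + r + 40 + 30 * ((C + 2) * 2816000 ^ (κ + 2))

theorem exists_mainBd (Φ : CNFFormula) (p : Prog) (r C κ : ℕ) : ∃ v, MainBd Φ p r C κ v ∧
    2 ^ v ≤ 2 * (wordConst p r C κ * (2 ^ Φ.n * Φ.encode.length) ^ (7 * (κ + 2) + 4)) := by
  have h1 := room_le Φ C κ
  have hy2 : Φ.encode.length ≤ 2 ^ Φ.n * Φ.encode.length :=
    Nat.le_mul_of_pos_left _ (by positivity)
  have hm := m_lt_length_encode Φ
  obtain ⟨v, h2, h3⟩ := exists_wordLength (16 + Φ.encode.length + p.constBound + r +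
    (((Φ.n + 1) * (Φ.n + Φ.zExp + 1) + 2) * limOf C κ Φ + 10))
  have h4 : 4 ≤ v := by
    by_contra hv
    have : 2 ^ v ≤ 2 ^ 4 := Nat.pow_le_pow_right (by norm_num) (by omega)
    omega
  refine ⟨v, ⟨h4, by omega, by omega, by omega, by omega⟩, h3.trans (Nat.mul_le_mul_left _ ?_)⟩
  generalize ((Φ.n + 1) * (Φ.n + Φ.zExp + 1) + 2) * limOf C κ Φ = ρ at *
  rw [wordConst]
  generalize (C + 2) * 2816000 ^ (κ + 2) = c₁ at *
  have h5 : 2 ^ Φ.n * Φ.encode.length ≤ (2 ^ Φ.n * Φ.encode.length) ^ (7 * (κ + 2) + 4) :=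
    Nat.le_self_pow (by omega) _
  generalize (2 ^ Φ.n * Φ.encode.length) ^ (7 * (κ + 2) + 4) = Y at *
  have h6 := Nat.le_mul_of_pos_right (p.constBound + r) (show 0 < Y by omega)
  have h7 : (p.constBound + r + 40 + 30 * c₁) * Y = (p.constBound + r) * Y + 40 * Y + 30 * c₁ * Y := by
    ring
  omega

end Word

/-- From an algorithm for All-Pairs Max-Flow to one for satisfiability. -/
theorem exists_satProgram {ε c : ℝ} {p : Prog} {r C κ : ℕ} (hp : FlowAlgorithm ε c p C κ)
    (hc : c ∈ Set.Icc (1 : ℝ) 2) (hr : 3 ≤ r) (hrε : 1 / (r : ℝ) ≤ ε) (hC : 1 ≤ C) (b : Bool) :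
    ∃ (q : Prog) (K D : ℕ), ∀ Φ : CNFFormula, ∃ (w t : ℕ) (s : State),
      2 ^ w ≤ K * (2 ^ Φ.n * Φ.encode.length) ^ D ∧ (∀ x ∈ Φ.encode, x < 2 ^ w) ∧
      Exec (2 ^ w) q (init Φ.encode) s t ∧
      t ≤ K * (2 ^ (Φ.n - Φ.n / r) * (Φ.n + 1) ^ 3 * (Φ.m + 1) ^ 12) ∧
      s.mem 1 0 = bif b then Φ.m - Φ.minUnsat else 1 - Φ.minUnsat := by
  refine ⟨mainProg p r C κ b, max ((2 * wordConst p r C κ) ^ 32)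
    ((300 + 15 * κ) * (1000 + p.regBound + 2 * p.limitedCost) * (256 * C) * 10 ^ 6),
    (7 * (κ + 2) + 4) * 32, fun Φ => ?_⟩
  obtain ⟨v, hb, hv⟩ := exists_mainBd Φ p r C κ
  obtain ⟨s, t, h1, h2, h3⟩ := exec_mainProg hb hC (T := guessCost p r C Φ)
    (fun a g _ hg hok => guessTime_le hr hC hg hok) (guessCost_pos hC)
    (exists_right_guess hp hc hr hrε Φ) b
  refine ⟨32 * v, t, s, ?_, fun x hx => (hb.encode_lt hx).trans_le
    (Nat.pow_le_pow_right (by norm_num) (by omega)), h1, ?_, h3⟩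
  · calc 2 ^ (32 * v) = (2 ^ v) ^ 32 := by rw [mul_comm, pow_mul]
      _ ≤ (2 * (wordConst p r C κ * (2 ^ Φ.n * Φ.encode.length) ^ (7 * (κ + 2) + 4))) ^ 32 :=
          Nat.pow_le_pow_left hv _
      _ = (2 * wordConst p r C κ) ^ 32 * (2 ^ Φ.n * Φ.encode.length) ^ ((7 * (κ + 2) + 4) * 32) := by
          rw [← mul_assoc, mul_pow, pow_mul]
      _ ≤ _ := Nat.mul_le_mul_right _ (le_max_left _ _)
  · exact (h2.trans (mainTime_guessCost_le hC)).trans (Nat.mul_le_mul_right _ (le_max_right _ _))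

end WordRAM

/-! ### Absorbing polynomial factors, and the theorem. -/

namespace WordRAM

/-- Half of the saving `n / r` in the exponent is spent on the polynomial, which is dominated by the
powers of `ρ = 2 ^ (1 / (2 * r)) > 1`. -/
theorem exists_pow_le {r : ℕ} (hr : 1 ≤ r) (k : ℕ) : ∃ K : ℕ, ∀ n : ℕ,
    (2 : ℝ) ^ (n - n / r) * ((n : ℝ) + 1) ^ k ≤ K * 2 ^ ((1 - 1 / (2 * (r : ℝ))) * n) := by
  have hr0 : (0 : ℝ) < r := by exact_mod_cast hr
  set ρ : ℝ := 2 ^ (1 / (2 * (r : ℝ))) with hρ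
  have hρ1 : 1 < ρ := Real.one_lt_rpow (by norm_num) (by positivity)
  have hρ0 : 0 < ρ := by linarith
  obtain ⟨M, hM⟩ := (tendsto_pow_const_div_const_pow_of_one_lt k hρ1).bddAbove_range
  refine ⟨⌈2 * (|M| * ρ)⌉₊, fun n => ?_⟩
  have h1 : ((n : ℝ) + 1) ^ k ≤ |M| * ρ * 2 ^ (1 / (2 * (r : ℝ)) * n) := by
    have h := hM ⟨n + 1, rfl⟩
    simp only at h
    rw [div_le_iff₀ (by positivity)] at h
    push_cast at h
    calc ((n : ℝ) + 1) ^ k ≤ M * ρ ^ (n + 1) := h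
      _ ≤ |M| * ρ ^ (n + 1) := by gcongr; exact le_abs_self M
      _ = |M| * ρ * ρ ^ n := by rw [pow_succ]; ring
      _ = _ := by rw [Real.rpow_mul (by norm_num), Real.rpow_natCast]
  have h2 : (2 : ℝ) ^ (n - n / r) ≤ 2 * 2 ^ ((1 - 1 / (r : ℝ)) * n) := by
    rw [← Real.rpow_natCast, show (2 : ℝ) * 2 ^ ((1 - 1 / (r : ℝ)) * n) =
      2 ^ (1 + (1 - 1 / (r : ℝ)) * n) by rw [Real.rpow_add (by norm_num), Real.rpow_one]]
    refine Real.rpow_le_rpow_of_exponent_le (by norm_num) ?_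
    rw [Nat.cast_sub (Nat.div_le_self _ _)]
    have h3 : (n : ℝ) / r < (n / r : ℕ) + 1 := by
      rw [div_lt_iff₀ hr0]
      have h4 : n < (n / r + 1) * r := (Nat.div_lt_iff_lt_mul hr).1 (Nat.lt_succ_self _)
      exact_mod_cast h4
    rw [sub_mul, one_mul, one_div_mul_eq_div]
    linarith
  calc (2 : ℝ) ^ (n - n / r) * ((n : ℝ) + 1) ^ k
      ≤ 2 * 2 ^ ((1 - 1 / (r : ℝ)) * n) * (|M| * ρ * 2 ^ (1 / (2 * (r : ℝ)) * n)) := by gcongr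
    _ = 2 * (|M| * ρ) * (2 ^ ((1 - 1 / (r : ℝ)) * n) * 2 ^ (1 / (2 * (r : ℝ)) * n)) := by ring
    _ = 2 * (|M| * ρ) * 2 ^ ((1 - 1 / (2 * (r : ℝ))) * n) := by
        rw [← Real.rpow_add (by norm_num)]
        congr 2
        field_simp
        ring
    _ ≤ _ := by gcongr; exact Nat.le_ceil _

/-- A single choice of the constants hidden in Θ̃ is needed, because the constructed graphs have the
right density up to a constant factor. -/
theorem flowAlgorithm_of_solvable {ε c : ℝ} (h : UncapAllPairsSolvable ε c) :
    ∃ (p : Prog) (C κ : ℕ), 1 ≤ C ∧ FlowAlgorithm ε c p C κ := by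
  obtain ⟨p, C, κ, h⟩ := h 128 0
  refine ⟨p, C + 1, κ, by omega, fun G hG => ?_⟩
  obtain ⟨w, t, s, h1, h2, h3, h4, h5⟩ := h G hG
  have hT : (0 : ℝ) ≤ ((G.n : ℝ) * (G.m : ℝ)) ^ (1 - ε) := by positivity
  have hC : (C : ℝ) ≤ (C + 1 : ℕ) := Nat.cast_le.2 (by omega)
  exact ⟨w, t, s, h1.trans (by gcongr), h2, h3, h4.trans (by gcongr), h5⟩

/-- The program uses words of size polynomial in `2 ^ n`, while the model grants a polynomial in the
input size `S` and the time bound `T`. From `2 ^ n ≤ T ^ 2` follows `2 ^ n * length ≤ (S + T) ^ 3`,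
hence the exponent `3 * D`. -/
theorem solvableInTime_of_satProgram {q : Prog} {K D r : ℕ} {b : Bool} {P : CNFFormula → Prop}
    {T : CNFFormula → ℝ} {correct : CNFFormula → (ℕ → ℕ) → Prop}
    (hq : ∀ Φ : CNFFormula, ∃ (w t : ℕ) (s : State),
      2 ^ w ≤ K * (2 ^ Φ.n * Φ.encode.length) ^ D ∧ (∀ x ∈ Φ.encode, x < 2 ^ w) ∧
      Exec (2 ^ w) q (init Φ.encode) s t ∧
      t ≤ K * (2 ^ (Φ.n - Φ.n / r) * (Φ.n + 1) ^ 3 * (Φ.m + 1) ^ 12) ∧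
      s.mem 1 0 = bif b then Φ.m - Φ.minUnsat else 1 - Φ.minUnsat)
    (hcorrect : ∀ Φ out, out 0 = (bif b then Φ.m - Φ.minUnsat else 1 - Φ.minUnsat) → correct Φ out)
    (hT0 : ∀ Φ, 0 ≤ T Φ) (hT1 : ∀ Φ, (2 : ℝ) ^ Φ.n ≤ T Φ ^ 2) (K' : ℕ)
    (hT2 : ∀ Φ, P Φ → (2 : ℝ) ^ (Φ.n - Φ.n / r) * ((Φ.n : ℝ) + 1) ^ 3 * ((Φ.m : ℝ) + 1) ^ 12 ≤
      K' * T Φ) : SolvableInTime P CNFFormula.encode correct T := by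
  refine ⟨q, K * (K' + 1), 3 * D, fun Φ hΦ => ?_⟩
  obtain ⟨w, t, s, h1, h2, h3, h4, h5⟩ := hq Φ
  have hT := hT0 Φ
  refine ⟨w, t, s, ?_, h2, h3, ?_, hcorrect Φ _ h5⟩
  · have h1' := (Nat.cast_le (α := ℝ)).2 h1
    rw [Nat.cast_pow, Nat.cast_mul, Nat.cast_pow, Nat.cast_mul, Nat.cast_pow, Nat.cast_ofNat] at h1'
    have hS : (Φ.encode.length : ℝ) ≤ (Φ.encode.length + Φ.encode.sum : ℕ) :=
      Nat.cast_le.2 (Nat.le_add_right _ _)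
    refine h1'.trans ?_
    generalize ((Φ.encode.length + Φ.encode.sum : ℕ) : ℝ) = S at *
    have hl : (0 : ℝ) ≤ Φ.encode.length := Nat.cast_nonneg _
    generalize (Φ.encode.length : ℝ) = l at *
    have h6 : (2 : ℝ) ^ Φ.n * l ≤ (S + T Φ) ^ 3 := by
      calc (2 : ℝ) ^ Φ.n * l ≤ T Φ ^ 2 * S := by gcongr; exact hT1 Φ
        _ ≤ (S + T Φ) ^ 2 * (S + T Φ) := by gcongr <;> linarith
        _ = _ := by ring
    have h7 : (K : ℝ) ≤ (K * (K' + 1) : ℕ) := Nat.cast_le.2 (Nat.le_mul_of_pos_right _ (by omega))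
    have h8 : (0 : ℝ) ≤ 2 ^ Φ.n := by positivity
    rw [pow_mul (S + T Φ)]
    exact mul_le_mul h7 (pow_le_pow_left₀ (mul_nonneg h8 hl) h6 _)
      (pow_nonneg (mul_nonneg h8 hl) _) (Nat.cast_nonneg _)
  · have h4' := (Nat.cast_le (α := ℝ)).2 h4
    push_cast at h4'
    refine h4'.trans ((mul_le_mul_of_nonneg_left (hT2 Φ hΦ) (Nat.cast_nonneg _)).trans ?_)
    push_cast
    have : (0 : ℝ) ≤ K * T Φ := by positivity
    linarith

theorem two_pow_le_sq {δ T : ℝ} (hδ : δ ≤ 1 / 2) (n : ℕ) (hT : (2 : ℝ) ^ ((1 - δ) * n) ≤ T) :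
    (2 : ℝ) ^ n ≤ T ^ 2 := by
  calc (2 : ℝ) ^ n = 2 ^ ((n : ℕ) : ℝ) := (Real.rpow_natCast _ _).symm
    _ ≤ 2 ^ ((1 - δ) * n * (2 : ℕ)) := by
        refine Real.rpow_le_rpow_of_exponent_le (by norm_num) ?_
        have : (0 : ℝ) ≤ n := Nat.cast_nonneg _
        push_cast
        nlinarith
    _ = (2 ^ ((1 - δ) * n)) ^ 2 := Real.rpow_mul_natCast (by norm_num) _ _
    _ ≤ T ^ 2 := by gcongr

end WordRAM

theorem theorem3 (ε : ℝ) (hε : 0 < ε) :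
    ∃ δ : ℝ, 0 < δ ∧ ∀ c : ℝ, c ∈ Set.Icc (1 : ℝ) 2 → UncapAllPairsSolvable ε c →
      MaxCNFSATSolvable δ ∧ ¬ SETH := by
  obtain ⟨r, hr, hrε⟩ : ∃ r : ℕ, 3 ≤ r ∧ 1 / (r : ℝ) ≤ ε := by
    obtain ⟨r, hr⟩ := exists_nat_ge (1 / ε)
    refine ⟨max 3 r, le_max_left _ _, ?_⟩
    rw [one_div_le (by positivity) hε]
    exact hr.trans (Nat.cast_le.2 (le_max_right _ _))
  have hδ0 : (0 : ℝ) < 1 / (2 * (r : ℝ)) := by positivity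
  have hδ : 1 / (2 * (r : ℝ)) ≤ 1 / 2 := by
    have : (3 : ℝ) ≤ r := by exact_mod_cast hr
    exact one_div_le_one_div_of_le (by norm_num) (by linarith)
  refine ⟨1 / (2 * (r : ℝ)), hδ0, fun c hc h => ?_⟩
  obtain ⟨p, C, κ, hC, hp⟩ := WordRAM.flowAlgorithm_of_solvable h
  constructor
  · intro D
    obtain ⟨q, K, E, hq⟩ := WordRAM.exists_satProgram hp hc hr hrε hC true
    -- With `m ≤ D * n` the factor `(m + 1) ^ 12` turns into a polynomial in `n`, and `15 = 3 + 12`.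
    obtain ⟨K', hK'⟩ := WordRAM.exists_pow_le (r := r) (by omega) 15
    refine WordRAM.solvableInTime_of_satProgram (K' := K' * (D + 1) ^ 12) hq
      (fun Φ out ho => Φ.maxSatOutput_iff ho) (fun Φ => by positivity)
      (fun Φ => WordRAM.two_pow_le_sq hδ _ le_rfl) fun Φ hm => ?_
    have hm' : ((Φ.m : ℝ) + 1) ≤ (D + 1) * ((Φ.n : ℝ) + 1) := by
      have : Φ.m + 1 ≤ (D + 1) * (Φ.n + 1) := by nlinarith
      exact_mod_cast this
    calc (2 : ℝ) ^ (Φ.n - Φ.n / r) * ((Φ.n : ℝ) + 1) ^ 3 * ((Φ.m : ℝ) + 1) ^ 12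
        ≤ (2 : ℝ) ^ (Φ.n - Φ.n / r) * ((Φ.n : ℝ) + 1) ^ 3 * ((D + 1) * ((Φ.n : ℝ) + 1)) ^ 12 := by
          gcongr
      _ = (D + 1) ^ 12 * ((2 : ℝ) ^ (Φ.n - Φ.n / r) * ((Φ.n : ℝ) + 1) ^ 15) := by ring
      _ ≤ (D + 1) ^ 12 * (K' * 2 ^ ((1 - 1 / (2 * (r : ℝ))) * Φ.n)) := by
          exact mul_le_mul_of_nonneg_left (hK' _) (by positivity)
      _ = _ := by push_cast; ring
  · intro hS
    obtain ⟨k, -, hk⟩ := hS _ hδ0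
    -- The clause width plays no role: one program serves all `k`, and the factor `(m + 1) ^ 12` is
    -- permitted by `KSATSolvable`.
    refine hk ⟨12, ?_⟩
    obtain ⟨q, K, E, hq⟩ := WordRAM.exists_satProgram hp hc hr hrε hC false
    obtain ⟨K', hK'⟩ := WordRAM.exists_pow_le (r := r) (by omega) 3
    refine WordRAM.solvableInTime_of_satProgram (K' := K') hq
      (fun Φ out ho => Φ.satOutput_iff ho) (fun Φ => by positivity)
      (fun Φ => WordRAM.two_pow_le_sq hδ _ ?_) fun Φ _ => ?_
    · exact le_mul_of_one_le_right (by positivity)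
        (one_le_pow₀ (by linarith [Nat.cast_nonneg (α := ℝ) Φ.m]))
    · rw [← mul_assoc]
      exact mul_le_mul_of_nonneg_right (hK' _) (by positivity)
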